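/- For Boolean matrices $A,B\in\{0,1\}^{n\times n}$, Boolean matrix multiplication (BMM) asks for the matrix $C$ with $C_{ij}=\bigvee_k (A_{ik}\wedge B_{kj})$. Witnessing BMM (WBMM) asks for a matrix $W$ such that $W_{ij}$ is some index $k$ with $A_{ik}=B_{kj}=1$ if such a $k$ exists, and $W_{ij}=\emptyset$ otherwise. Theorem. BMM can be computed with high probability in $O\bigl((n^3\log n)^{\log 6/\log 7}\bigr)\le O(n^{2.763})$ bit operations, and WBMM can be computed with high probability in $O\bigl((n^3\log n)^{\log 6/\log 7}\bigr)\le O(n^{2.763})$ integer operations. Explicitly: $(n^3\log n)^{\log 6/\log 7}=O(n^{2.763})$, and for each of the two problems and every $d\in\mathbb N$ there are a randomized random access machine program and a constant $K$ such that for all $n\ge 2$ and all $A,B\in\{0,1\}^{n\times n}$, with probability at least $1-n^{-d}$ over its random bits, the program halts on input $(n,A,B)$ within $K(n^3\log n)^{\log 6/\log 7}$ operations with a correct output. The machine has finitely many registers holding natural numbers of $O(\log n)$ bits, used also for addresses. Its operations, each of cost one, are: loading a constant, addition, truncated subtraction, halving, multiplication of two numbers each of which fits in a memory cell, reading or writing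 one memory cell, drawing a fair random bit, and testing $a<b$ for a branch or a loop. For BMM a memory cell holds a single bit ("bit operations"); for WBMM it holds a natural number of $O(\log n)$ bits ("integer operations"). -/

import Mathlib

open MeasureTheory

namespace BMM

/-! ### Boolean matrix multiplication and witnesses -/

/-- The Boolean product: `C i j = ⋁ k, A i k ∧ B k j`. -/
def boolMul {n : ℕ} (A B : Matrix (Fin n) (Fin n) Bool) : Matrix (Fin n) (Fin n) Bool :=
  fun i j => decide (∃ k, A i k = true ∧ B k j = true)

/-- `W` is a witness matrix for the Boolean product of `A` and `B`: the entry `some k` is a valid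
witness, and the entry `none` (that is, `∅`) occurs exactly where there is no witness. -/
def IsWitnessMatrix {n : ℕ} (A B : Matrix (Fin n) (Fin n) Bool)
    (W : Matrix (Fin n) (Fin n) (Option (Fin n))) : Prop :=
  ∀ i j, (∀ k, W i j = some k → A i k = true ∧ B k j = true) ∧
    (W i j = none → ∀ k, ¬ (A i k = true ∧ B k j = true))

/-! ### Randomized random access machines

A program has finitely many registers (those named in its text) holding `w`-bit words, and
a random access memory of `2 ^ w` cells, each holding a `c`-bit number.
* For `c = 1` this is a bit machine: memory consists of single bits, one instruction reads or writes
  at most one of them, and multiplication acts on bits only.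
* For `c = w` this is the usual word RAM: integers of `w` bits in registers and memory.

Every instruction and every test has cost one; address computations and loop control are charged
as well. A run in which a value does not fit where it is put is stuck. -/

/-- The instructions. Register and cell contents are natural numbers; `a`, `b`, `r` name registers.
* `const r k`: `r := k`
* `add r a b`: `r := a + b`
* `sub r a b`: `r := a - b`, truncated at `0`
* `half r a`: `r := ⌊a / 2⌋`
* `mul r a b`: `r := a * b`, where both factors must fit in a memory cell
* `load r a`: `r :=` content of the cell whose address is in `a`
* `store a r`: the cell whose address is in `a` receives the content of `r`
* `coin r`: `r :=` a fresh fair random bit -/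
inductive Instr where
  | const (r k : ℕ)
  | add (r a b : ℕ)
  | sub (r a b : ℕ)
  | half (r a : ℕ)
  | mul (r a b : ℕ)
  | load (r a : ℕ)
  | store (a r : ℕ)
  | coin (r : ℕ)

/-- Structured programs. `branch a b p q` is `if a < b then p else q`, and
`loop a b p` is `while a < b do p`, where `a`, `b` are the contents of the named registers. -/
inductive Prog where
  | nop
  | instr (i : Instr)
  | seq (p q : Prog)
  | branch (a b : ℕ) (p q : Prog)
  | loop (a b : ℕ) (p : Prog)

/-- Register contents, cell contents, and the number of random bits used so far. -/
structure State where
  reg : ℕ → ℕ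
  mem : ℕ → ℕ
  used : ℕ

/-- Put `v` into register `r`, provided that it is a `w`-bit number. -/
def State.setReg (w : ℕ) (σ : State) (r v : ℕ) : Option State :=
  if v < 2 ^ w then some { σ with reg := Function.update σ.reg r v } else none

/-- The effect of one instruction with word width `w`, cell width `c` and random bits `ω`;
`none` means that the machine is stuck. -/
def Instr.exec (w c : ℕ) (ω : ℕ → Bool) (σ : State) : Instr → Option State
  | .const r k => σ.setReg w r k
  | .add r a b => σ.setReg w r (σ.reg a + σ.reg b)
  | .sub r a b => σ.setReg w r (σ.reg a - σ.reg b)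
  | .half r a => σ.setReg w r (σ.reg a / 2)
  | .mul r a b =>
      if σ.reg a < 2 ^ c ∧ σ.reg b < 2 ^ c then σ.setReg w r (σ.reg a * σ.reg b) else none
  | .load r a => σ.setReg w r (σ.mem (σ.reg a))
  | .store a r =>
      if σ.reg r < 2 ^ c then some { σ with mem := Function.update σ.mem (σ.reg a) (σ.reg r) }
      else none
  | .coin r => State.setReg w { σ with used := σ.used + 1 } r (ω σ.used).toNat

/-- `Exec w c ω p σ t τ`: started in state `σ`, with random bits `ω`, the program `p` halts after
exactly `t` operations in state `τ`. -/
inductive Exec (w c : ℕ) (ω : ℕ → Bool) : Prog → State → ℕ → State → Prop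
  | nop (σ : State) : Exec w c ω .nop σ 0 σ
  | instr (i : Instr) (σ τ : State) (h : i.exec w c ω σ = some τ) :
      Exec w c ω (.instr i) σ 1 τ
  | seq (p q : Prog) (σ τ υ : State) (t u : ℕ) (hp : Exec w c ω p σ t τ)
      (hq : Exec w c ω q τ u υ) : Exec w c ω (.seq p q) σ (t + u) υ
  | branch_true (a b : ℕ) (p q : Prog) (σ τ : State) (t : ℕ) (h : σ.reg a < σ.reg b)
      (hp : Exec w c ω p σ t τ) : Exec w c ω (.branch a b p q) σ (t + 1) τ
  | branch_false (a b : ℕ) (p q : Prog) (σ τ : State) (t : ℕ) (h : ¬ σ.reg a < σ.reg b)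
      (hq : Exec w c ω q σ t τ) : Exec w c ω (.branch a b p q) σ (t + 1) τ
  | loop_stop (a b : ℕ) (p : Prog) (σ : State) (h : ¬ σ.reg a < σ.reg b) :
      Exec w c ω (.loop a b p) σ 1 σ
  | loop_step (a b : ℕ) (p : Prog) (σ τ υ : State) (t u : ℕ) (h : σ.reg a < σ.reg b)
      (hp : Exec w c ω p σ t τ) (hl : Exec w c ω (.loop a b p) τ u υ) :
      Exec w c ω (.loop a b p) σ (t + u + 1) υ

/-- The law of an infinite sequence of independent fair random bits. -/
noncomputable def coinMeasure : Measure (ℕ → Bool) :=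
  Measure.infinitePi fun _ => (PMF.uniformOfFintype Bool).toMeasure

/-! ### Input and output -/

open Classical in
/-- Initial state: register `0` holds the dimension `n`, cells `0, …, n² - 1` hold `A` and cells
`n², …, 2n² - 1` hold `B` (row by row, one entry per cell); everything else is zero. -/
noncomputable def inputState {n : ℕ} (A B : Matrix (Fin n) (Fin n) Bool) : State where
  reg := fun r => if r = 0 then n else 0
  mem := fun a =>
    if (∃ i j : Fin n, a = i * n + j ∧ A i j = true) ∨
        (∃ i j : Fin n, a = n * n + i * n + j ∧ B i j = true) then 1 else 0
  used := 0

/-- The cells `2n², …, 3n² - 1` hold the Boolean matrix `C`, row by row. -/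
def OutputsBool {n : ℕ} (C : Matrix (Fin n) (Fin n) Bool) (τ : State) : Prop :=
  ∀ i j : Fin n, τ.mem (2 * (n * n) + i * n + j) = (C i j).toNat

/-- The cells `2n², …, 3n² - 1` hold `W`, row by row, where `none` is written as `0` and
`some k` as `k + 1` (with indices `k` counted from `0`). -/
def OutputsWitness {n : ℕ} (W : Matrix (Fin n) (Fin n) (Option (Fin n))) (τ : State) : Prop :=
  ∀ i j : Fin n, τ.mem (2 * (n * n) + i * n + j) = (W i j).elim 0 (fun k => (k : ℕ) + 1)

/-- The set of random bit sequences for which program `p`, run with word width `w` and cell width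
`c` on input `A`, `B`, halts within `T` operations in a state satisfying `good`. -/
def successEvent (w c : ℕ) (p : Prog) {n : ℕ} (A B : Matrix (Fin n) (Fin n) Bool) (T : ℝ)
    (good : State → Prop) : Set (ℕ → Bool) :=
  {ω | ∃ (t : ℕ) (τ : State), Exec w c ω p (inputState A B) t τ ∧ (t : ℝ) ≤ T ∧ good τ}

/-- The function `(n³ log n) ^ (log 6 / log 7)`. -/
noncomputable def rate (n : ℕ) : ℝ :=
  ((n : ℝ) ^ 3 * Real.log n) ^ (Real.log 6 / Real.log 7)

end BMM

namespace BMM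

set_option linter.constructorNameAsVariable false

/-! ### Named variables, expressions and structured commands -/

/-! Winograd's form of Strassen's algorithm for 2 × 2 matrices computes the product `a₀₁ b₁₀`
separately and uses it for the entry `c₀₀` only. Without that product, six multiplications still
compute seven of the eight terms `a i k * b k j` (`six_products`). The `L`-th Kronecker power takes
`6 ^ L` multiplications and computes the `7 ^ L` terms selected by `good` among the `8 ^ L` terms of
a product of `D × D` matrices, `D = 2 ^ L` (`partial_product`, `sum_good`).

Let `N = 2 ^ m` be the least power of two with `n ≤ N`, and let `L` be least with `7 ^ L ≥ m * N ^
3`. Independent uniform maps `f, h : [D] → [N]` and `g : [D] → [2 ^ e]`, `e ≥ m`, produce `D × D`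
matrices with entries `A (f i) (g k)` and `B (g k) (h j)`, padded by zeros. Fix an entry `(x, y)`
with witness set `S`. If `f i = x` and `h j = y`, then the `(i, j)` entry of the partial product is
the sum over the computed terms with `g k ∈ S`. If there is exactly one such `k`, the witness is
isolated: the sum is odd, and if row `z` of `B` carries the weight `z + 1`, the sum modulo `n + 1`
reveals `z`. A nonzero sum, conversely, always proves that a witness exists, and a proposed witness
can be checked, so errors are one-sided.

Isolation is likely by a second moment argument (`avg_failure`). With `p = 1 / N` and `ρ = |S| / 2 ^
e`, the expected number of computed terms with `f i = x` and `g k ∈ S` is `μ = p * ρ * 7 ^ L`. The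
second moments factor over binary digits into powers of 25 and 13, and for `ρ` close to `1 / N` the
relative variance and the proportion of collisions in a column are exponentially small in `L`. So at
least `μ / 4` columns isolate a witness with high probability, and the map `h` misses `y` on all of
them with probability at most `exp (-μ / (4 * N))`, where `μ / N ≥ m`. Altogether one run fails with
probability at most `77 * L * 0.99 ^ L` (`failure_rate`).

As `|S|` is unknown, `e` runs through 64 scales in steps of about `m / 64`. One of them satisfies `1
/ N ≤ ρ ≤ 2 ^ (m / 64 + 1) / N`, and the excess is absorbed by the exponential slack
(`numeric_bound`). Thus the number of scales is constant, and so is the number `R` of repetitions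
that makes the failure probability polynomially small (`repeated_failure`, `exists_repetitions`); a
union bound over the `n ^ 2` entries finishes the probabilistic part (`measure_allIsolated`).

The Kronecker powers are applied digit by digit, in `O(6 ^ L)` operations (`transform_spec`), and
reading the rearranged matrices takes `O(L * 4 ^ L)`. Since `6 = 7 ^ (log 6 / log 7)` and `7 ^ L =
O(n ^ 3 log n)`, the total is of the claimed order (`six_pow_le_rate`). The rest implements this in
a small language over named variables, compiled to the machine and verified by a calculus of total
correctness with time bounds (`Tot`). -/

/-- The program variables. -/
inductive Var where
  | n | m | N | L | X | P | d2 | d4 | nn | md | mm | tb | rb | step | e | cnt | rp | s | r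
  | gb | hb | ab | p | t | a | q | h | i | k | pw | c | adr | wd | v | vn | x | xn | y
  | src | sz | M | l | dst | acc | rho | fa | bb | z | pc
  deriving DecidableEq

/-- The register that holds a variable. -/
def Var.idx : Var → ℕ
  | n => 0 | m => 1 | N => 2 | L => 3 | X => 4 | P => 5 | d2 => 6 | d4 => 7 | nn => 8 | md => 9
  | mm => 10 | tb => 11 | rb => 12 | step => 13 | e => 14 | cnt => 15 | rp => 16 | s => 17 | r => 18
  | gb => 19 | hb => 20 | ab => 21 | p => 22 | t => 23 | a => 24 | q => 25 | h => 26 | i => 27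
  | k => 28 | pw => 29 | c => 30 | adr => 31 | wd => 32 | v => 33 | vn => 34 | x => 35 | xn => 36
  | y => 37 | src => 38 | sz => 39 | M => 40 | l => 41 | dst => 42 | acc => 43 | rho => 44 | fa => 45
  | bb => 46 | z => 47 | pc => 48

/-- Registers from this one on hold intermediate results. -/
def scratch : ℕ := 64

theorem Var.idx_lt (v : Var) : v.idx < scratch := by
  cases v <;> decide

theorem Var.idx_injective : Function.Injective Var.idx := by
  intro u v h
  cases u <;> first
    | (cases v <;> first | rfl | exact absurd h (by decide))

/-- The part of a machine state that programs over variables refer to. -/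
structure Store where
  env : Var → ℕ
  mem : ℕ → ℕ
  used : ℕ

def Store.set (s : Store) (v : Var) (x : ℕ) : Store := { s with env := Function.update s.env v x }

def Store.put (s : Store) (a x : ℕ) : Store := { s with mem := Function.update s.mem a x }

def Store.tick (s : Store) : Store := { s with used := s.used + 1 }

section
variable (s : Store) (u v : Var) (a b x : ℕ)

@[simp] theorem Store.set_env : (s.set v x).env u = if u = v then x else s.env u := by
  simp [Store.set, Function.update_apply]
@[simp] theorem Store.set_mem : (s.set v x).mem = s.mem := rfl
@[simp] theorem Store.set_used : (s.set v x).used = s.used := rfl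
@[simp] theorem Store.put_env : (s.put a x).env = s.env := rfl
@[simp] theorem Store.put_mem : (s.put a x).mem b = if b = a then x else s.mem b := by
  simp [Store.put, Function.update_apply]
@[simp] theorem Store.put_used : (s.put a x).used = s.used := rfl
@[simp] theorem Store.tick_env : s.tick.env = s.env := rfl
@[simp] theorem Store.tick_mem : s.tick.mem = s.mem := rfl
@[simp] theorem Store.tick_used : s.tick.used = s.used + 1 := rfl
end

/-- The machine state `σ` agrees with the store `s`. -/
def Rep (σ : State) (s : Store) : Prop :=
  (∀ v : Var, σ.reg v.idx = s.env v) ∧ σ.mem = s.mem ∧ σ.used = s.used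

inductive Expr where
  | lit (k : ℕ)
  | var (v : Var)
  | add (a b : Expr)
  | sub (a b : Expr)
  | half (a : Expr)
  | mul (a b : Expr)
  | load (a : Expr)

namespace Expr

def eval (s : Store) : Expr → ℕ
  | lit k => k
  | var v => s.env v
  | add a b => a.eval s + b.eval s
  | sub a b => a.eval s - b.eval s
  | half a => a.eval s / 2
  | mul a b => a.eval s * b.eval s
  | load a => s.mem (a.eval s)

/-- Evaluation does not overflow with word width `w` and cell width `c`. -/
def ok (w c : ℕ) (s : Store) : Expr → Prop
  | lit k => k < 2 ^ w
  | var _ => True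
  | add a b => a.ok w c s ∧ b.ok w c s ∧ a.eval s + b.eval s < 2 ^ w
  | sub a b => a.ok w c s ∧ b.ok w c s ∧ a.eval s - b.eval s < 2 ^ w
  | half a => a.ok w c s ∧ a.eval s / 2 < 2 ^ w
  | mul a b => a.ok w c s ∧ b.ok w c s ∧ a.eval s < 2 ^ c ∧ b.eval s < 2 ^ c ∧
      a.eval s * b.eval s < 2 ^ w
  | load a => a.ok w c s ∧ s.mem (a.eval s) < 2 ^ w

def isVar : Expr → Bool
  | var _ => true
  | _ => false

/-- The register that holds the value of an expression once it has been computed. -/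
def opnd : Expr → ℕ → ℕ
  | var v, _ => v.idx
  | _, t => t

/-- Code that computes an expression into the register `d`, with scratch registers from `t` on. -/
def emit : Expr → ℕ → ℕ → Prog
  | lit k, _, d => .instr (.const d k)
  | var v, t, d => .seq (.instr (.const t 0)) (.instr (.add d v.idx t))
  | add a b, t, d =>
      .seq (if a.isVar then .nop else a.emit t t)
        (.seq (if b.isVar then .nop else b.emit (t + 1) (t + 1))
          (.instr (.add d (a.opnd t) (b.opnd (t + 1)))))
  | sub a b, t, d =>
      .seq (if a.isVar then .nop else a.emit t t)
        (.seq (if b.isVar then .nop else b.emit (t + 1) (t + 1))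
          (.instr (.sub d (a.opnd t) (b.opnd (t + 1)))))
  | half a, t, d => .seq (if a.isVar then .nop else a.emit t t) (.instr (.half d (a.opnd t)))
  | mul a b, t, d =>
      .seq (if a.isVar then .nop else a.emit t t)
        (.seq (if b.isVar then .nop else b.emit (t + 1) (t + 1))
          (.instr (.mul d (a.opnd t) (b.opnd (t + 1)))))
  | load a, t, d => .seq (if a.isVar then .nop else a.emit t t) (.instr (.load d (a.opnd t)))

/-- Code that makes the value of an expression available in the register `opnd`. -/
def fetch (a : Expr) (t : ℕ) : Prog := if a.isVar then .nop else a.emit t t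

def cost : Expr → ℕ
  | lit _ => 1
  | var _ => 2
  | add a b => a.cost + b.cost + 1
  | sub a b => a.cost + b.cost + 1
  | half a => a.cost + 1
  | mul a b => a.cost + b.cost + 1
  | load a => a.cost + 1

end Expr

/-! ### Correctness of the code for expressions -/

section Execution

variable {w c : ℕ} {ω : ℕ → Bool}

/-- `σ` is a machine state reached from `τ` by changing register `d` and scratch registers from `t`
on only. -/
def Keeps (t d : ℕ) (τ σ : State) : Prop :=
  (∀ r, r ≠ d → r < t → τ.reg r = σ.reg r) ∧ τ.mem = σ.mem ∧ τ.used = σ.used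

theorem Keeps.rep {t : ℕ} {τ σ : State} {s : Store} (h : Keeps t t τ σ) (hσ : Rep σ s)
    (ht : scratch ≤ t) : Rep τ s := by
  refine ⟨fun v => ?_, h.2.1.trans hσ.2.1, h.2.2.trans hσ.2.2⟩
  have := v.idx_lt
  rw [h.1 _ (by omega) (by omega), hσ.1]

theorem State.setReg_eq {σ : State} {r x : ℕ} (h : x < 2 ^ w) :
    σ.setReg w r x = some { σ with reg := Function.update σ.reg r x } := if_pos h

theorem Keeps.update {t d x : ℕ} {τ σ : State} (h : Keeps t d τ σ) :
    Keeps t d { τ with reg := Function.update τ.reg d x } σ :=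
  ⟨fun r hr hr' => by simp [hr, h.1 r hr hr'], h.2.1, h.2.2⟩

/-- What the code for an expression does. -/
def Emits (w c : ℕ) (ω : ℕ → Bool) (a : Expr) (s : Store) : Prop :=
  ∀ t d σ, scratch ≤ t → Rep σ s → ∃ k τ, Exec w c ω (a.emit t d) σ k τ ∧ k ≤ a.cost ∧
    τ.reg d = a.eval s ∧ Keeps t d τ σ

/-- A variable is read in its own register. `Expr.ok` does not bound its content, so copying it
could make the machine stuck; therefore `Emits` is only demanded of expressions other than
variables. -/
theorem Emits.fetch {a : Expr} {s : Store} (h : a.isVar = false → Emits w c ω a s) {t : ℕ} {σ : State}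
    (ht : scratch ≤ t) (hσ : Rep σ s) : ∃ k τ, Exec w c ω (a.fetch t) σ k τ ∧ k ≤ a.cost ∧
      τ.reg (a.opnd t) = a.eval s ∧ Keeps t t τ σ ∧ (a.opnd t ≤ t) := by
  by_cases hv : a.isVar
  · cases a <;> simp [Expr.isVar] at hv
    rename_i v
    refine ⟨0, σ, ?_, by simp, hσ.1 v, ⟨fun _ _ _ => rfl, rfl, rfl⟩, ?_⟩
    · simpa [Expr.fetch, Expr.isVar] using Exec.nop σ
    · have := v.idx_lt
      simp only [Expr.opnd]; omega
  · obtain ⟨k, τ, h1, h2, h3, h4⟩ := h (by simpa using hv) t t σ ht hσ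
    have ho : a.opnd t = t := by cases a <;> simp_all [Expr.isVar, Expr.opnd]
    refine ⟨k, τ, ?_, h2, ?_, h4, ho.le⟩
    · simpa [Expr.fetch, hv] using h1
    · rw [ho, h3]

theorem Keeps.widen {t : ℕ} {τ σ : State} (h : Keeps t t τ σ) (d : ℕ) : Keeps t d τ σ :=
  ⟨fun r _ hr => h.1 r (by omega) hr, h.2⟩

theorem Keeps.trans_succ {t : ℕ} {υ τ σ : State} (h : Keeps (t + 1) (t + 1) υ τ)
    (h' : Keeps t t τ σ) : Keeps t t υ σ :=
  ⟨fun r hr hr' => by rw [h.1 r (by omega) (by omega), h'.1 r hr hr'], h.2.1.trans h'.2.1,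
    h.2.2.trans h'.2.2⟩

theorem Emits.unary {a : Expr} {s : Store} (ha : a.isVar = false → Emits w c ω a s) {f : ℕ → ℕ → Instr} {x : ℕ}
    (hf : ∀ σ d r, Rep σ s → σ.reg r = a.eval s → (f d r).exec w c ω σ =
      some { σ with reg := Function.update σ.reg d x })
    {t d : ℕ} {σ : State} (ht : scratch ≤ t) (hσ : Rep σ s) :
    ∃ k τ, Exec w c ω (.seq (a.fetch t) (.instr (f d (a.opnd t)))) σ k τ ∧ k ≤ a.cost + 1 ∧
      τ.reg d = x ∧ Keeps t d τ σ := by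
  obtain ⟨k, τ, h1, h2, h3, h4, -⟩ := Emits.fetch ha ht hσ
  exact ⟨k + 1, _, .seq _ _ _ _ _ _ _ h1 (.instr _ _ _ (hf τ d _ (h4.rep hσ ht) h3)),
    by omega, by simp, (h4.widen d).update⟩

/-- The second operand uses scratch registers from `t + 1` on only, so the first one, which lies in
a register at most `t`, survives. The continuation `p` is left open to serve arithmetic, stores and
branches alike. -/
theorem Emits.binary_fetch {a b : Expr} {s : Store} (ha : a.isVar = false → Emits w c ω a s) (hb : b.isVar = false → Emits w c ω b s)
    {t : ℕ} {σ : State} (ht : scratch ≤ t) (hσ : Rep σ s) :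
    ∃ k τ, (∀ p u υ, Exec w c ω p τ u υ →
        Exec w c ω (.seq (a.fetch t) (.seq (b.fetch (t + 1)) p)) σ (k + u) υ) ∧
      k ≤ a.cost + b.cost ∧ τ.reg (a.opnd t) = a.eval s ∧ τ.reg (b.opnd (t + 1)) = b.eval s ∧
      Keeps t t τ σ := by
  obtain ⟨k, τ, h1, h2, h3, h4, h5⟩ := Emits.fetch ha ht hσ
  obtain ⟨k', τ', h1', h2', h3', h4', -⟩ := Emits.fetch hb (t := t + 1) (by omega) (h4.rep hσ ht)
  refine ⟨k + k', τ', fun p u υ hp => ?_, by omega, ?_, h3', h4'.trans_succ h4⟩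
  · rw [add_assoc]
    exact .seq _ _ _ _ _ _ _ h1 (.seq _ _ _ _ _ _ _ h1' hp)
  · rw [h4'.1 _ (by omega) (by omega), h3]

theorem Emits.binary {a b : Expr} {s : Store} (ha : a.isVar = false → Emits w c ω a s) (hb : b.isVar = false → Emits w c ω b s)
    {f : ℕ → ℕ → ℕ → Instr} {x : ℕ}
    (hf : ∀ σ d r r', σ.reg r = a.eval s → σ.reg r' = b.eval s → (f d r r').exec w c ω σ =
      some { σ with reg := Function.update σ.reg d x })
    {t d : ℕ} {σ : State} (ht : scratch ≤ t) (hσ : Rep σ s) :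
    ∃ k τ, Exec w c ω (.seq (a.fetch t) (.seq (b.fetch (t + 1))
        (.instr (f d (a.opnd t) (b.opnd (t + 1)))))) σ k τ ∧ k ≤ a.cost + b.cost + 1 ∧
      τ.reg d = x ∧ Keeps t d τ σ := by
  obtain ⟨k, τ, h1, h2, h3, h4, h5⟩ := Emits.binary_fetch ha hb ht hσ
  exact ⟨k + 1, _, h1 _ _ _ (.instr _ _ _ (hf τ d _ _ h3 h4)), by omega, by simp,
    (h5.widen d).update⟩

theorem Expr.emits (a : Expr) {s : Store} (h : a.ok w c s) (hv : a.isVar = false) :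
    Emits w c ω a s := by
  induction a with
  | lit k =>
    intro t d σ ht hσ
    exact ⟨1, _, .instr _ _ _ (State.setReg_eq h), le_rfl, by simp [eval],
      Keeps.update ⟨fun _ _ _ => rfl, rfl, rfl⟩⟩
  | var v => simp [isVar] at hv
  | add a b iha ihb =>
    obtain ⟨h1, h2, h3⟩ := h
    intro t d σ ht hσ
    refine Emits.binary (f := .add) (iha h1) (ihb h2) (fun τ d r r' e e' => ?_) ht hσ
    simp only [Instr.exec, e, e']
    exact State.setReg_eq h3
  | sub a b iha ihb =>
    obtain ⟨h1, h2, h3⟩ := h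
    intro t d σ ht hσ
    refine Emits.binary (f := .sub) (iha h1) (ihb h2) (fun τ d r r' e e' => ?_) ht hσ
    simp only [Instr.exec, e, e']
    exact State.setReg_eq h3
  | half a iha =>
    obtain ⟨h1, h2⟩ := h
    intro t d σ ht hσ
    refine Emits.unary (f := .half) (iha h1) (fun τ d r _ e => ?_) ht hσ
    simp only [Instr.exec, e]
    exact State.setReg_eq h2
  | mul a b iha ihb =>
    obtain ⟨h1, h2, h3, h4, h5⟩ := h
    intro t d σ ht hσ
    refine Emits.binary (f := .mul) (iha h1) (ihb h2) (fun τ d r r' e e' => ?_) ht hσ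
    simp only [Instr.exec, e, e', h3, h4, and_self, if_true]
    exact State.setReg_eq h5
  | load a iha =>
    obtain ⟨h1, h2⟩ := h
    intro t d σ ht hσ
    refine Emits.unary (f := .load) (iha h1) (fun τ d r hτ e => ?_) ht hσ
    simp only [Instr.exec, e]
    rw [show τ.mem (a.eval s) = (load a).eval s by rw [hτ.2.1, eval]]
    exact State.setReg_eq h2

/-! ### Total correctness with a time bound -/

/-- Started in a state that agrees with `s`, the program `p` halts within `T` operations in a state
that agrees with a store satisfying `Q`. -/
def Tot (w c : ℕ) (ω : ℕ → Bool) (p : Prog) (s : Store) (T : ℕ) (Q : Store → Prop) : Prop :=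
  ∀ σ, Rep σ s → ∃ t τ s', Exec w c ω p σ t τ ∧ t ≤ T ∧ Rep τ s' ∧ Q s'

namespace Prog

def assign (v : Var) (a : Expr) : Prog := a.emit scratch v.idx

def put (a b : Expr) : Prog :=
  .seq (a.fetch scratch) (.seq (b.fetch (scratch + 1))
    (.instr (.store (a.opnd scratch) (b.opnd (scratch + 1)))))

def toss (v : Var) : Prog := .instr (.coin v.idx)

def ite (a b : Expr) (p q : Prog) : Prog :=
  .seq (a.fetch scratch) (.seq (b.fetch (scratch + 1))
    (.branch (a.opnd scratch) (b.opnd (scratch + 1)) p q))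

def whileLt (u v : Var) (p : Prog) : Prog := .loop u.idx v.idx p

/-- For `u` from `0` to `v - 1` do `p`. -/
def forLt (u v : Var) (p : Prog) : Prog :=
  .seq (assign u (.lit 0)) (whileLt u v (.seq p (assign u (.add (.var u) (.lit 1)))))

end Prog

theorem Tot.mono {p : Prog} {s : Store} {T T' : ℕ} {Q Q' : Store → Prop} (h : Tot w c ω p s T Q)
    (hT : T ≤ T') (hQ : ∀ s, Q s → Q' s) : Tot w c ω p s T' Q' := by
  intro σ hσ
  obtain ⟨t, τ, s', h1, h2, h3, h4⟩ := h σ hσ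
  exact ⟨t, τ, s', h1, h2.trans hT, h3, hQ _ h4⟩

theorem Tot.nop {s : Store} {Q : Store → Prop} (h : Q s) : Tot w c ω .nop s 0 Q :=
  fun σ hσ => ⟨0, σ, s, .nop σ, le_rfl, hσ, h⟩

theorem Tot.seq {p q : Prog} {s : Store} {T U : ℕ} {R Q : Store → Prop}
    (hp : Tot w c ω p s T R) (hq : ∀ s', R s' → Tot w c ω q s' U Q) :
    Tot w c ω (.seq p q) s (T + U) Q := by
  intro σ hσ
  obtain ⟨t, τ, s', h1, h2, h3, h4⟩ := hp σ hσ
  obtain ⟨t', τ', s'', h1', h2', h3', h4'⟩ := hq s' h4 τ h3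
  exact ⟨t + t', τ', s'', .seq _ _ _ _ _ _ _ h1 h1', by omega, h3', h4'⟩

theorem Keeps.rep_set {τ σ : State} {s : Store} {v : Var} {x : ℕ} (h : Keeps scratch v.idx τ σ)
    (hσ : Rep σ s) (hx : τ.reg v.idx = x) : Rep τ (s.set v x) := by
  refine ⟨fun u => ?_, h.2.1.trans hσ.2.1, h.2.2.trans hσ.2.2⟩
  by_cases huv : u = v
  · simp [huv, hx]
  · rw [h.1 _ (fun e => huv (Var.idx_injective e)) u.idx_lt, hσ.1]
    simp [huv]

theorem Tot.assign {v : Var} {a : Expr} {s : Store} {Q : Store → Prop} (ha : a.ok w c s)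
    (hv : a.eval s < 2 ^ w) (hQ : Q (s.set v (a.eval s))) :
    Tot w c ω (.assign v a) s a.cost Q := by
  intro σ hσ
  by_cases h : a.isVar
  · cases a <;> simp [Expr.isVar] at h
    rename_i u
    have hu : σ.reg u.idx < 2 ^ w := by rw [hσ.1]; exact hv
    have := u.idx_lt
    have e1 : Function.update σ.reg scratch 0 u.idx = σ.reg u.idx := by
      rw [Function.update_of_ne (by omega)]
    refine ⟨2, _, _, .seq _ _ _ _ _ 1 1 (.instr _ _ _ (State.setReg_eq (by positivity)))
      (.instr _ _ _ (State.setReg_eq (by simpa [e1] using hu))), le_rfl,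
      Keeps.rep_set (σ := σ) (v := v) (Keeps.update ⟨fun r _ hr => ?_, rfl, rfl⟩) hσ ?_, hQ⟩
    · simp [Function.update_of_ne (show r ≠ scratch by omega)]
    · simp [e1, Expr.eval, hσ.1]
  · obtain ⟨k, τ, h1, h2, h3, h4⟩ := a.emits (ω := ω) ha (by simpa using h) scratch v.idx σ le_rfl hσ
    exact ⟨k, τ, _, h1, h2, h4.rep_set hσ h3, hQ⟩

theorem Tot.put {a b : Expr} {s : Store} {Q : Store → Prop} (ha : a.ok w c s) (hb : b.ok w c s)
    (hv : b.eval s < 2 ^ c) (hQ : Q (s.put (a.eval s) (b.eval s))) :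
    Tot w c ω (.put a b) s (a.cost + b.cost + 1) Q := by
  intro σ hσ
  obtain ⟨k, τ, h1, h2, h3, h4, h5⟩ :=
    Emits.binary_fetch (ω := ω) (a.emits ha) (b.emits hb) le_rfl hσ
  have hτ := h5.rep hσ le_rfl
  refine ⟨k + 1, _, _, h1 _ _ _ (.instr _ _ _ (?_ : _ = some { τ with
    mem := Function.update τ.mem (a.eval s) (b.eval s) })), by omega, ⟨hτ.1, ?_, hτ.2.2⟩, hQ⟩
  · simp [Instr.exec, h3, h4, hv]
  · simp [Store.put, hτ.2.1]

theorem Tot.toss {v : Var} {s : Store} {Q : Store → Prop} (hw : 1 ≤ w)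
    (hQ : Q (s.tick.set v (ω s.used).toNat)) : Tot w c ω (.toss v) s 1 Q := by
  intro σ hσ
  have h2 : (ω σ.used).toNat < 2 ^ w :=
    (Bool.toNat_lt _).trans_le (by simpa using Nat.pow_le_pow_right (n := 2) (by simp) hw)
  refine ⟨1, _, s.tick.set v (ω s.used).toNat, .instr _ _ _ (State.setReg_eq h2), le_rfl,
    ⟨fun u => ?_, hσ.2.1, ?_⟩, hQ⟩
  · by_cases huv : u = v
    · simp [huv, hσ.2.2]
    · have : u.idx ≠ v.idx := fun e => huv (Var.idx_injective e)
      simp [huv, this, hσ.1]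
  · simp [hσ.2.2]

theorem Tot.ite {a b : Expr} {p q : Prog} {s : Store} {T U : ℕ} {Q : Store → Prop}
    (ha : a.ok w c s) (hb : b.ok w c s) (hp : a.eval s < b.eval s → Tot w c ω p s T Q)
    (hq : ¬ a.eval s < b.eval s → Tot w c ω q s U Q) :
    Tot w c ω (.ite a b p q) s (a.cost + b.cost + 1 + (T + U)) Q := by
  intro σ hσ
  obtain ⟨k, τ, h1, h2, h3, h4, h5⟩ :=
    Emits.binary_fetch (ω := ω) (a.emits ha) (b.emits hb) le_rfl hσ
  have hτ := h5.rep hσ le_rfl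
  by_cases h : a.eval s < b.eval s
  · obtain ⟨t, υ, s', e1, e2, e3, e4⟩ := hp h τ hτ
    exact ⟨k + (t + 1), υ, s', h1 _ _ _ (.branch_true _ _ _ _ _ _ _ (by rwa [h3, h4]) e1),
      by omega, e3, e4⟩
  · obtain ⟨t, υ, s', e1, e2, e3, e4⟩ := hq h τ hτ
    exact ⟨k + (t + 1), υ, s', h1 _ _ _ (.branch_false _ _ _ _ _ _ _ (by rwa [h3, h4]) e1),
      by omega, e3, e4⟩

/-- A loop with the invariant `I`, executed `N` times; the `k`-th iteration takes time `T k`. -/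
theorem Tot.whileLt_sum {u v : Var} {p : Prog} {s : Store} {N : ℕ} {T : ℕ → ℕ}
    {I : ℕ → Store → Prop} (h0 : I 0 s)
    (hI : ∀ k s, k < N → I k s → s.env u < s.env v ∧ Tot w c ω p s (T k) (I (k + 1)))
    (hN : ∀ s, I N s → ¬ s.env u < s.env v) :
    Tot w c ω (.whileLt u v p) s (∑ k ∈ Finset.range N, (T k + 1) + 1) (I N) := by
  -- Induction on the number `j` of remaining iterations, because `Exec` unfolds a loop at its
  -- front.
  suffices ∀ j k s, k + j = N → I k s → Tot w c ω (.whileLt u v p) s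
      (∑ i ∈ Finset.range j, (T (k + i) + 1) + 1) (I N) by
    simpa using this N 0 s (by omega) h0
  intro j
  induction j with
  | zero =>
    intro k s hk hs σ hσ
    obtain rfl : k = N := by omega
    refine ⟨1, σ, s, Exec.loop_stop _ _ _ _ ?_, by omega, hσ, hs⟩
    rw [hσ.1, hσ.1]
    exact hN s hs
  | succ j ih =>
    intro k s hk hs σ hσ
    obtain ⟨h1, h2⟩ := hI k s (by omega) hs
    obtain ⟨t, τ, s', e1, e2, e3, e4⟩ := h2 σ hσ
    obtain ⟨t', τ', s'', e1', e2', e3', e4'⟩ := ih (k + 1) s' (by omega) e4 τ e3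
    refine ⟨t + t' + 1, τ', s'', .loop_step _ _ _ _ _ _ _ _ ?_ e1 e1', ?_, e3', e4'⟩
    · rwa [hσ.1, hσ.1]
    · rw [Finset.sum_range_succ']
      simp only [add_zero, ← add_assoc, add_right_comm k _ 1] at e2' ⊢
      omega

/-- A loop with the invariant `I`, executed `N` times. -/
theorem Tot.whileLt {u v : Var} {p : Prog} {s : Store} {T N : ℕ} {I : ℕ → Store → Prop}
    (h0 : I 0 s) (hI : ∀ k s, k < N → I k s → s.env u < s.env v ∧ Tot w c ω p s T (I (k + 1)))
    (hN : ∀ s, I N s → ¬ s.env u < s.env v) :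
    Tot w c ω (.whileLt u v p) s (N * (T + 1) + 1) (I N) := by
  simpa using Tot.whileLt_sum (T := fun _ => T) h0 hI hN

/-- A loop over `u < v` with the invariant `I`; the `k`-th iteration takes time `T k`. -/
theorem Tot.forLt_sum {u v : Var} {p : Prog} {s : Store} {N : ℕ} {T : ℕ → ℕ}
    {I : ℕ → Store → Prop} (huv : u ≠ v) (hs : s.env v = N) (hNw : N < 2 ^ w) (h0 : I 0 (s.set u 0))
    (hI : ∀ k s, k < N → s.env u = k → s.env v = N → I k s → Tot w c ω p s (T k) fun s' =>
      s'.env u = k ∧ s'.env v = N ∧ I (k + 1) (s'.set u (k + 1))) :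
    Tot w c ω (.forLt u v p) s (∑ k ∈ Finset.range N, (T k + 5) + 2)
      fun s => s.env u = N ∧ s.env v = N ∧ I N s := by
  -- In each iteration the increment costs 4 and the test 1; the initial assignment and the last
  -- test make up the final 2.
  refine (Tot.seq (T := 1) (R := fun s' => s'.env u = 0 ∧ s'.env v = N ∧ I 0 s')
    (Tot.assign (by simp [Expr.ok]) (by simp [Expr.eval]) ?_) (fun s' hs' =>
    Tot.whileLt_sum (T := fun k => T k + 4) (N := N)
      (I := fun k s => s.env u = k ∧ s.env v = N ∧ I k s) hs' ?_ ?_)).mono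
    (by simp only [add_assoc, Nat.reduceAdd]; omega) (fun _ h => h)
  · simp [huv.symm, hs, Expr.eval, h0]
  · rintro k s hk ⟨h1, h2, h3⟩
    refine ⟨by omega, Tot.seq (hI k s hk h1 h2 h3) ?_⟩
    rintro s' ⟨h1', h2', h3'⟩
    have hb : s'.env u + 1 < 2 ^ w := by omega
    refine (Tot.assign (a := .add (.var u) (.lit 1)) ?_ hb ?_).mono (by simp [Expr.cost])
      (fun _ h => h)
    · exact ⟨trivial, by simp only [Expr.ok]; omega, hb⟩
    · simp [Expr.eval, h1', huv.symm, h2', h3']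
  · rintro s ⟨h1, h2, -⟩
    omega

/-- A loop over `u < v` with the invariant `I`. -/
theorem Tot.forLt {u v : Var} {p : Prog} {s : Store} {T N : ℕ} {I : ℕ → Store → Prop}
    (huv : u ≠ v) (hs : s.env v = N) (hNw : N < 2 ^ w) (h0 : I 0 (s.set u 0))
    (hI : ∀ k s, k < N → s.env u = k → s.env v = N → I k s → Tot w c ω p s T fun s' =>
      s'.env u = k ∧ s'.env v = N ∧ I (k + 1) (s'.set u (k + 1))) :
    Tot w c ω (.forLt u v p) s (N * (T + 5) + 2) fun s => s.env u = N ∧ s.env v = N ∧ I N s := by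
  simpa using Tot.forLt_sum (T := fun _ => T) huv hs hNw h0 hI

/-! ### Frames -/

/-- The stores differ in the variables `l` only, as far as variables are concerned. -/
def Same (l : List Var) (s' s : Store) : Prop := ∀ u, u ∉ l → s'.env u = s.env u

theorem Same.refl (l : List Var) (s : Store) : Same l s s := fun _ _ => rfl

theorem Same.trans {l : List Var} {s'' s' s : Store} (h : Same l s'' s') (h' : Same l s' s) :
    Same l s'' s := fun u hu => (h u hu).trans (h' u hu)

theorem Same.weaken {l l' : List Var} {s' s : Store} (h : Same l s' s) (hl : ∀ u ∈ l, u ∈ l') :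
    Same l' s' s := fun u hu => h u (fun h => hu (hl u h))

end Execution

/-! ### Kronecker powers -/

section Kronecker
variable {R : Type*} [CommRing R]

/-- Splits off the last digit in base `b`; the inductions over Kronecker powers rest on it. -/
theorem sum_range_mul (F : ℕ → R) (a b : ℕ) :
    ∑ x ∈ Finset.range (a * b), F x =
      ∑ u ∈ Finset.range a, ∑ d ∈ Finset.range b, F (b * u + d) := by
  induction a with
  | zero => simp
  | succ a ih =>
    rw [Finset.sum_range_succ, ← ih, add_mul, one_mul, Finset.sum_range_add, mul_comm b a]

/-- The Kronecker power of a `q × p` matrix. -/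
def kron (S : ℕ → ℕ → R) (q p : ℕ) : ℕ → ℕ → ℕ → R
  | 0, _, _ => 1
  | l + 1, x, y => kron S q p l (x / q) (y / p) * S (x % q) (y % p)

/-- The vector `T` after `l` of the `L` factors of a Kronecker power have been applied to it; each
step consumes the leading digit of the index and appends a new trailing digit. -/
def stage (S : ℕ → ℕ → R) (q p L : ℕ) (T : ℕ → R) : ℕ → ℕ → R
  | 0, x => T x
  | l + 1, x => ∑ d ∈ Finset.range p,
      S (x % q) d * stage S q p L T l (x / q + d * (p ^ (L - 1 - l) * q ^ l))

/-- After `l` steps the index is `α * q ^ l + ε`, where `α` consists of the `L - l` digits in base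
`p` that are still to be consumed and `ε` of the `l` digits in base `q` already produced. The next
step sums over the leading digit of the old index, which has weight `p ^ (L - 1 - l) * q ^ l`. It is
the last digit of the column index of the partial Kronecker power. -/
theorem stage_eq_aux (S : ℕ → ℕ → R) {q p L : ℕ} (hq : 0 < q) (hp : 0 < p) (T : ℕ → R) (l : ℕ)
    (hl : l ≤ L) (α ε : ℕ) (hε : ε < q ^ l) :
    stage S q p L T l (α * q ^ l + ε) =
      ∑ δ ∈ Finset.range (p ^ l), kron S q p l ε δ * T (δ * p ^ (L - l) + α) := by
  induction l generalizing α ε with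
  | zero =>
    obtain rfl : ε = 0 := by simpa using hε
    simp [stage, kron]
  | succ l ih =>
    have e1 : (α * q ^ (l + 1) + ε) % q = ε % q := by
      rw [pow_succ, ← mul_assoc, Nat.mul_add_mod_self_right]
    have e2 : (α * q ^ (l + 1) + ε) / q = α * q ^ l + ε / q := by
      rw [pow_succ, ← mul_assoc, add_comm, Nat.add_mul_div_right _ _ hq, add_comm]
    have hε' : ε / q < q ^ l := by
      rw [Nat.div_lt_iff_lt_mul hq]; rwa [pow_succ] at hε
    have e3 : L - l = L - 1 - l + 1 := by omega
    have e4 : L - (l + 1) = L - 1 - l := by omega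
    rw [stage, e1, e2, pow_succ, sum_range_mul, Finset.sum_comm]
    refine Finset.sum_congr rfl fun d hd => ?_
    have hd := Finset.mem_range.1 hd
    rw [show α * q ^ l + ε / q + d * (p ^ (L - 1 - l) * q ^ l) =
      (d * p ^ (L - 1 - l) + α) * q ^ l + ε / q by ring, ih (by omega) _ _ hε', Finset.mul_sum]
    refine Finset.sum_congr rfl fun δ _ => ?_
    rw [kron, e3, e4, pow_succ, Nat.mul_add_mod, Nat.mod_eq_of_lt hd, Nat.mul_add_div hp,
      Nat.div_eq_of_lt hd, add_zero]
    rw [show δ * (p ^ (L - 1 - l) * p) + (d * p ^ (L - 1 - l) + α) =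
      (p * δ + d) * p ^ (L - 1 - l) + α by ring]
    ring

theorem stage_eq (S : ℕ → ℕ → R) {q p L : ℕ} (hq : 0 < q) (hp : 0 < p) (T : ℕ → R) (ε : ℕ)
    (hε : ε < q ^ L) :
    stage S q p L T L ε = ∑ δ ∈ Finset.range (p ^ L), kron S q p L ε δ * T δ := by
  simpa using stage_eq_aux S hq hp T L le_rfl 0 ε hε

end Kronecker

/-! ### Six products for seven of the eight terms -/

/-- The row of the entry with Morton index `a`. -/
def row : ℕ → ℕ → ℕ
  | 0, _ => 0
  | l + 1, a => 2 * row l (a / 4) + a % 4 / 2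

/-- The column of the entry with Morton index `a`. -/
def col : ℕ → ℕ → ℕ
  | 0, _ => 0
  | l + 1, a => 2 * col l (a / 4) + a % 2

/-- The terms `a i k * b k j` that the bilinear algorithm computes: no binary digit position has
the digits `0, 1, 0` in `i, k, j`. -/
def good : ℕ → ℕ → ℕ → ℕ → Bool
  | 0, _, _, _ => true
  | l + 1, i, k, j => good l (i / 2) (k / 2) (j / 2) && !(i % 2 == 0 && k % 2 == 1 && j % 2 == 0)

/-- The entry of a matrix that is given by its rows. -/
def entry (S : List (List ℤ)) (x y : ℕ) : ℤ := (S.getD x []).getD y 0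

/-- Winograd's variant of Strassen's algorithm without the product `a₀₁ b₁₀`. In `coeffA` and
`coeffB` a row is a product and a column a matrix entry `2 * row + column`; in `coeffC` it is the
other way round. -/
def coeffA : List (List ℤ) :=
  [[1, 0, 0, 0], [1, 1, -1, -1], [0, 0, 0, 1], [0, 0, 1, 1], [-1, 0, 1, 1], [1, 0, -1, 0]]

def coeffB : List (List ℤ) :=
  [[1, 0, 0, 0], [0, 0, 0, 1], [1, -1, -1, 1], [-1, 1, 0, 0], [1, -1, 0, 1], [0, -1, 0, 1]]

def coeffC : List (List ℤ) :=
  [[1, 0, 0, 0, 0, 0], [1, 1, 0, 1, 1, 0], [1, 0, -1, 0, 1, 1], [1, 0, 0, 1, 1, 1]]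

section Identity
variable {R : Type*} [CommRing R]

def coeff (R : Type*) [CommRing R] (S : List (List ℤ)) (x y : ℕ) : R := (entry S x y : R)

theorem six_products (c : ℕ) (hc : c < 4) (U V : ℕ → R) :
    ∑ e ∈ Finset.range 6, coeff R coeffC c e *
      ((∑ d ∈ Finset.range 4, coeff R coeffA e d * U d) *
        ∑ d ∈ Finset.range 4, coeff R coeffB e d * V d) =
      ∑ k ∈ Finset.range 2, if good 1 (c / 2) k (c % 2) then
        U (2 * (c / 2) + k) * V (2 * k + c % 2) else 0 := by
  interval_cases c <;>
  · simp [Finset.sum_range_succ, coeff, entry, coeffA, coeffB, coeffC, good]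
    try ring

theorem row_eq (L i0 a d : ℕ) (hd : d < 4) (hi : d / 2 = i0) :
    row (L + 1) (4 * a + d) = 2 * row L a + i0 := by
  rw [row, Nat.mul_add_div (by norm_num), Nat.div_eq_of_lt hd]
  simp [← hi, Nat.mod_eq_of_lt hd]

theorem col_eq (L a d : ℕ) (hd : d < 4) :
    col (L + 1) (4 * a + d) = 2 * col L a + d % 2 := by
  rw [col, Nat.mul_add_div (by norm_num), Nat.div_eq_of_lt hd]
  simp; omega

theorem good_eq (L i k j a b c : ℕ) (ha : a < 2) (hb : b < 2) (hc : c < 2) :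
    good (L + 1) (2 * i + a) (2 * k + b) (2 * j + c) = (good L i k j && good 1 a b c) := by
  rw [good, Nat.mul_add_div (by norm_num), Nat.mul_add_div (by norm_num),
    Nat.mul_add_div (by norm_num), Nat.div_eq_of_lt ha, Nat.div_eq_of_lt hb, Nat.div_eq_of_lt hc]
  simp [good]

theorem kron_mul_add (S : ℕ → ℕ → R) (q p l x y u d : ℕ) (hu : u < q) (hd : d < p) :
    kron S q p (l + 1) (q * x + u) (p * y + d) = kron S q p l x y * S u d := by
  rw [kron, Nat.mul_add_div (by omega), Nat.mul_add_div (by omega), Nat.div_eq_of_lt hu,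
    Nat.div_eq_of_lt hd, Nat.mul_add_mod, Nat.mul_add_mod, Nat.mod_eq_of_lt hu,
    Nat.mod_eq_of_lt hd, add_zero, add_zero]

/-- Induction on `L`, separating the last digit of every index. For fixed leading digits, the last
digits form an instance of `six_products` whose arguments are sums over the leading digits; the
remaining sum is the induction hypothesis for the submatrices of `X` and `Y` with prescribed last
digits. -/
theorem partial_product (L : ℕ) (c : ℕ) (X Y : ℕ → ℕ → R) :
    ∑ e ∈ Finset.range (6 ^ L), kron (coeff R coeffC) 4 6 L c e *
      ((∑ d ∈ Finset.range (4 ^ L), kron (coeff R coeffA) 6 4 L e d * X (row L d) (col L d)) *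
        ∑ d ∈ Finset.range (4 ^ L), kron (coeff R coeffB) 6 4 L e d * Y (row L d) (col L d)) =
      ∑ k ∈ Finset.range (2 ^ L), if good L (row L c) k (col L c) then
        X (row L c) k * Y k (col L c) else 0 := by
  induction L generalizing c X Y with
  | zero => simp [kron, row, col, good]
  | succ L ih =>
    obtain ⟨c', c0, hc0, rfl⟩ : ∃ c' c0, c0 < 4 ∧ c = 4 * c' + c0 :=
      ⟨c / 4, c % 4, Nat.mod_lt _ (by norm_num), (Nat.div_add_mod _ _).symm⟩
    -- A linear form of the large power is a small linear form, in the last digit, of forms of the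
    -- smaller power.
    have key (S : List (List ℤ)) (Z : ℕ → ℕ → R) (e' e0 : ℕ) (he : e0 < 6) :
        ∑ d ∈ Finset.range (4 ^ (L + 1)), kron (coeff R S) 6 4 (L + 1) (6 * e' + e0) d *
          Z (row (L + 1) d) (col (L + 1) d) =
        ∑ d0 ∈ Finset.range 4, coeff R S e0 d0 * ∑ d ∈ Finset.range (4 ^ L),
          kron (coeff R S) 6 4 L e' d * Z (2 * row L d + d0 / 2) (2 * col L d + d0 % 2) := by
      rw [pow_succ, sum_range_mul, Finset.sum_comm]
      refine Finset.sum_congr rfl fun d0 hd0 => ?_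
      have hd0 := Finset.mem_range.1 hd0
      rw [Finset.mul_sum]
      refine Finset.sum_congr rfl fun d _ => ?_
      rw [kron_mul_add _ _ _ _ _ _ _ _ he hd0, row_eq L _ d d0 hd0 rfl, col_eq L d d0 hd0]
      ring
    rw [pow_succ, sum_range_mul, pow_succ 2, sum_range_mul, row_eq L _ c' c0 hc0 rfl,
      col_eq L c' c0 hc0]
    -- The sum over the last digit `e0` of the product index, with the leading digits `e'` fixed.
    have step (e' : ℕ) : ∑ e0 ∈ Finset.range 6,
        kron (coeff R coeffC) 4 6 (L + 1) (4 * c' + c0) (6 * e' + e0) *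
        ((∑ d ∈ Finset.range (4 ^ (L + 1)), kron (coeff R coeffA) 6 4 (L + 1) (6 * e' + e0) d *
          X (row (L + 1) d) (col (L + 1) d)) *
        (∑ d ∈ Finset.range (4 ^ (L + 1)), kron (coeff R coeffB) 6 4 (L + 1) (6 * e' + e0) d *
          Y (row (L + 1) d) (col (L + 1) d))) =
        ∑ k0 ∈ Finset.range 2, if good 1 (c0 / 2) k0 (c0 % 2) then
          kron (coeff R coeffC) 4 6 L c' e' * ((∑ d ∈ Finset.range (4 ^ L),
            kron (coeff R coeffA) 6 4 L e' d * X (2 * row L d + c0 / 2) (2 * col L d + k0)) *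
          ∑ d ∈ Finset.range (4 ^ L),
            kron (coeff R coeffB) 6 4 L e' d * Y (2 * row L d + k0) (2 * col L d + c0 % 2))
        else 0 := by
      rw [Finset.sum_congr rfl fun e0 he0 => by
        rw [key _ X _ _ (Finset.mem_range.1 he0), key _ Y _ _ (Finset.mem_range.1 he0),
          kron_mul_add _ _ _ _ _ _ _ _ hc0 (Finset.mem_range.1 he0), mul_assoc],
        ← Finset.mul_sum, six_products c0 hc0, Finset.mul_sum]
      refine Finset.sum_congr rfl fun k0 hk0 => ?_
      have hk0 := Finset.mem_range.1 hk0
      rw [mul_ite, mul_zero, show (2 * (c0 / 2) + k0) / 2 = c0 / 2 by omega,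
        show (2 * (c0 / 2) + k0) % 2 = k0 by omega, show (2 * k0 + c0 % 2) / 2 = k0 by omega,
        show (2 * k0 + c0 % 2) % 2 = c0 % 2 by omega]
    rw [Finset.sum_congr rfl fun e' _ => step e', Finset.sum_comm, Finset.sum_comm]
    rw [Finset.sum_comm, Finset.sum_comm (s := Finset.range (2 ^ L))]
    refine Finset.sum_congr rfl fun k0 hk0 => ?_
    have hk0 := Finset.mem_range.1 hk0
    by_cases hg : good 1 (c0 / 2) k0 (c0 % 2)
    · simp only [hg, if_true]
      rw [ih c' (fun i k => X (2 * i + c0 / 2) (2 * k + k0))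
        (fun k j => Y (2 * k + k0) (2 * j + c0 % 2))]
      refine Finset.sum_congr rfl fun k _ => ?_
      rw [good_eq _ _ _ _ _ _ _ (by omega) hk0 (by omega), hg, Bool.and_true]
    · rw [Finset.sum_eq_zero fun _ _ => by rw [if_neg hg], Finset.sum_eq_zero fun k _ => ?_]
      rw [good_eq _ _ _ _ _ _ _ (by omega) hk0 (by omega)]
      simp [hg]

end Identity

theorem row_lt (L a : ℕ) : row L a < 2 ^ L := by
  induction L generalizing a with
  | zero => simp [row]
  | succ L ih => rw [row, pow_succ]; have := ih (a / 4); omega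

theorem col_lt (L a : ℕ) : col L a < 2 ^ L := by
  induction L generalizing a with
  | zero => simp [col]
  | succ L ih => rw [col, pow_succ]; have := ih (a / 4); omega

/-- Every position has a Morton index. -/
theorem exists_morton (L i j : ℕ) (hi : i < 2 ^ L) (hj : j < 2 ^ L) :
    ∃ a < 4 ^ L, row L a = i ∧ col L a = j := by
  induction L generalizing i j with
  | zero => exact ⟨0, by simp, by simp [row]; omega, by simp [col]; omega⟩
  | succ L ih =>
    rw [pow_succ] at hi hj
    obtain ⟨a, ha, h1, h2⟩ := ih (i / 2) (j / 2) (by omega) (by omega)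
    have e : (2 * (i % 2) + j % 2) / 2 = i % 2 := by omega
    refine ⟨4 * a + (2 * (i % 2) + j % 2), by rw [pow_succ]; omega, ?_, ?_⟩
    · rw [row_eq L _ a _ (by omega) e, h1]; omega
    · rw [col_eq L a _ (by omega), h2]; omega

/-! ### Counting the computed terms -/

/-- The indicator function of the computed terms. -/
def goodInd (L i k j : ℕ) : ℝ := if good L i k j then 1 else 0

/-- The indicator factors over the binary digits. Hence each moment of the set of computed terms is
the `L`-th power of its value for a single digit. -/
theorem goodInd_eq (L i k j a b c : ℕ) (ha : a < 2) (hb : b < 2) (hc : c < 2) :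
    goodInd (L + 1) (2 * i + a) (2 * k + b) (2 * j + c) = goodInd L i k j * goodInd 1 a b c := by
  simp only [goodInd, good_eq L i k j a b c ha hb hc, Bool.and_eq_true]
  by_cases h : good L i k j <;> simp [h]

theorem sum_two_pow_succ (F : ℕ → ℝ) (L : ℕ) : ∑ x ∈ Finset.range (2 ^ (L + 1)), F x =
    ∑ x ∈ Finset.range (2 ^ L), (F (2 * x + 0) + F (2 * x + 1)) := by
  rw [pow_succ, sum_range_mul]
  simp [Finset.sum_range_succ]

section Counting
variable (L i k j a b c : ℕ)

theorem sum_good_i (hb : b < 2) (hc : c < 2) :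
    ∑ i ∈ Finset.range (2 ^ (L + 1)), goodInd (L + 1) i (2 * k + b) (2 * j + c) =
      (goodInd 1 0 b c + goodInd 1 1 b c) * ∑ i ∈ Finset.range (2 ^ L), goodInd L i k j := by
  rw [sum_two_pow_succ, Finset.mul_sum]
  refine Finset.sum_congr rfl fun i _ => ?_
  rw [goodInd_eq _ _ _ _ _ _ _ (by norm_num) hb hc, goodInd_eq _ _ _ _ _ _ _ (by norm_num) hb hc]
  ring

theorem sum_good_k (ha : a < 2) (hc : c < 2) :
    ∑ k ∈ Finset.range (2 ^ (L + 1)), goodInd (L + 1) (2 * i + a) k (2 * j + c) =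
      (goodInd 1 a 0 c + goodInd 1 a 1 c) * ∑ k ∈ Finset.range (2 ^ L), goodInd L i k j := by
  rw [sum_two_pow_succ, Finset.mul_sum]
  refine Finset.sum_congr rfl fun i _ => ?_
  rw [goodInd_eq _ _ _ _ _ _ _ ha (by norm_num) hc, goodInd_eq _ _ _ _ _ _ _ ha (by norm_num) hc]
  ring

theorem sum_good_j (ha : a < 2) (hb : b < 2) :
    ∑ j ∈ Finset.range (2 ^ (L + 1)), goodInd (L + 1) (2 * i + a) (2 * k + b) j =
      (goodInd 1 a b 0 + goodInd 1 a b 1) * ∑ j ∈ Finset.range (2 ^ L), goodInd L i k j := by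
  rw [sum_two_pow_succ, Finset.mul_sum]
  refine Finset.sum_congr rfl fun i _ => ?_
  rw [goodInd_eq _ _ _ _ _ _ _ ha hb (by norm_num), goodInd_eq _ _ _ _ _ _ _ ha hb (by norm_num)]
  ring

@[simp] theorem goodInd_one : goodInd 1 0 0 0 = 1 ∧ goodInd 1 0 0 1 = 1 ∧ goodInd 1 0 1 0 = 0 ∧
    goodInd 1 0 1 1 = 1 ∧ goodInd 1 1 0 0 = 1 ∧ goodInd 1 1 0 1 = 1 ∧ goodInd 1 1 1 0 = 1 ∧
    goodInd 1 1 1 1 = 1 := by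
  simp [goodInd, good]

/-- The excluded pattern `0, 1, 0` leaves three pairs of digits of `k, j` when the digit of `i` is
0, and all four when it is 1. -/
theorem sum_good_kj (ha : a < 2) : ∑ k ∈ Finset.range (2 ^ (L + 1)),
    ∑ j ∈ Finset.range (2 ^ (L + 1)), goodInd (L + 1) (2 * i + a) k j =
      (3 + a) * ∑ k ∈ Finset.range (2 ^ L), ∑ j ∈ Finset.range (2 ^ L), goodInd L i k j := by
  rw [sum_two_pow_succ, Finset.mul_sum]
  refine Finset.sum_congr rfl fun k _ => ?_
  rw [sum_good_j L i k a 0 ha (by norm_num), sum_good_j L i k a 1 ha (by norm_num)]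
  obtain ⟨h1, h2, h3, h4, h5, h6, h7, h8⟩ := goodInd_one
  interval_cases a <;> simp only [h1, h2, h3, h4, h5, h6, h7, h8] <;> push_cast <;> ring

theorem sum_good_ij (hb : b < 2) : ∑ i ∈ Finset.range (2 ^ (L + 1)),
    ∑ j ∈ Finset.range (2 ^ (L + 1)), goodInd (L + 1) i (2 * k + b) j =
      (4 - b) * ∑ i ∈ Finset.range (2 ^ L), ∑ j ∈ Finset.range (2 ^ L), goodInd L i k j := by
  rw [sum_two_pow_succ, Finset.mul_sum]
  refine Finset.sum_congr rfl fun i _ => ?_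
  rw [sum_good_j L i k 0 b (by norm_num) hb, sum_good_j L i k 1 b (by norm_num) hb]
  obtain ⟨h1, h2, h3, h4, h5, h6, h7, h8⟩ := goodInd_one
  interval_cases b <;> simp only [h1, h2, h3, h4, h5, h6, h7, h8] <;> push_cast <;> ring

theorem sum_good_ik (hc : c < 2) : ∑ i ∈ Finset.range (2 ^ (L + 1)),
    ∑ k ∈ Finset.range (2 ^ (L + 1)), goodInd (L + 1) i k (2 * j + c) =
      (3 + c) * ∑ i ∈ Finset.range (2 ^ L), ∑ k ∈ Finset.range (2 ^ L), goodInd L i k j := by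
  rw [sum_two_pow_succ, Finset.mul_sum]
  refine Finset.sum_congr rfl fun i _ => ?_
  rw [sum_good_k L i j 0 c (by norm_num) hc, sum_good_k L i j 1 c (by norm_num) hc]
  obtain ⟨h1, h2, h3, h4, h5, h6, h7, h8⟩ := goodInd_one
  interval_cases c <;> simp only [h1, h2, h3, h4, h5, h6, h7, h8] <;> push_cast <;> ring

theorem sum_good : ∑ i ∈ Finset.range (2 ^ L), ∑ k ∈ Finset.range (2 ^ L),
    ∑ j ∈ Finset.range (2 ^ L), goodInd L i k j = 7 ^ L := by
  induction L with
  | zero => simp [goodInd, good]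
  | succ L ih =>
    rw [sum_two_pow_succ, pow_succ (7 : ℝ), ← ih, Finset.sum_mul]
    refine Finset.sum_congr rfl fun i _ => ?_
    rw [sum_good_kj L i 0 (by norm_num), sum_good_kj L i 1 (by norm_num)]
    push_cast; ring

/-- `25 = 3 ^ 2 + 4 ^ 2`: one of the two values of a digit occurs in three terms, the other in four.
-/
theorem sum_sq_good_i : ∑ i ∈ Finset.range (2 ^ L), (∑ k ∈ Finset.range (2 ^ L),
    ∑ j ∈ Finset.range (2 ^ L), goodInd L i k j) ^ 2 = 25 ^ L := by
  induction L with
  | zero => simp [goodInd, good]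
  | succ L ih =>
    rw [sum_two_pow_succ, pow_succ (25 : ℝ), ← ih, Finset.sum_mul]
    refine Finset.sum_congr rfl fun i _ => ?_
    rw [sum_good_kj L i 0 (by norm_num), sum_good_kj L i 1 (by norm_num)]
    push_cast; ring

theorem sum_sq_good_k : ∑ k ∈ Finset.range (2 ^ L), (∑ i ∈ Finset.range (2 ^ L),
    ∑ j ∈ Finset.range (2 ^ L), goodInd L i k j) ^ 2 = 25 ^ L := by
  induction L with
  | zero => simp [goodInd, good]
  | succ L ih =>
    rw [sum_two_pow_succ, pow_succ (25 : ℝ), ← ih, Finset.sum_mul]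
    refine Finset.sum_congr rfl fun k _ => ?_
    rw [sum_good_ij L k 0 (by norm_num), sum_good_ij L k 1 (by norm_num)]
    push_cast; ring

theorem sum_sq_good_j : ∑ j ∈ Finset.range (2 ^ L), (∑ i ∈ Finset.range (2 ^ L),
    ∑ k ∈ Finset.range (2 ^ L), goodInd L i k j) ^ 2 = 25 ^ L := by
  induction L with
  | zero => simp [goodInd, good]
  | succ L ih =>
    rw [sum_two_pow_succ, pow_succ (25 : ℝ), ← ih, Finset.sum_mul]
    refine Finset.sum_congr rfl fun j _ => ?_
    rw [sum_good_ik L j 0 (by norm_num), sum_good_ik L j 1 (by norm_num)]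
    push_cast; ring

/-- `13 = 2 ^ 2 + 1 ^ 2 + 2 ^ 2 + 2 ^ 2`: of the four pairs of digits, only the one in the excluded
pattern loses a term. -/
theorem sum_sq_good_ik : ∑ i ∈ Finset.range (2 ^ L), ∑ k ∈ Finset.range (2 ^ L),
    (∑ j ∈ Finset.range (2 ^ L), goodInd L i k j) ^ 2 = 13 ^ L := by
  induction L with
  | zero => simp [goodInd, good]
  | succ L ih =>
    rw [sum_two_pow_succ, pow_succ (13 : ℝ), ← ih, Finset.sum_mul]
    refine Finset.sum_congr rfl fun i _ => ?_
    rw [sum_two_pow_succ, sum_two_pow_succ, ← Finset.sum_add_distrib, Finset.sum_mul]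
    refine Finset.sum_congr rfl fun k _ => ?_
    rw [sum_good_j L i k 0 0 (by norm_num) (by norm_num),
      sum_good_j L i k 0 1 (by norm_num) (by norm_num),
      sum_good_j L i k 1 0 (by norm_num) (by norm_num),
      sum_good_j L i k 1 1 (by norm_num) (by norm_num)]
    obtain ⟨h1, h2, h3, h4, h5, h6, h7, h8⟩ := goodInd_one
    simp only [h1, h2, h3, h4, h5, h6, h7, h8]; ring

theorem sum_sq_good_ij : ∑ i ∈ Finset.range (2 ^ L), ∑ j ∈ Finset.range (2 ^ L),
    (∑ k ∈ Finset.range (2 ^ L), goodInd L i k j) ^ 2 = 13 ^ L := by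
  induction L with
  | zero => simp [goodInd, good]
  | succ L ih =>
    rw [sum_two_pow_succ, pow_succ (13 : ℝ), ← ih, Finset.sum_mul]
    refine Finset.sum_congr rfl fun i _ => ?_
    rw [sum_two_pow_succ, sum_two_pow_succ, ← Finset.sum_add_distrib, Finset.sum_mul]
    refine Finset.sum_congr rfl fun j _ => ?_
    rw [sum_good_k L i j 0 0 (by norm_num) (by norm_num),
      sum_good_k L i j 0 1 (by norm_num) (by norm_num),
      sum_good_k L i j 1 0 (by norm_num) (by norm_num),
      sum_good_k L i j 1 1 (by norm_num) (by norm_num)]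
    obtain ⟨h1, h2, h3, h4, h5, h6, h7, h8⟩ := goodInd_one
    simp only [h1, h2, h3, h4, h5, h6, h7, h8]; ring

theorem sum_sq_good_kj : ∑ k ∈ Finset.range (2 ^ L), ∑ j ∈ Finset.range (2 ^ L),
    (∑ i ∈ Finset.range (2 ^ L), goodInd L i k j) ^ 2 = 13 ^ L := by
  induction L with
  | zero => simp [goodInd, good]
  | succ L ih =>
    rw [sum_two_pow_succ, pow_succ (13 : ℝ), ← ih, Finset.sum_mul]
    refine Finset.sum_congr rfl fun k _ => ?_
    rw [sum_two_pow_succ, sum_two_pow_succ, ← Finset.sum_add_distrib, Finset.sum_mul]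
    refine Finset.sum_congr rfl fun j _ => ?_
    rw [sum_good_i L k j 0 0 (by norm_num) (by norm_num),
      sum_good_i L k j 0 1 (by norm_num) (by norm_num),
      sum_good_i L k j 1 0 (by norm_num) (by norm_num),
      sum_good_i L k j 1 1 (by norm_num) (by norm_num)]
    obtain ⟨h1, h2, h3, h4, h5, h6, h7, h8⟩ := goodInd_one
    simp only [h1, h2, h3, h4, h5, h6, h7, h8]; ring

end Counting

/-! ### Averages over finite types -/

section Average

/-- The average of `F`. -/
noncomputable def avg {Ω : Type*} [Fintype Ω] (F : Ω → ℝ) : ℝ := (∑ x, F x) / Fintype.card Ω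

variable {Ω Ω' : Type*} [Fintype Ω] [Fintype Ω']

theorem avg_mono {F G : Ω → ℝ} (h : ∀ x, F x ≤ G x) : avg F ≤ avg G := by
  unfold avg
  gcongr with x
  exact h x

theorem avg_add (F G : Ω → ℝ) : avg (fun x => F x + G x) = avg F + avg G := by
  simp [avg, Finset.sum_add_distrib, add_div]

theorem avg_mul_left (c : ℝ) (F : Ω → ℝ) : avg (fun x => c * F x) = c * avg F := by
  simp [avg, ← Finset.mul_sum, mul_div_assoc]

theorem avg_mul_right (c : ℝ) (F : Ω → ℝ) : avg (fun x => F x * c) = avg F * c := by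
  simp only [mul_comm _ c, avg_mul_left]

theorem avg_sum {ι : Type*} (s : Finset ι) (F : ι → Ω → ℝ) :
    avg (fun x => ∑ i ∈ s, F i x) = ∑ i ∈ s, avg (F i) := by
  simp [avg, Finset.sum_comm (s := Finset.univ), Finset.sum_div]

theorem avg_const [Nonempty Ω] (c : ℝ) : avg (fun _ : Ω => c) = c := by
  simp [avg]

theorem avg_nonneg {F : Ω → ℝ} (h : ∀ x, 0 ≤ F x) : 0 ≤ avg F :=
  div_nonneg (Finset.sum_nonneg fun x _ => h x) (Nat.cast_nonneg _)

/-- The indicator of membership in `S`. -/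
def ind {V : Type*} [DecidableEq V] (S : Finset V) (v : V) : ℝ := if v ∈ S then 1 else 0

theorem ind_nonneg {V : Type*} [DecidableEq V] (S : Finset V) (v : V) : 0 ≤ ind S v := by
  unfold ind; split_ifs <;> norm_num

/-- The values of a uniformly random function are independent and uniform: the sum over all
functions of a product over arguments is the product of the sums over values. -/
theorem avg_prod_ind {U V : Type*} [Fintype U] [DecidableEq U] [Fintype V] [DecidableEq V]
    [Nonempty V] (T : Finset U) (S : Finset V) :
    avg (fun f : U → V => ∏ u ∈ T, ind S (f u)) = ((S.card : ℝ) / Fintype.card V) ^ T.card := by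
  have h (f : U → V) : ∏ u ∈ T, ind S (f u) = ∏ u, if u ∈ T then ind S (f u) else 1 := by
    rw [Finset.prod_ite_mem, Finset.univ_inter]
  have hV : (Fintype.card V : ℝ) ≠ 0 := by simp
  have hsum := Finset.prod_univ_sum (fun _ : U => (Finset.univ : Finset V))
    (fun u v => if u ∈ T then ind S v else 1)
  rw [Fintype.piFinset_univ] at hsum
  unfold avg
  rw [Finset.sum_congr rfl fun f _ => h f, ← hsum, Fintype.card_fun]
  have h2 (u : U) : (∑ v : V, if u ∈ T then ind S v else 1) =
      (if u ∈ T then (S.card : ℝ) / Fintype.card V else 1) * Fintype.card V := by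
    split_ifs
    · rw [div_mul_cancel₀ _ hV]
      simp [ind]
    · simp
  rw [Finset.prod_congr rfl fun u _ => h2 u, Finset.prod_mul_distrib, Finset.prod_ite_mem,
    Finset.univ_inter, Finset.prod_const, Finset.prod_const, Finset.card_univ]
  push_cast
  field_simp

end Average

/-! ### Isolation by three random maps: the second moment method -/

section Isolation

set_option linter.unusedSectionVars false

variable {U X Y Z : Type*} [Fintype U] [Fintype X] [Fintype Y] [Fintype Z]
  [DecidableEq U] [DecidableEq X] [DecidableEq Y] [DecidableEq Z]

/-- The random maps `f`, `g`, `h` isolate a term `a x z * b z y` with `z ∈ S`. -/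
def Isolates (G : U → U → U → Bool) (f : U → X) (g : U → Z) (h : U → Y) (x : X) (S : Finset Z)
    (y : Y) : Prop :=
  ∃ i j, f i = x ∧ h j = y ∧ ∃! k, g k ∈ S ∧ G i k j = true

theorem avg_ind [Nonempty X] (S : Finset X) (i : U) :
    avg (fun f : U → X => ind S (f i)) = (S.card : ℝ) / Fintype.card X := by
  simpa using avg_prod_ind {i} S

/-- Independence off the diagonal; on the diagonal the product of the indicators is one indicator.
Keeping both summands in the bound gives a form that can be expanded without cases. -/
theorem avg_ind_mul [Nonempty X] (S : Finset X) (i i' : U) :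
    avg (fun f : U → X => ind S (f i) * ind S (f i')) ≤
      ((S.card : ℝ) / Fintype.card X) ^ 2 + if i = i' then (S.card : ℝ) / Fintype.card X else 0 := by
  by_cases h : i = i'
  · subst h
    have : avg (fun f : U → X => ind S (f i) * ind S (f i)) = (S.card : ℝ) / Fintype.card X := by
      rw [← avg_ind S i]
      congr; ext f; unfold ind; split_ifs <;> simp
    rw [this, if_pos rfl]
    have : 0 ≤ ((S.card : ℝ) / Fintype.card X) ^ 2 := by positivity
    linarith
  · have := avg_prod_ind {i, i'} S
    simp only [Finset.card_pair h, Finset.prod_pair h] at this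
    rw [if_neg h, add_zero, ← this]

theorem sum_diag (c r : ℝ) (F : U → U → ℝ) :
    ∑ k, ∑ k', (c + if k = k' then r else 0) * F k k' = c * ∑ k, ∑ k', F k k' + r * ∑ k, F k k := by
  simp only [add_mul, ite_mul, zero_mul, Finset.sum_add_distrib, Finset.sum_ite_eq,
    Finset.mem_univ, if_true, Finset.mul_sum]

/-- `f` and `g` are independent, so the weight of a pair of terms is at most `(p ^ 2 + [i = i'] * p)
* (ρ ^ 2 + [k = k'] * ρ)`. Expanding it yields the four sums, according to which of the indices
coincide. -/
theorem avg_quadratic [Nonempty X] [Nonempty Z] (R : Finset X) (S : Finset Z) (p ρ : ℝ)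
    (hp : p = R.card / Fintype.card X) (hρ : ρ = S.card / Fintype.card Z)
    (C : U → U → U → U → ℝ) (hC : ∀ i i' k k', 0 ≤ C i i' k k') :
    avg (fun f : U → X => avg fun g : U → Z => ∑ i, ∑ i', ∑ k, ∑ k',
      (ind R (f i) * ind R (f i')) * (ind S (g k) * ind S (g k')) * C i i' k k') ≤
    p ^ 2 * ρ ^ 2 * ∑ i, ∑ i', ∑ k, ∑ k', C i i' k k' + p * ρ ^ 2 * ∑ i, ∑ k, ∑ k', C i i k k' +
      p ^ 2 * ρ * ∑ i, ∑ i', ∑ k, C i i' k k + p * ρ * ∑ i, ∑ k, C i i k k := by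
  simp only [avg_sum]
  have hp0 : 0 ≤ p := by rw [hp]; positivity
  have hρ0 : 0 ≤ ρ := by rw [hρ]; positivity
  have key (i i' k k' : U) : avg (fun f : U → X => avg fun g : U → Z =>
      (ind R (f i) * ind R (f i')) * (ind S (g k) * ind S (g k')) * C i i' k k') ≤
      (p ^ 2 + if i = i' then p else 0) * (ρ ^ 2 + if k = k' then ρ else 0) * C i i' k k' := by
    simp only [avg_mul_right, avg_mul_left]
    refine mul_le_mul_of_nonneg_right ?_ (hC _ _ _ _)
    have h1 := avg_ind_mul R i i'
    have h2 := avg_ind_mul S k k'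
    rw [← hp] at h1
    rw [← hρ] at h2
    refine mul_le_mul h1 h2 (avg_nonneg fun _ => mul_nonneg (ind_nonneg _ _) (ind_nonneg _ _)) ?_
    split_ifs <;> positivity
  refine (Finset.sum_le_sum fun i _ => Finset.sum_le_sum fun i' _ => Finset.sum_le_sum fun k _ =>
    Finset.sum_le_sum fun k' _ => key i i' k k').trans_eq ?_
  have h (i i' : U) : ∑ k, ∑ k', (p ^ 2 + if i = i' then p else 0) *
      (ρ ^ 2 + if k = k' then ρ else 0) * C i i' k k' = (p ^ 2 + if i = i' then p else 0) *
      (ρ ^ 2 * ∑ k, ∑ k', C i i' k k' + ρ * ∑ k, C i i' k k) := by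
    rw [← sum_diag]
    simp only [Finset.mul_sum, mul_assoc]
  simp only [h, sum_diag, Finset.sum_add_distrib, ← Finset.mul_sum]
  ring

open Classical in
/-- The indicator function of the event that nothing is isolated. -/
noncomputable def failure (G : U → U → U → Bool) (f : U → X) (g : U → Z) (h : U → Y) (x : X)
    (S : Finset Z) (y : Y) : ℝ := if Isolates G f g h x S y then 0 else 1

open Classical in
/-- The places at which the value `y` of `h` isolates. -/
noncomputable def places (G : U → U → U → Bool) (f : U → X) (g : U → Z) (x : X) (S : Finset Z) :
    Finset U := {j | ∃ i, f i = x ∧ ∃! k, g k ∈ S ∧ G i k j = true}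

/-- The indicator function of a relation. -/
def rel (G : U → U → U → Bool) (i k j : U) : ℝ := if G i k j then 1 else 0

/-- For fixed `f` and `g`, a failure means that `h` avoids the value `y` at all isolating places.
These events are independent, of probability `1 - 1 / |Y|` each. -/
theorem avg_failure_le [Nonempty Y] (G : U → U → U → Bool) (f : U → X) (g : U → Z) (x : X)
    (S : Finset Z) (y : Y) : avg (fun h : U → Y => failure G f g h x S y) ≤
      Real.exp (-((places G f g x S).card / Fintype.card Y)) := by
  have hY : (0 : ℝ) < Fintype.card Y := by exact_mod_cast Fintype.card_pos
  calc avg (fun h : U → Y => failure G f g h x S y)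
      ≤ avg (fun h : U → Y => ∏ j ∈ places G f g x S, ind ({y}ᶜ) (h j)) := by
        refine avg_mono fun h => ?_
        unfold failure
        split_ifs with hI
        · exact Finset.prod_nonneg fun j _ => ind_nonneg _ _
        · rw [Finset.prod_eq_one fun j hj => ?_]
          simp only [places, Finset.mem_filter, Finset.mem_univ, true_and] at hj
          obtain ⟨i, hi, hk⟩ := hj
          have : h j ≠ y := fun e => hI ⟨i, j, hi, e, hk⟩
          simp [ind, this]
    _ = (1 - 1 / Fintype.card Y) ^ (places G f g x S).card := by
        rw [avg_prod_ind, Finset.card_compl, Finset.card_singleton,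
          Nat.cast_sub Fintype.card_pos]
        congr 1
        push_cast
        field_simp
    _ ≤ Real.exp (-(1 / Fintype.card Y)) ^ (places G f g x S).card := by
        refine pow_le_pow_left₀ ?_ (Real.one_sub_le_exp_neg _) _
        rw [sub_nonneg, div_le_one hY]
        exact_mod_cast Fintype.card_pos
    _ = _ := by
        rw [← Real.exp_nat_mul]
        congr 1
        ring

/-- The number of sampled terms at place `j`. -/
noncomputable def hits (G : U → U → U → Bool) (f : U → X) (g : U → Z) (x : X) (S : Finset Z)
    (j : U) : ℝ := ∑ i, ∑ k, ind {x} (f i) * ind S (g k) * rel G i k j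

theorem hits_eq (G : U → U → U → Bool) (f : U → X) (g : U → Z) (x : X) (S : Finset Z) (j : U) :
    hits G f g x S j = (Finset.univ.filter fun ik : U × U =>
      f ik.1 = x ∧ g ik.2 ∈ S ∧ G ik.1 ik.2 j = true).card := by
  rw [Finset.card_filter, ← Finset.univ_product_univ, Finset.sum_product]
  push_cast
  refine Finset.sum_congr rfl fun i _ => Finset.sum_congr rfl fun k _ => ?_
  by_cases h1 : f i = x <;> by_cases h2 : g k ∈ S <;> simp [ind, rel, h1, h2]

/-- For a natural number `h`, `2 * h - h ^ 2` is at most the indicator of `h = 1`, and a place with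
exactly one hit isolates. The bound is quadratic, so its average needs second moments only. -/
theorem le_card_places (G : U → U → U → Bool) (f : U → X) (g : U → Z) (x : X) (S : Finset Z) :
    ∑ j, (2 * hits G f g x S j - hits G f g x S j ^ 2) ≤ ((places G f g x S).card : ℝ) := by
  classical
  rw [places, Finset.card_filter]
  push_cast
  refine Finset.sum_le_sum fun j _ => ?_
  rw [hits_eq]
  set T := Finset.univ.filter fun ik : U × U => f ik.1 = x ∧ g ik.2 ∈ S ∧ G ik.1 ik.2 j = true
    with hT
  have h0 : (0 : ℝ) ≤ if ∃ i, f i = x ∧ ∃! k, g k ∈ S ∧ G i k j = true then 1 else 0 := by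
    split_ifs <;> norm_num
  rcases Nat.lt_or_ge T.card 2 with h | h
  · interval_cases hc : T.card
    · simpa using h0
    · obtain ⟨⟨i, k⟩, hik⟩ := Finset.card_eq_one.1 hc
      have hmem (i' k' : U) : (f i' = x ∧ g k' ∈ S ∧ G i' k' j = true) ↔ i' = i ∧ k' = k := by
        simpa [hT] using Finset.ext_iff.1 hik (i', k')
      have := (hmem i k).2 ⟨rfl, rfl⟩
      rw [if_pos ⟨i, this.1, k, this.2, fun k' hk' => ((hmem i k').1 ⟨this.1, hk'⟩).2⟩]
      norm_num
  · refine le_trans ?_ h0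
    have : (2 : ℝ) ≤ T.card := by exact_mod_cast h
    nlinarith

theorem hits_le_sq (G : U → U → U → Bool) (f : U → X) (g : U → Z) (x : X) (S : Finset Z) (j : U) :
    hits G f g x S j ≤ hits G f g x S j ^ 2 := by
  rw [hits_eq]
  exact_mod_cast Nat.le_self_pow two_ne_zero _

/-- Three cases. If `c ≥ μ / 4`, the exponential on the right dominates. Otherwise the left side is
at most 1: if `X ≤ μ / 2`, the Chebyshev term is at least 1, and if `X > μ / 2`, then `Q - X ≥ X - c
> μ / 4` makes the Markov term at least 1. -/
theorem pointwise_failure_bound {c X Q μ η : ℝ} (hμ : 0 < μ) (hη : 0 < η) (hQ : X ≤ Q)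
    (hc : 2 * X - Q ≤ c) (hc0 : 0 ≤ c) : Real.exp (-(c / η)) ≤
      4 / μ ^ 2 * (X - μ) ^ 2 + 4 / μ * (Q - X) + Real.exp (-(μ / (4 * η))) := by
  have h1 : 0 ≤ 4 / μ ^ 2 * (X - μ) ^ 2 := by positivity
  have h2 : 0 ≤ 4 / μ * (Q - X) := mul_nonneg (by positivity) (by linarith)
  by_cases h : μ / 4 ≤ c
  · have : Real.exp (-(c / η)) ≤ Real.exp (-(μ / (4 * η))) := by
      rw [Real.exp_le_exp, neg_le_neg_iff, ← div_div]
      gcongr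
    linarith
  · have h3 : Real.exp (-(c / η)) ≤ 1 := Real.exp_le_one_iff.2 (neg_nonpos.2 (by positivity))
    have h4 := Real.exp_pos (-(μ / (4 * η)))
    by_cases h5 : X ≤ μ / 2
    · have : 1 ≤ 4 / μ ^ 2 * (X - μ) ^ 2 := by
        rw [div_mul_eq_mul_div, le_div_iff₀ (by positivity)]
        nlinarith
      linarith
    · have : 1 ≤ 4 / μ * (Q - X) := by
        rw [div_mul_eq_mul_div, le_div_iff₀ hμ]
        linarith
      linarith

theorem sq_sum_eq (F : U → ℝ) : (∑ k, F k) ^ 2 = ∑ k, ∑ k', F k * F k' := by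
  rw [sq, Finset.sum_mul_sum]

theorem sq_sum_sum_eq (F : U → U → ℝ) :
    (∑ i, ∑ k, F i k) ^ 2 = ∑ i, ∑ i', ∑ k, ∑ k', F i k * F i' k' := by
  rw [sq, Finset.sum_mul_sum]
  simp only [Finset.sum_mul_sum]

/-- A second moment bound for the probability that nothing is isolated. -/
theorem avg_failure [Nonempty X] [Nonempty Y] [Nonempty Z] (G : U → U → U → Bool) (x : X)
    (S : Finset Z) (y : Y) (p ρ μ m₁ q₁ q₂ : ℝ) (hp : p = 1 / Fintype.card X)
    (hρ : ρ = S.card / Fintype.card Z) (hμ : μ = p * ρ * m₁) (hμ0 : 0 < μ)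
    (h1 : ∑ i, ∑ k, ∑ j, rel G i k j = m₁)
    (hi : ∑ i, (∑ k, ∑ j, rel G i k j) ^ 2 = q₂) (hk : ∑ k, (∑ i, ∑ j, rel G i k j) ^ 2 = q₂)
    (hj : ∑ j, (∑ i, ∑ k, rel G i k j) ^ 2 = q₂) (hik : ∑ i, ∑ k, (∑ j, rel G i k j) ^ 2 = q₁)
    (hij : ∑ i, ∑ j, (∑ k, rel G i k j) ^ 2 = q₁) (hkj : ∑ k, ∑ j, (∑ i, rel G i k j) ^ 2 = q₁) :
    avg (fun f : U → X => avg fun g : U → Z => avg fun h : U → Y => failure G f g h x S y) ≤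
      4 / μ ^ 2 * (p * ρ ^ 2 * q₂ + p ^ 2 * ρ * q₂ + p * ρ * q₁) +
      4 / μ * (p ^ 2 * ρ ^ 2 * q₂ + p * ρ ^ 2 * q₁ + p ^ 2 * ρ * q₁) +
      Real.exp (-(μ / (4 * Fintype.card Y))) := by
  have hY : (0 : ℝ) < Fintype.card Y := by exact_mod_cast Fintype.card_pos
  have hp' : p = ({x} : Finset X).card / Fintype.card X := by simp [hp]
  have hrel (i k j : U) : 0 ≤ rel G i k j := by unfold rel; split_ifs <;> norm_num
  have hrel2 (i k j : U) : rel G i k j * rel G i k j = rel G i k j := by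
    unfold rel; split_ifs <;> norm_num
  -- `W` counts the sampled terms, and `Q - W` the ordered pairs of distinct sampled terms at the
  -- same place `j`.
  set W : (U → X) → (U → Z) → ℝ := fun f g => ∑ j, hits G f g x S j with hW
  set Q : (U → X) → (U → Z) → ℝ := fun f g => ∑ j, hits G f g x S j ^ 2 with hQ
  have hWsum (f : U → X) (g : U → Z) :
      W f g = ∑ i, ∑ k, ind {x} (f i) * ind S (g k) * ∑ j, rel G i k j := by
    simp only [hW, hits]
    rw [Finset.sum_comm]
    refine Finset.sum_congr rfl fun i _ => ?_
    rw [Finset.sum_comm]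
    simp only [Finset.mul_sum]
  have avgW : avg (fun f : U → X => avg fun g : U → Z => W f g) = μ := by
    simp only [hWsum, avg_sum, avg_mul_right, avg_mul_left, avg_ind, ← hρ, ← hp', hμ, ← h1,
      Finset.mul_sum]
  have avgW2 : avg (fun f : U → X => avg fun g : U → Z => W f g ^ 2) ≤
      μ ^ 2 + p * ρ ^ 2 * q₂ + p ^ 2 * ρ * q₂ + p * ρ * q₁ := by
    have := avg_quadratic {x} S p ρ hp' hρ (fun i i' k k' =>
      (∑ j, rel G i k j) * ∑ j, rel G i' k' j) fun i i' k k' =>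
        mul_nonneg (Finset.sum_nonneg fun j _ => hrel _ _ _)
          (Finset.sum_nonneg fun j _ => hrel _ _ _)
    refine (le_of_eq ?_).trans (this.trans_eq ?_)
    · congr; ext f; congr; ext g
      rw [hWsum, sq, Finset.sum_mul_sum]
      refine Finset.sum_congr rfl fun i _ => Finset.sum_congr rfl fun i' _ => ?_
      rw [Finset.sum_mul_sum]
      refine Finset.sum_congr rfl fun k _ => Finset.sum_congr rfl fun k' _ => ?_
      ring
    -- The sums over all pairs of terms, over those with the same `i`, and over those with the same
    -- `k`. The pairs sharing both give the sum `q₁`.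
    · have e1 : ∑ i, ∑ i', ∑ k, ∑ k', (∑ j, rel G i k j) * ∑ j, rel G i' k' j = m₁ ^ 2 := by
        rw [← h1, sq_sum_sum_eq]
      have e2 : ∑ i, ∑ k, ∑ k', (∑ j, rel G i k j) * ∑ j, rel G i k' j = q₂ := by
        simp only [← hi, sq_sum_eq]
      have e3 : ∑ i, ∑ i', ∑ k, (∑ j, rel G i k j) * ∑ j, rel G i' k j = q₂ := by
        rw [← hk, Finset.sum_congr rfl fun i _ => Finset.sum_comm, Finset.sum_comm]
        simp only [sq_sum_eq (fun i => ∑ j, rel G i _ j)]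
      rw [e1, e2, e3, hμ, ← hik]
      simp only [sq]
      ring
  have avgQ : avg (fun f : U → X => avg fun g : U → Z => Q f g) ≤
      p ^ 2 * ρ ^ 2 * q₂ + p * ρ ^ 2 * q₁ + p ^ 2 * ρ * q₁ + μ := by
    have := avg_quadratic {x} S p ρ hp' hρ (fun i i' k k' =>
      ∑ j, rel G i k j * rel G i' k' j) fun i i' k k' =>
        Finset.sum_nonneg fun j _ => mul_nonneg (hrel _ _ _) (hrel _ _ _)
    refine (le_of_eq ?_).trans (this.trans_eq ?_)
    · congr; ext f; congr; ext g
      simp only [hQ, hits, sq_sum_sum_eq, Finset.mul_sum]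
      rw [Finset.sum_comm]
      refine Finset.sum_congr rfl fun i _ => ?_
      rw [Finset.sum_comm]
      refine Finset.sum_congr rfl fun i' _ => ?_
      rw [Finset.sum_comm]
      refine Finset.sum_congr rfl fun k _ => ?_
      rw [Finset.sum_comm]
      refine Finset.sum_congr rfl fun k' _ => Finset.sum_congr rfl fun j _ => ?_
      ring
    -- The same expansion, with `j` common to both terms. The pairs that coincide altogether
    -- contribute `μ`, which cancels against the average of `W`.
    · have e1 : ∑ i, ∑ i', ∑ k, ∑ k', ∑ j, rel G i k j * rel G i' k' j = q₂ := by
        simp only [← hj, sq_sum_sum_eq]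
        symm
        rw [Finset.sum_comm]
        refine Finset.sum_congr rfl fun i _ => ?_
        rw [Finset.sum_comm]
        refine Finset.sum_congr rfl fun i' _ => ?_
        rw [Finset.sum_comm]
        exact Finset.sum_congr rfl fun k _ => Finset.sum_comm
      have e2 : ∑ i, ∑ k, ∑ k', ∑ j, rel G i k j * rel G i k' j = q₁ := by
        simp only [← hij, sq_sum_eq]
        refine Finset.sum_congr rfl fun i _ => ?_
        symm
        rw [Finset.sum_comm]
        exact Finset.sum_congr rfl fun k _ => Finset.sum_comm
      have e3 : ∑ i, ∑ i', ∑ k, ∑ j, rel G i k j * rel G i' k j = q₁ := by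
        simp only [← hkj, sq_sum_eq]
        rw [Finset.sum_congr rfl fun i _ => Finset.sum_comm, Finset.sum_comm]
        refine Finset.sum_congr rfl fun k _ => ?_
        symm
        rw [Finset.sum_comm]
        exact Finset.sum_congr rfl fun i _ => Finset.sum_comm
      simp only [e1, e2, e3, hrel2, h1, hμ]
  calc avg (fun f : U → X => avg fun g : U → Z => avg fun h : U → Y => failure G f g h x S y)
      ≤ avg (fun f : U → X => avg fun g : U → Z => 4 / μ ^ 2 * (W f g - μ) ^ 2 +
          4 / μ * (Q f g - W f g) + Real.exp (-(μ / (4 * Fintype.card Y)))) := by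
        refine avg_mono fun f => avg_mono fun g => (avg_failure_le G f g x S y).trans ?_
        refine pointwise_failure_bound hμ0 hY (Finset.sum_le_sum fun j _ => hits_le_sq G f g x S j)
          ((le_of_eq ?_).trans (le_card_places G f g x S)) (Nat.cast_nonneg _)
        rw [Finset.sum_sub_distrib, ← Finset.mul_sum]
    _ = 4 / μ ^ 2 * (avg (fun f : U → X => avg fun g : U → Z => W f g ^ 2) - μ ^ 2) +
          4 / μ * (avg (fun f : U → X => avg fun g : U → Z => Q f g) - μ) +
          Real.exp (-(μ / (4 * Fintype.card Y))) := by
        have e (f : U → X) (g : U → Z) : 4 / μ ^ 2 * (W f g - μ) ^ 2 + 4 / μ * (Q f g - W f g) +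
            Real.exp (-(μ / (4 * Fintype.card Y))) = 4 / μ ^ 2 * W f g ^ 2 + (4 / μ * Q f g +
            ((-(8 / μ) - 4 / μ) * W f g + (4 + Real.exp (-(μ / (4 * Fintype.card Y)))))) := by
          field_simp; ring
        simp only [e, avg_add, avg_mul_left, avg_const, avgW]
        field_simp; ring
    _ ≤ _ := by
        gcongr
        · linarith
        · linarith

end Isolation

/-! ### The probability that a term is not isolated -/

/-- The number of levels of the recursion for matrices whose dimension has `m` bits. -/
def depth (m : ℕ) : ℕ := Nat.clog 7 (m * 8 ^ m)

/-- With `pow_depth_lt` this says `m * N ^ 3 ≤ 7 ^ L < 7 * m * N ^ 3` for `N = 2 ^ m`. The lower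
bound makes isolation likely; the upper one gives the running time and controls the error terms that
contain `1 / N`. -/
theorem le_pow_depth (m : ℕ) : m * 8 ^ m ≤ 7 ^ depth m := Nat.le_pow_clog (by norm_num) _

theorem one_lt_mul_pow {m : ℕ} (hm : 1 ≤ m) : 1 < m * 8 ^ m := by
  have : 8 ^ 1 ≤ 8 ^ m := Nat.pow_le_pow_right (by norm_num) hm
  nlinarith

theorem depth_pos {m : ℕ} (hm : 1 ≤ m) : 1 ≤ depth m :=
  Nat.clog_pos (by norm_num) (one_lt_mul_pow hm)

theorem pow_depth_lt {m : ℕ} (hm : 1 ≤ m) : 7 ^ depth m < 7 * (m * 8 ^ m) := by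
  have h := Nat.pow_pred_clog_lt_self (b := 7) (by norm_num) (one_lt_mul_pow hm)
  have h1 : 7 ^ depth m = 7 * 7 ^ (depth m - 1) := by
    rw [← pow_succ', Nat.sub_add_cancel (depth_pos hm)]
  have h2 : (Nat.clog 7 (m * 8 ^ m)).pred = depth m - 1 := rfl
  rw [h2] at h
  omega

theorem le_depth {m : ℕ} (hm : 1 ≤ m) : m ≤ depth m := by
  by_contra h
  have h1 := le_pow_depth m
  have h2 : 7 ^ depth m < 7 ^ m := Nat.pow_lt_pow_right (by norm_num) (by omega)
  have h3 : 7 ^ m ≤ 8 ^ m := Nat.pow_le_pow_left (by norm_num) m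
  have h4 : 1 * 8 ^ m ≤ m * 8 ^ m := Nat.mul_le_mul_right _ hm
  omega

theorem depth_le {m : ℕ} (hm : 1 ≤ m) : depth m ≤ 2 * m := by
  have h1 := pow_depth_lt hm
  have h2 : m * 8 ^ m < 7 ^ (2 * m) := by
    have : m < 2 ^ m := Nat.lt_two_pow_self
    calc m * 8 ^ m < 2 ^ m * 8 ^ m := by gcongr
      _ = 16 ^ m := by rw [← mul_pow]; norm_num
      _ ≤ 49 ^ m := Nat.pow_le_pow_left (by norm_num) m
      _ = 7 ^ (2 * m) := by rw [pow_mul]; norm_num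
  have h3 : 7 ^ depth m < 7 ^ (2 * m + 1) := by rw [pow_succ]; omega
  have := (Nat.pow_lt_pow_iff_right (by norm_num)).1 h3
  omega

/-- The computed terms, as a relation on `Fin (2 ^ L)`. -/
def goodFin (L : ℕ) (i k j : Fin (2 ^ L)) : Bool := good L i k j

theorem rel_goodFin (L : ℕ) (i k j : Fin (2 ^ L)) : rel (goodFin L) i k j = goodInd L i k j := rfl

/-- `N` is comparable to `7 ^ (L / 3)` up to a polynomial factor, so error terms are compared
through their cubes, which avoids fractional exponents. -/
theorem le_of_cube_le {x y : ℝ} (hy : 0 ≤ y) (h : x ^ 3 ≤ y ^ 3) : x ≤ y :=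
  le_of_pow_le_pow_left₀ three_ne_zero hy h

/-- The step between consecutive sampling densities. -/
def stepSize (m : ℕ) : ℕ := m / 64 + 1

/-- The loss from an imprecise sampling density is a factor of 1.04 per level after cubing, because
`8 ≤ 1.04 ^ 64`. This is what makes 64 scales sufficient. -/
theorem two_pow_stepSize (m : ℕ) : ((2 : ℝ) ^ stepSize m) ^ 3 ≤ 8 * 1.04 ^ m := by
  have : (8 : ℝ) ≤ 1.04 ^ 64 := by norm_num
  calc ((2 : ℝ) ^ stepSize m) ^ 3 = 8 * 8 ^ (m / 64) := by
        rw [stepSize, ← pow_mul, mul_comm, pow_mul, ← pow_succ']; norm_num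
    _ ≤ 8 * (1.04 ^ 64) ^ (m / 64) := by gcongr
    _ ≤ 8 * 1.04 ^ m := by
        rw [← pow_mul]
        gcongr
        · norm_num
        · exact Nat.mul_div_le m 64

/-- A polynomial factor of degree at most 3 in the cube costs at most one factor `L`, and a ratio up
to `0.99 ^ 3` becomes 0.99. -/
theorem error_term (L : ℕ) (hL : 1 ≤ L) (K C e : ℕ) (θ x : ℝ) (hx : x ^ 3 ≤ C * (L : ℝ) ^ e * θ ^ L)
    (he : e ≤ 3) (hK : C ≤ K ^ 3) (hθ0 : 0 ≤ θ) (hθ : θ ≤ 0.99 ^ 3) :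
    x ≤ K * (L * 0.99 ^ L) := by
  refine le_of_cube_le (by positivity) (hx.trans ?_)
  have h1 : (1 : ℝ) ≤ L := by exact_mod_cast hL
  calc (C : ℝ) * (L : ℝ) ^ e * θ ^ L ≤ (K : ℝ) ^ 3 * (L : ℝ) ^ 3 * (0.99 ^ 3) ^ L := by
        gcongr
        exact_mod_cast hK
    _ = _ := by rw [← pow_mul, mul_comm 3 L, pow_mul]; ring

/-- After cancellation the variance part consists of `N * (25/49) ^ L` (twice) and `N ^ 2 * (13/49)
^ L`, the collision part of `B * p ^ 2 * (25/7) ^ L` and `B * p * (13/7) ^ L` (twice), where `B` is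
the loss from the density. All of them decay exponentially, and `77 = 4 * (1 + 1 + 1) + 4 * (8 + 4 +
4) + 1`. -/
theorem numeric_bound (m : ℕ) (hm : 1 ≤ m) (N p ρ : ℝ) (hN : N = 2 ^ m) (hpN : p = N⁻¹) (hpρ : p ≤ ρ)
    (hρB : ρ ≤ 2 ^ stepSize m * p) :
    4 / (p * ρ * 7 ^ depth m) ^ 2 *
      (p * ρ ^ 2 * 25 ^ depth m + p ^ 2 * ρ * 25 ^ depth m + p * ρ * 13 ^ depth m) +
    4 / (p * ρ * 7 ^ depth m) *
      (p ^ 2 * ρ ^ 2 * 25 ^ depth m + p * ρ ^ 2 * 13 ^ depth m + p ^ 2 * ρ * 13 ^ depth m) +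
    Real.exp (-(p * ρ * 7 ^ depth m / (4 * N))) ≤ 77 * (depth m * 0.99 ^ depth m) := by
  have hL1 : 1 ≤ depth m := depth_pos hm
  have hmL : m ≤ depth m := le_depth hm
  have hB3 : ((2 : ℝ) ^ stepSize m) ^ 3 ≤ 8 * 1.04 ^ depth m := (two_pow_stepSize m).trans (by
    gcongr
    norm_num)
  have hN3 : N ^ 3 = 8 ^ m := by rw [hN, ← pow_mul, mul_comm, pow_mul]; norm_num
  have hT1 : m * N ^ 3 ≤ 7 ^ depth m := by rw [hN3]; exact_mod_cast le_pow_depth m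
  have hT2 : (7 : ℝ) ^ depth m ≤ 7 * (m * N ^ 3) := by rw [hN3]; exact_mod_cast (pow_depth_lt hm).le
  have hLm : (depth m : ℝ) ≤ 2 * m := by exact_mod_cast depth_le hm
  have hB1 : (1 : ℝ) ≤ 2 ^ stepSize m := one_le_pow₀ (by norm_num)
  have hN0 : 0 < N := by rw [hN]; positivity
  clear hN
  generalize (2 : ℝ) ^ stepSize m = B at *
  generalize depth m = L at *
  have hB0 : 0 < B := by linarith
  have hmL' : (m : ℝ) ≤ L := by exact_mod_cast hmL
  have hm1 : (1 : ℝ) ≤ m := by exact_mod_cast hm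
  have hT3 : N ^ 3 ≤ 7 ^ L := le_trans (by nlinarith [pow_pos hN0 3]) hT1
  have hT4 : (N⁻¹) ^ 3 ≤ 7 * L * (1 / 7) ^ L := by
    rw [inv_pow, one_div, inv_pow, ← div_eq_mul_inv, inv_eq_one_div,
      div_le_div_iff₀ (by positivity) (by positivity), one_mul]
    calc (7 : ℝ) ^ L ≤ 7 * (m * N ^ 3) := hT2
      _ ≤ 7 * (L * N ^ 3) := by gcongr
      _ = _ := by ring
  have hp0 : 0 < p := by rw [hpN]; positivity
  have hρ0 : 0 < ρ := hp0.trans_le hpρ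
  -- The ratio of the cube is `7 * (25/49) ^ 3 = 15625/16807`. The other terms lead to the same
  -- number or to `2197/2401`, times 1.04 where `B` occurs.
  have t1 : N * (25 / 49) ^ L ≤ (1 : ℕ) * (L * 0.99 ^ L) := by
    refine error_term L hL1 1 1 0 (15625 / 16807) _ ?_ (by norm_num) (by norm_num) (by norm_num)
      (by norm_num)
    calc (N * (25 / 49) ^ L) ^ 3 = N ^ 3 * ((25 / 49) ^ 3) ^ L := by
          rw [mul_pow, ← pow_mul, mul_comm L 3, pow_mul]
      _ ≤ 7 ^ L * ((25 / 49) ^ 3) ^ L := by gcongr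
      _ = _ := by rw [← mul_pow]; norm_num
  have t2 : N ^ 2 * (13 / 49) ^ L ≤ (1 : ℕ) * (L * 0.99 ^ L) := by
    refine error_term L hL1 1 1 0 (2197 / 2401) _ ?_ (by norm_num) (by norm_num) (by norm_num)
      (by norm_num)
    calc (N ^ 2 * (13 / 49) ^ L) ^ 3 = N ^ 3 * N ^ 3 * ((13 / 49) ^ 3) ^ L := by
          rw [mul_pow, ← pow_mul _ L, mul_comm L 3, pow_mul _ 3]; ring
      _ ≤ 7 ^ L * 7 ^ L * ((13 / 49) ^ 3) ^ L := by gcongr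
      _ = _ := by rw [← mul_pow, ← mul_pow]; norm_num
  -- `392 = 8 * 7 ^ 2`: 8 comes from the cube of `B`, and each factor 7 from the rounding of `L` in
  -- the bound for `N⁻¹ ^ 3`.
  have t3 : B * p ^ 2 * (25 / 7) ^ L ≤ (8 : ℕ) * (L * 0.99 ^ L) := by
    refine error_term L hL1 8 392 2 (1.04 * (15625 / 16807)) _ ?_ (by norm_num) (by norm_num)
      (by norm_num) (by norm_num)
    calc (B * p ^ 2 * (25 / 7) ^ L) ^ 3 = B ^ 3 * ((N⁻¹) ^ 3) ^ 2 * ((25 / 7) ^ 3) ^ L := by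
          rw [mul_pow, ← pow_mul _ L, mul_comm L 3, pow_mul _ 3, hpN]; ring
      _ ≤ (8 * (1.04 : ℝ) ^ L) * (7 * (L : ℝ) * (1 / 7) ^ L) ^ 2 * ((25 / 7) ^ 3) ^ L := by gcongr
      _ = 392 * (L : ℝ) ^ 2 * (1.04 ^ L * ((1 / 7) ^ L * (1 / 7) ^ L) * ((25 / 7) ^ 3) ^ L) := by
          ring
      _ = _ := by rw [← mul_pow, ← mul_pow, ← mul_pow]; norm_num
  have t4 : B * p * (13 / 7) ^ L ≤ (4 : ℕ) * (L * 0.99 ^ L) := by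
    refine error_term L hL1 4 56 1 (1.04 * (2197 / 2401)) _ ?_ (by norm_num) (by norm_num)
      (by norm_num) (by norm_num)
    calc (B * p * (13 / 7) ^ L) ^ 3 = B ^ 3 * (N⁻¹) ^ 3 * ((13 / 7) ^ 3) ^ L := by
          rw [mul_pow, ← pow_mul _ L, mul_comm L 3, pow_mul _ 3, hpN]; ring
      _ ≤ (8 * (1.04 : ℝ) ^ L) * (7 * (L : ℝ) * (1 / 7) ^ L) * ((13 / 7) ^ 3) ^ L := by gcongr
      _ = 56 * (L : ℝ) ^ 1 * (1.04 ^ L * (1 / 7) ^ L * ((13 / 7) ^ 3) ^ L) := by ring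
      _ = _ := by rw [← mul_pow, ← mul_pow]; norm_num
  have t5 : Real.exp (-(p * ρ * 7 ^ L / (4 * N))) ≤ L * 0.99 ^ L := by
    -- The exponent is at least `p ^ 2 * m * N ^ 3 / (4 * N) = m / 4`, and `L ≤ 2 * m`.
    have h1 : (L : ℝ) / 8 ≤ p * ρ * 7 ^ L / (4 * N) := by
      calc (L : ℝ) / 8 ≤ m / 4 := by
            linarith
        _ = p * p * (m * N ^ 3) / (4 * N) := by rw [hpN]; field_simp
        _ ≤ _ := by gcongr
    calc Real.exp (-(p * ρ * 7 ^ L / (4 * N))) ≤ Real.exp (-(L / 8)) := by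
          rw [Real.exp_le_exp]; linarith
      _ = (Real.exp (1 / 8))⁻¹ ^ L := by
          rw [inv_pow, ← Real.exp_nat_mul, ← Real.exp_neg]; congr 1; ring
      _ ≤ 0.99 ^ L := by
          refine pow_le_pow_left₀ (by positivity) ?_ L
          rw [inv_le_comm₀ (Real.exp_pos _) (by norm_num)]
          refine le_trans ?_ (Real.add_one_le_exp (1 / 8))
          norm_num
      _ ≤ L * 0.99 ^ L := le_mul_of_one_le_left (by positivity) (by exact_mod_cast hL1)
  have s1 : 4 / (p * ρ * 7 ^ L) ^ 2 * (p * ρ ^ 2 * 25 ^ L + p ^ 2 * ρ * 25 ^ L + p * ρ * 13 ^ L) =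
      4 * (p⁻¹ * (25 / 49) ^ L + ρ⁻¹ * (25 / 49) ^ L + p⁻¹ * ρ⁻¹ * (13 / 49) ^ L) := by
    have : (49 : ℝ) ^ L = 7 ^ L * 7 ^ L := by rw [← mul_pow]; norm_num
    rw [div_pow, div_pow, this]
    generalize (25 : ℝ) ^ L = u
    generalize (13 : ℝ) ^ L = v
    have : (7 : ℝ) ^ L ≠ 0 := by positivity
    generalize (7 : ℝ) ^ L = z at *
    clear * - hp0 hρ0 this
    field_simp
  have s2 : 4 / (p * ρ * 7 ^ L) *
      (p ^ 2 * ρ ^ 2 * 25 ^ L + p * ρ ^ 2 * 13 ^ L + p ^ 2 * ρ * 13 ^ L) =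
      4 * (p * ρ * (25 / 7) ^ L + ρ * (13 / 7) ^ L + p * (13 / 7) ^ L) := by
    rw [div_pow, div_pow]
    generalize (25 : ℝ) ^ L = u
    generalize (13 : ℝ) ^ L = v
    have : (7 : ℝ) ^ L ≠ 0 := by positivity
    generalize (7 : ℝ) ^ L = z at *
    clear * - hp0 hρ0 this
    field_simp
  have hpi : p⁻¹ = N := by rw [hpN]; simp
  have hρi : ρ⁻¹ ≤ N := by rw [← hpi]; gcongr
  have u1 : p⁻¹ * (25 / 49) ^ L + ρ⁻¹ * (25 / 49) ^ L + p⁻¹ * ρ⁻¹ * (13 / 49) ^ L ≤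
      N * (25 / 49) ^ L + N * (25 / 49) ^ L + N ^ 2 * (13 / 49) ^ L := by
    rw [hpi, sq]
    gcongr
  have u2 : p * ρ * (25 / 7) ^ L + ρ * (13 / 7) ^ L + p * (13 / 7) ^ L ≤
      B * p ^ 2 * (25 / 7) ^ L + B * p * (13 / 7) ^ L + B * p * (13 / 7) ^ L := by
    have : p * ρ ≤ B * p ^ 2 := by nlinarith
    have : p ≤ B * p := le_mul_of_one_le_left hp0.le hB1
    gcongr
  rw [s1, s2]
  push_cast at t1 t2 t3 t4
  linarith

/-- Enlarging the range of `g` by the factor `2 ^ t` dilutes `S`: when `2 ^ t ≤ |S| ≤ 2 ^ (t +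
stepSize m)`, its density lies between `1 / N` and `2 ^ stepSize m / N`, whatever the number of
witnesses. -/
theorem failure_rate {X Y Z : Type*} [Fintype X] [Fintype Y] [Fintype Z] [DecidableEq X]
    [DecidableEq Y] [DecidableEq Z] [Nonempty X] [Nonempty Y] [Nonempty Z] (m t : ℕ) (hm : 1 ≤ m)
    (hX : Fintype.card X = 2 ^ m) (hY : Fintype.card Y = 2 ^ m) (hZ : Fintype.card Z = 2 ^ (m + t))
    (x : X) (S : Finset Z) (y : Y) (hS : 2 ^ t ≤ S.card) (hS' : S.card ≤ 2 ^ (t + stepSize m)) :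
    avg (fun f : Fin (2 ^ depth m) → X => avg fun g : Fin (2 ^ depth m) → Z =>
      avg fun h : Fin (2 ^ depth m) → Y => failure (goodFin (depth m)) f g h x S y) ≤
      77 * (depth m * 0.99 ^ depth m) := by
  have hρ : (S.card : ℝ) / Fintype.card Z = S.card / (2 ^ m * 2 ^ t) := by
    rw [hZ, pow_add]; norm_cast
  have hY' : (Fintype.card Y : ℝ) = 2 ^ m := by rw [hY]; norm_cast
  have hcard : (2 : ℝ) ^ t ≤ S.card := by exact_mod_cast hS
  have hcard' : (S.card : ℝ) ≤ 2 ^ t * 2 ^ stepSize m := by rw [← pow_add]; exact_mod_cast hS'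
  have hpρ : ((2 : ℝ) ^ m)⁻¹ ≤ S.card / (2 ^ m * 2 ^ t) := by
    rw [inv_eq_one_div, div_le_div_iff₀ (by positivity) (by positivity), one_mul, mul_comm]
    gcongr
  refine (avg_failure (goodFin (depth m)) x S y ((2 : ℝ) ^ m)⁻¹ (S.card / (2 ^ m * 2 ^ t))
    (((2 : ℝ) ^ m)⁻¹ * (S.card / (2 ^ m * 2 ^ t)) * 7 ^ depth m)
    (7 ^ depth m) (13 ^ depth m) (25 ^ depth m) (by rw [hX]; simp) hρ.symm rfl ?_
    (by simpa only [Finset.sum_range, rel_goodFin] using sum_good _)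
    (by simpa only [Finset.sum_range, rel_goodFin] using sum_sq_good_i _)
    (by simpa only [Finset.sum_range, rel_goodFin] using sum_sq_good_k _)
    (by simpa only [Finset.sum_range, rel_goodFin] using sum_sq_good_j _)
    (by simpa only [Finset.sum_range, rel_goodFin] using sum_sq_good_ik _)
    (by simpa only [Finset.sum_range, rel_goodFin] using sum_sq_good_ij _)
    (by simpa only [Finset.sum_range, rel_goodFin] using sum_sq_good_kj _)).trans ?_
  · have : (0 : ℝ) < S.card := lt_of_lt_of_le (by positivity) hcard
    positivity
  · rw [hY']
    refine numeric_bound m hm _ _ _ rfl rfl hpρ ?_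
    rw [← div_eq_mul_inv, div_le_div_iff₀ (by positivity) (by positivity)]
    calc (S.card : ℝ) * 2 ^ m ≤ 2 ^ t * 2 ^ stepSize m * 2 ^ m := by gcongr
      _ = _ := by ring

/-! ### Independent repetitions -/

instance : IsProbabilityMeasure coinMeasure := by
  unfold coinMeasure; infer_instance

theorem coinMeasure_cylinder {ι : Type*} [Fintype ι] (e : ι → ℕ) (he : Function.Injective e)
    (v : ι → Bool) : coinMeasure.real {ω | ∀ a, ω (e a) = v a} = (1 / 2) ^ Fintype.card ι := by
  have hset : {ω : ℕ → Bool | ∀ a, ω (e a) = v a} =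
      Set.pi (Finset.univ.map ⟨e, he⟩ : Finset ℕ) (fun k => {b | ∀ a, e a = k → b = v a}) := by
    ext ω
    simp only [Set.mem_ofPred_eq, Set.mem_pi, Finset.coe_map, Function.Embedding.coeFn_mk,
      Finset.coe_univ, Set.image_univ, Set.mem_range, forall_exists_index, forall_apply_eq_imp_iff]
    exact ⟨fun h a b hb => by rw [← hb, h], fun h a => h a a rfl⟩
  rw [measureReal_def, hset, coinMeasure, Measure.infinitePi_pi]
  · rw [Finset.prod_map]
    have h1 (a : ι) : {b : Bool | ∀ a', e a' = e a → b = v a'} = {v a} := by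
      ext b
      simp only [Set.mem_ofPred_eq, Set.mem_singleton_iff]
      exact ⟨fun h => h a rfl, fun h a' ha => by rw [h, he ha]⟩
    simp only [Function.Embedding.coeFn_mk, h1]
    have h2 (b : Bool) : ((PMF.uniformOfFintype Bool).toMeasure {b}) = 2⁻¹ := by
      rw [PMF.toMeasure_apply_singleton _ _ (measurableSet_singleton _)]
      simp
    simp [h2]
  · intro k _
    exact (Set.toFinite _).measurableSet

/-- The bridge from the coin measure to counting: an event that depends on finitely many coins is a
disjoint union of cylinders of equal measure. -/
theorem coinMeasure_finite {ι : Type*} [Fintype ι] [DecidableEq ι] (e : ι → ℕ)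
    (he : Function.Injective e) (Q : Finset (ι → Bool)) :
    MeasurableSet {ω : ℕ → Bool | (fun a => ω (e a)) ∈ Q} ∧
    coinMeasure.real {ω | (fun a => ω (e a)) ∈ Q} = Q.card / Fintype.card (ι → Bool) := by
  have hset : {ω : ℕ → Bool | (fun a => ω (e a)) ∈ Q} =
      ⋃ v ∈ Q, {ω | ∀ a, ω (e a) = v a} := by
    ext ω
    simp only [Set.mem_ofPred_eq, Set.mem_iUnion, exists_prop]
    constructor
    · exact fun h => ⟨_, h, fun _ => rfl⟩
    · rintro ⟨v, hv, h⟩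
      rwa [show (fun a => ω (e a)) = v from funext h]
  have hmeas (v : ι → Bool) : MeasurableSet {ω : ℕ → Bool | ∀ a, ω (e a) = v a} := by
    rw [Set.ofPred_forall]
    exact MeasurableSet.iInter fun a => (measurableSet_singleton (v a)).preimage (measurable_pi_apply (e a))
  constructor
  · rw [hset]
    exact Finset.measurableSet_biUnion _ fun v _ => hmeas v
  · rw [hset, measureReal_biUnion_finset]
    · simp only [coinMeasure_cylinder e he, Finset.sum_const, nsmul_eq_mul]
      simp [div_eq_mul_inv]
    · intro v _ v' _ hne
      refine Set.disjoint_left.2 fun ω h h' => hne (funext fun a => ?_)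
      rw [← h a, ← h' a]
    · exact fun v _ => hmeas v

theorem avg_comp_equiv {Ω Ω' : Type*} [Fintype Ω] [Fintype Ω'] (e : Ω ≃ Ω') (F : Ω' → ℝ) :
    avg (fun x => F (e x)) = avg F := by
  rw [avg, avg, Equiv.sum_comp e, Fintype.card_congr e]

theorem avg_prod {Ω Ω' : Type*} [Fintype Ω] [Fintype Ω'] (F : Ω × Ω' → ℝ) :
    avg F = avg fun x => avg fun y => F (x, y) := by
  simp only [avg, Fintype.sum_prod_type, Fintype.card_prod, ← Finset.sum_div]
  push_cast
  rw [div_div, mul_comm (Fintype.card Ω : ℝ)]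

theorem avg_ind_eq {V : Type*} [Fintype V] [DecidableEq V] (S : Finset V) :
    avg (ind S) = S.card / Fintype.card V := by
  simp [avg, ind]

/-! ### The layout of the random bits -/

/-- The positions of the random bits of a run: `m` bits for each row, `e` bits for each inner index,
`m` bits for each column of the `D × D` matrices. -/
abbrev Bits (m e D : ℕ) : Type := (Fin D × Fin m) ⊕ (Fin D × Fin e) ⊕ (Fin D × Fin m)

/-- Row `r` of a table holds the `r`-th digits of all `D` values, so that the digits of one value
are `D` positions apart. -/
def Bits.pos {m e D : ℕ} : Bits m e D → ℕ
  | .inl (i, r) => r * D + i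
  | .inr (.inl (k, r)) => (m + r) * D + k
  | .inr (.inr (j, r)) => (m + e + r) * D + j

theorem mul_add_lt_mul {D a b i : ℕ} (hi : i < D) (ha : a < b) : a * D + i < b * D := by
  have : (a + 1) * D ≤ b * D := Nat.mul_le_mul_right _ ha
  rw [add_mul] at this; omega

theorem mul_add_inj {D a b i j : ℕ} (hi : i < D) (hj : j < D) (h : a * D + i = b * D + j) :
    a = b ∧ i = j := by
  rcases lt_trichotomy a b with hab | hab | hab
  · have := mul_add_lt_mul hi hab; omega
  · subst hab; omega
  · have := mul_add_lt_mul hj hab; omega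

theorem Bits.pos_lt {m e D : ℕ} (b : Bits m e D) : b.pos < (2 * m + e) * D := by
  rcases b with ⟨i, r⟩ | ⟨i, r⟩ | ⟨i, r⟩ <;> exact mul_add_lt_mul i.2 (by omega)

theorem Bits.pos_injective {m e D : ℕ} : Function.Injective (Bits.pos (m := m) (e := e) (D := D)) := by
  rintro (⟨i, r⟩ | ⟨i, r⟩ | ⟨i, r⟩) (⟨j, s⟩ | ⟨j, s⟩ | ⟨j, s⟩) h <;>
  · obtain ⟨h1, h2⟩ := mul_add_inj i.2 j.2 h
    have := r.2
    have := s.2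
    first
    | (exfalso; omega)
    | (have e1 : i = j := Fin.ext h2
       have e2 : r = s := Fin.ext (by omega)
       rw [e1, e2])

/-- The maps that the random bits of a run describe. -/
def Bits.maps (m e D : ℕ) : (Bits m e D → Bool) ≃
    (Fin D → Fin m → Bool) × (Fin D → Fin e → Bool) × (Fin D → Fin m → Bool) :=
  (Equiv.sumArrowEquivProdArrow _ _ _).trans
    (Equiv.prodCongr (Equiv.curry _ _ _)
      ((Equiv.sumArrowEquivProdArrow _ _ _).trans
        (Equiv.prodCongr (Equiv.curry _ _ _) (Equiv.curry _ _ _))))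

/-- The number with the binary digits `b 0, …, b (k - 1)`, most significant digit first. -/
def ofBits (b : ℕ → ℕ) : ℕ → ℕ
  | 0 => 0
  | k + 1 => 2 * ofBits b k + b k

theorem ofBits_congr {b b' : ℕ → ℕ} {k : ℕ} (h : ∀ r < k, b r = b' r) :
    ofBits b k = ofBits b' k := by
  induction k with
  | zero => rfl
  | succ k ih => rw [ofBits, ofBits, ih fun r hr => h r (by omega), h k (by omega)]

theorem ofBits_lt {b : ℕ → ℕ} {k : ℕ} (h : ∀ r < k, b r < 2) : ofBits b k < 2 ^ k := by
  induction k with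
  | zero => simp [ofBits]
  | succ k ih =>
    have := ih fun r hr => h r (by omega)
    have := h k (by omega)
    rw [ofBits, pow_succ]; omega

theorem ofBits_inj {b b' : ℕ → ℕ} {k : ℕ} (h : ∀ r < k, b r < 2) (h' : ∀ r < k, b' r < 2)
    (e : ofBits b k = ofBits b' k) : ∀ r < k, b r = b' r := by
  induction k with
  | zero => intro r hr; omega
  | succ k ih =>
    have h1 := h k (by omega)
    have h2 := h' k (by omega)
    rw [ofBits, ofBits] at e
    intro r hr
    rcases Nat.lt_succ_iff_lt_or_eq.1 hr with hr | rfl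
    · exact ih (fun r hr => h r (by omega)) (fun r hr => h' r (by omega)) (by omega) r hr
    · omega

/-- The number that a vector of bits represents. -/
def number {k : ℕ} (v : Fin k → Bool) : ℕ :=
  ofBits (fun r => if h : r < k then (v ⟨r, h⟩).toNat else 0) k

theorem number_lt {k : ℕ} (v : Fin k → Bool) : number v < 2 ^ k :=
  ofBits_lt fun r hr => by rw [dif_pos hr]; exact Bool.toNat_lt _

theorem number_injective {k : ℕ} : Function.Injective (number (k := k)) := by
  intro v v' h
  ext r
  have := ofBits_inj (fun r hr => by rw [dif_pos hr]; exact Bool.toNat_lt _)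
    (fun r hr => by rw [dif_pos hr]; exact Bool.toNat_lt _) h r r.2
  simp only [r.2, dif_pos, Fin.eta] at this
  revert this
  cases v r <;> cases v' r <;> simp

theorem exists_number_eq {k a : ℕ} (ha : a < 2 ^ k) : ∃ v : Fin k → Bool, number v = a := by
  have hb : Function.Bijective fun v : Fin k → Bool => (⟨number v, number_lt v⟩ : Fin (2 ^ k)) := by
    rw [Fintype.bijective_iff_injective_and_card]
    exact ⟨fun v v' h => number_injective (by simpa using h), by simp⟩
  obtain ⟨v, hv⟩ := hb.2 ⟨a, ha⟩
  exact ⟨v, by simpa using hv⟩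

/-- The number that column `i` of a table of random bits represents; the table starts at position
`u` of the bit sequence and has `D` columns and `k` rows. -/
def column (ω : ℕ → Bool) (D u k i : ℕ) : ℕ := ofBits (fun r => (ω (u + r * D + i)).toNat) k

/-- The run whose random bits start at position `u` isolates a witness for the entry `x, y`;
the witnesses are the numbers satisfying `S`. -/
def IsolatesAt (ω : ℕ → Bool) (L m e u x y : ℕ) (S : ℕ → Prop) : Prop :=
  ∃ i < 2 ^ L, ∃ j < 2 ^ L, column ω (2 ^ L) u m i = x ∧
    column ω (2 ^ L) (u + (m + e) * 2 ^ L) m j = y ∧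
    ∃! k, k < 2 ^ L ∧ S (column ω (2 ^ L) (u + m * 2 ^ L) e k) ∧ good L i k j = true

/-- The number of random bits of a run. -/
def runBits (L m e : ℕ) : ℕ := (2 * m + e) * 2 ^ L

/-- Passes from bit vectors, for which the probabilities are computed, to the numbers that the
program reads off its tables. -/
theorem Isolates.isolatesAt {ω : ℕ → Bool} {L m e u : ℕ} {b : Bits m e (2 ^ L) → Bool}
    (hb : ∀ a, b a = ω (u + a.pos)) {x y : Fin m → Bool} {S : Finset (Fin e → Bool)} {P : ℕ → Prop}
    (hS : ∀ z, z ∈ S ↔ P (number z))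
    (h : Isolates (goodFin L) (Bits.maps m e (2 ^ L) b).1 (Bits.maps m e (2 ^ L) b).2.1
      (Bits.maps m e (2 ^ L) b).2.2 x S y) :
    IsolatesAt ω L m e u (number x) (number y) P := by
  have h1 (i : Fin (2 ^ L)) : column ω (2 ^ L) u m i = number ((Bits.maps m e (2 ^ L) b).1 i) := by
    refine ofBits_congr fun r hr => ?_
    have := hb (.inl (i, ⟨r, hr⟩))
    rw [dif_pos hr]
    simp only [Bits.pos] at this
    rw [add_assoc, ← this]; rfl
  have h2 (i : Fin (2 ^ L)) : column ω (2 ^ L) (u + m * 2 ^ L) e i =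
      number ((Bits.maps m e (2 ^ L) b).2.1 i) := by
    refine ofBits_congr fun r hr => ?_
    have := hb (.inr (.inl (i, ⟨r, hr⟩)))
    rw [dif_pos hr]
    simp only [Bits.pos] at this
    rw [show u + m * 2 ^ L + r * 2 ^ L + i = u + ((m + r) * 2 ^ L + i) by ring, ← this]; rfl
  have h3 (i : Fin (2 ^ L)) : column ω (2 ^ L) (u + (m + e) * 2 ^ L) m i =
      number ((Bits.maps m e (2 ^ L) b).2.2 i) := by
    refine ofBits_congr fun r hr => ?_
    have := hb (.inr (.inr (i, ⟨r, hr⟩)))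
    rw [dif_pos hr]
    simp only [Bits.pos] at this
    rw [show u + (m + e) * 2 ^ L + r * 2 ^ L + i = u + ((m + e + r) * 2 ^ L + i) by ring, ← this]
    rfl
  obtain ⟨i, j, hi, hj, k, hk, huniq⟩ := h
  refine ⟨i, i.2, j, j.2, by rw [h1, hi], by rw [h3, hj], k, ⟨k.2, ?_, hk.2⟩, ?_⟩
  · rw [h2, ← hS]; exact hk.1
  · rintro k' ⟨hk', hk2, hk3⟩
    have := huniq ⟨k', hk'⟩ ⟨by rw [hS, ← h2]; exact hk2, hk3⟩
    rw [← this]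

/-! ### The failure probability of one run and of many -/

/-- All binary digits of `2 ^ L - 1` are 1, and the excluded pattern needs a digit 0 in `i`. -/
theorem good_last (L k j : ℕ) : good L (2 ^ L - 1) k j = true := by
  induction L generalizing k j with
  | zero => rfl
  | succ L ih =>
    have h1 : (2 ^ (L + 1) - 1) / 2 = 2 ^ L - 1 := by rw [pow_succ]; omega
    have h2 : (2 ^ (L + 1) - 1) % 2 = 1 := by
      have : 0 < 2 ^ L := by positivity
      rw [pow_succ]; omega
    rw [good, h1, h2, ih]
    simp

/-- The bound of `failure_rate` is void for small `L`. There it suffices that some outcome of the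
coins succeeds: constant maps for rows and columns, and a single inner index sent into `S`. -/
theorem exists_isolates {L : ℕ} {X Y Z : Type*} (x : X) (y : Y) (S : Finset Z) (z z' : Z)
    (hz : z ∈ S) (hz' : z' ∉ S) : ∃ f g h, Isolates (goodFin L) f g h x S y := by
  have h0 : 2 ^ L - 1 < 2 ^ L := Nat.sub_lt (by positivity) one_pos
  refine ⟨fun _ => x, fun k => if k = ⟨_, h0⟩ then z else z', fun _ => y, ⟨_, h0⟩, ⟨_, h0⟩, rfl, rfl,
    ⟨_, h0⟩, ⟨by simp [hz], good_last _ _ _⟩, ?_⟩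
  rintro k ⟨hk, -⟩
  by_contra hne
  simp only [if_neg hne] at hk
  exact hz' hk

theorem card_div_le {V : Type*} [Fintype V] [DecidableEq V] (T : Finset V) (v : V) (hv : v ∉ T) :
    (T.card : ℝ) / Fintype.card V ≤ 1 - 1 / Fintype.card V := by
  have h : T.card < Fintype.card V := Finset.card_lt_univ_of_notMem hv
  have h0 : (0 : ℝ) < Fintype.card V := by exact_mod_cast (Nat.zero_le _).trans_lt h
  have h1 : (T.card : ℝ) + 1 ≤ Fintype.card V := by exact_mod_cast h
  rw [div_le_iff₀ h0, sub_mul, div_mul_cancel₀ _ h0.ne']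
  linarith

theorem card_cube {ι V : Type*} [Fintype ι] [DecidableEq ι] [Fintype V] [DecidableEq V] [Nonempty V]
    (T : Finset V) (Q : Finset (ι → V)) (hQ : ∀ v, v ∈ Q ↔ ∀ i, v i ∈ T) :
    (Q.card : ℝ) / Fintype.card (ι → V) = (T.card / Fintype.card V) ^ Fintype.card ι := by
  have h := avg_prod_ind (U := ι) Finset.univ T
  rw [Finset.card_univ] at h
  rw [← h, ← avg_ind_eq Q]
  congr; ext v
  by_cases hv : v ∈ Q
  · rw [ind, if_pos hv, Finset.prod_eq_one fun i _ => ?_]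
    rw [ind, if_pos ((hQ v).1 hv i)]
  · obtain ⟨i, hi⟩ := not_forall.1 ((hQ v).not.1 hv)
    rw [ind, if_neg hv, Finset.prod_eq_zero (Finset.mem_univ i)]
    rw [ind, if_neg hi]

/-- The probability that none of `R` runs isolates a witness for a given entry. -/
theorem repeated_failure (m t off R x y : ℕ) (hm : 1 ≤ m) (ht : t ≤ m) (hx : x < 2 ^ m)
    (hy : y < 2 ^ m) (P : ℕ → Prop) (S : Finset ℕ) (hS : ∀ z, z ∈ S ↔ P z) (hSm : ∀ z ∈ S, z < 2 ^ m)
    (hc : 2 ^ t ≤ S.card) (hc' : S.card < 2 ^ (t + stepSize m)) :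
    ∃ φ : ℝ, 0 ≤ φ ∧ φ ≤ 77 * (depth m * 0.99 ^ depth m) ∧
      φ ≤ 1 - 1 / 2 ^ (4 * depth m * 2 ^ depth m) ∧
      coinMeasure.real {ω | ∀ r < R, ¬ IsolatesAt ω (depth m) m (m + t)
        (off + r * runBits (depth m) m (m + t)) x y P} ≤ φ ^ R := by
  classical
  set L := depth m with hL
  set e := m + t with he
  obtain ⟨xv, rfl⟩ := exists_number_eq hx
  obtain ⟨yv, rfl⟩ := exists_number_eq hy
  set Sv : Finset (Fin e → Bool) := {z | number z ∈ S} with hSv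
  have hmem (z : Fin e → Bool) : z ∈ Sv ↔ P (number z) := by simp [hSv, hS]
  have hcard : Sv.card = S.card := by
    refine Finset.card_bij (fun z _ => number z) (fun z hz => by simpa [hSv] using hz)
      (fun z _ z' _ h => number_injective h) fun a ha => ?_
    obtain ⟨z, hz⟩ := exists_number_eq (k := e)
      ((hSm a ha).trans_le (Nat.pow_le_pow_right (by norm_num) (by omega)))
    exact ⟨z, by simpa [hSv, hz] using ha, hz⟩
  set T : Finset (Bits m e (2 ^ L) → Bool) := {b | ¬ Isolates (goodFin L)
    (Bits.maps m e (2 ^ L) b).1 (Bits.maps m e (2 ^ L) b).2.1 (Bits.maps m e (2 ^ L) b).2.2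
    xv Sv yv} with hT
  refine ⟨T.card / Fintype.card (Bits m e (2 ^ L) → Bool), by positivity, ?_, ?_, ?_⟩
  · rw [← avg_ind_eq]
    have h := failure_rate (X := Fin m → Bool) (Y := Fin m → Bool) (Z := Fin e → Bool) m t hm
      (by simp) (by simp) (by simp [he]) xv Sv yv (by rwa [hcard]) (by rw [hcard]; exact hc'.le)
    refine le_trans (le_of_eq ?_) h
    have h2 := avg_comp_equiv (Bits.maps m e (2 ^ L)) (fun c =>
      failure (goodFin L) c.1 c.2.1 c.2.2 xv Sv yv)
    rw [avg_prod] at h2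
    simp only [avg_prod] at h2
    rw [← h2]
    refine congrArg avg (funext fun b => ?_)
    simp only [ind, hT, Finset.mem_filter, Finset.mem_univ, true_and, failure]
    split_ifs <;> rfl
  · obtain ⟨z, hz⟩ := Finset.card_pos.1 (hcard ▸ lt_of_lt_of_le (by positivity) hc)
    -- If `S` filled the range of `g`, then `2 ^ (m + t) < 2 ^ (t + stepSize m)`, that is `m < m /
    -- 64 + 1`, which fails for `m ≥ 1`.
    obtain ⟨z', hz'⟩ : ∃ z', z' ∉ Sv := by
      by_contra! h
      have h1 : Sv = Finset.univ := Finset.eq_univ_iff_forall.2 h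
      rw [h1, Finset.card_univ] at hcard
      rw [← hcard] at hc'
      simp only [Fintype.card_fun, Fintype.card_bool, Fintype.card_fin] at hc'
      have := (Nat.pow_lt_pow_iff_right (by norm_num)).1 hc'
      rw [stepSize] at this
      omega
    obtain ⟨f, g, h, hI⟩ := exists_isolates (L := L) xv yv Sv z z' hz hz'
    refine (card_div_le T ((Bits.maps m e (2 ^ L)).symm (f, g, h)) ?_).trans ?_
    · simpa [hT] using hI
    -- One run uses `2 * m + e ≤ 4 * L` table rows of `2 ^ L` bits, because `e ≤ 2 * m` and `m ≤ L`.
    · have h1 : Fintype.card (Bits m e (2 ^ L) → Bool) ≤ 2 ^ (4 * L * 2 ^ L) := by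
        simp only [Fintype.card_fun, Fintype.card_bool, Fintype.card_sum, Fintype.card_prod,
          Fintype.card_fin]
        refine Nat.pow_le_pow_right (by norm_num) ?_
        have : m ≤ L := le_depth hm
        calc 2 ^ L * m + (2 ^ L * e + 2 ^ L * m) = (m + e + m) * 2 ^ L := by ring
          _ ≤ (4 * L) * 2 ^ L := Nat.mul_le_mul_right _ (by omega)
      have h2 : (0 : ℝ) < Fintype.card (Bits m e (2 ^ L) → Bool) := by
        exact_mod_cast Fintype.card_pos
      have h3 : (Fintype.card (Bits m e (2 ^ L) → Bool) : ℝ) ≤ 2 ^ (4 * L * 2 ^ L) := by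
        exact_mod_cast h1
      have := one_div_le_one_div_of_le h2 h3
      linarith
  -- The runs use disjoint blocks of coins, so their failures are independent.
  · set pos : Fin R × Bits m e (2 ^ L) → ℕ := fun a => off + (a.1 * runBits L m e + a.2.pos)
      with hpos
    have hinj : Function.Injective pos := by
      rintro ⟨r, a⟩ ⟨r', a'⟩ h
      obtain ⟨h1, h2⟩ := mul_add_inj a.pos_lt a'.pos_lt (Nat.add_left_cancel h)
      exact Prod.ext (Fin.ext h1) (Bits.pos_injective h2)
    set Q : Finset (Fin R × Bits m e (2 ^ L) → Bool) := {v | ∀ r, (fun a => v (r, a)) ∈ T} with hQ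
    set Q' : Finset (Fin R → Bits m e (2 ^ L) → Bool) := {v | ∀ r, v r ∈ T} with hQ'
    have h1 : Q.card = Q'.card := by
      refine Finset.card_equiv (Equiv.curry _ _ _) fun v => ?_
      simp only [hQ, hQ', Finset.mem_filter, Finset.mem_univ, true_and]
      rfl
    have h2 := card_cube T Q' (by simp [hQ'])
    rw [Fintype.card_fin] at h2
    rw [← h2, ← h1, ← Fintype.card_congr (Equiv.curry (Fin R) (Bits m e (2 ^ L)) Bool),
      ← (coinMeasure_finite pos hinj Q).2]
    refine measureReal_mono (fun ω hω => ?_) (measure_ne_top _ _)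
    simp only [hQ, hT, Set.mem_ofPred_eq, Finset.mem_filter, Finset.mem_univ, true_and]
    intro r hI
    refine hω r r.2 (hI.isolatesAt (fun a => ?_) hmem)
    simp only [hpos, add_assoc]

/-- A constant number of repetitions makes the probability of failure polynomially small. -/
theorem exists_repetitions (d : ℕ) : ∃ R : ℕ, ∀ L : ℕ, 1 ≤ L → ∀ φ : ℝ, 0 ≤ φ →
    φ ≤ 77 * (L * 0.99 ^ L) → φ ≤ 1 - 1 / 2 ^ (4 * L * 2 ^ L) → φ ^ R ≤ (1 / 2) ^ (d * L) := by
  -- `0.99 = (198 / 199) * 0.995`: the first factor absorbs `77 * L` from some `L₀` on, the second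
  -- remains as the rate.
  have hlim : Filter.Tendsto (fun L : ℕ => 77 * ((L : ℝ) * (198 / 199) ^ L)) Filter.atTop (nhds 0) := by
    simpa using (tendsto_self_mul_const_pow_of_lt_one (r := 198 / 199) (by norm_num)
      (by norm_num)).const_mul 77
  obtain ⟨L₀, hL₀⟩ := Filter.eventually_atTop.1 (hlim.eventually (eventually_le_nhds one_pos))
  set δ : ℝ := 1 - 1 / 2 ^ (4 * L₀ * 2 ^ L₀) with hδ
  have hδ1 : δ < 1 := by rw [hδ]; linarith [show (0 : ℝ) < 1 / 2 ^ (4 * L₀ * 2 ^ L₀) by positivity]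
  have hδ0 : 0 ≤ δ := by
    rw [hδ, sub_nonneg]
    exact div_le_one_of_le₀ (one_le_pow₀ (by norm_num)) (by positivity)
  -- `R₁` repetitions settle the finitely many `L ≤ L₀`, for which the failure probability is at
  -- most `δ < 1`; `R₂` repetitions settle the others.
  obtain ⟨R₁, hR₁⟩ := exists_pow_lt_of_lt_one (show (0 : ℝ) < (1 / 2) ^ (d * L₀) by positivity) hδ1
  obtain ⟨R₂, hR₂⟩ := exists_pow_lt_of_lt_one (show (0 : ℝ) < (1 / 2) ^ d by positivity)
    (show (0.995 : ℝ) < 1 by norm_num)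
  refine ⟨R₁ + R₂, fun L hL φ h0 h1 h2 => ?_⟩
  have hφ1 : φ ≤ 1 := h2.trans (by simp)
  rcases le_total L₀ L with h | h
  · have h3 : φ ≤ 0.995 ^ L := by
      calc φ ≤ 77 * (L * 0.99 ^ L) := h1
        _ = 77 * (L * (198 / 199) ^ L) * 0.995 ^ L := by
          rw [mul_assoc, mul_assoc, ← mul_pow]; norm_num
        _ ≤ 1 * 0.995 ^ L := mul_le_mul_of_nonneg_right (hL₀ L h) (by positivity)
        _ = _ := one_mul _
    calc φ ^ (R₁ + R₂) ≤ φ ^ R₂ := pow_le_pow_of_le_one h0 hφ1 (by omega)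
      _ ≤ (0.995 ^ L) ^ R₂ := by gcongr
      _ = (0.995 ^ R₂) ^ L := by rw [← pow_mul, ← pow_mul, mul_comm]
      _ ≤ ((1 / 2) ^ d) ^ L := by gcongr
      _ = _ := by rw [pow_mul]
  · have h3 : φ ≤ δ := by
      refine h2.trans (sub_le_sub_left ?_ 1)
      gcongr
      · norm_num
      · norm_num
    calc φ ^ (R₁ + R₂) ≤ φ ^ R₁ := pow_le_pow_of_le_one h0 hφ1 (by omega)
      _ ≤ δ ^ R₁ := by gcongr
      _ ≤ (1 / 2) ^ (d * L₀) := hR₁.le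
      _ ≤ _ := pow_le_pow_of_le_one (by norm_num) (by norm_num) (Nat.mul_le_mul_left _ h)

section Programs

variable {w c : ℕ} {ω : ℕ → Bool}

/-! ### Straight-line code -/

attribute [simp] Expr.eval Expr.ok Expr.cost

section
variable {l : List Var} {s s' : Store} {v : Var} {a x : ℕ}

@[simp] theorem Same.self : Same l s s := Same.refl l s

@[simp] theorem same_set (h : v ∈ l) : Same l (s'.set v x) s ↔ Same l s' s := by
  refine forall₂_congr fun u hu => ?_
  have : u ≠ v := fun e => hu (e ▸ h)
  simp [this]

@[simp] theorem same_put : Same l (s'.put a x) s ↔ Same l s' s := Iff.rfl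

@[simp] theorem same_tick : Same l s'.tick s ↔ Same l s' s := Iff.rfl

end

theorem Tot.le {p : Prog} {s : Store} {T T' : ℕ} {Q : Store → Prop} (h : Tot w c ω p s T Q)
    (hT : T ≤ T') : Tot w c ω p s T' Q := h.mono hT fun _ h => h

/-- Sequential composition of a list of programs. -/
def Prog.block : List Prog → Prog
  | [] => .nop
  | p :: l => .seq p (block l)

theorem Tot.block_nil {s : Store} {Q : Store → Prop} (h : Q s) : Tot w c ω (.block []) s 0 Q :=
  Tot.nop h

theorem Tot.block_cons {p : Prog} {l : List Prog} {s : Store} {T U : ℕ} {R Q : Store → Prop}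
    (hp : Tot w c ω p s T R) (hq : ∀ s', R s' → Tot w c ω (.block l) s' U Q) :
    Tot w c ω (.block (p :: l)) s (T + U) Q := Tot.seq hp hq

theorem Tot.block_assign {v : Var} {a : Expr} {l : List Prog} {s : Store} {U : ℕ}
    {Q : Store → Prop} (ha : a.ok w c s) (hv : a.eval s < 2 ^ w)
    (h : Tot w c ω (.block l) (s.set v (a.eval s)) U Q) :
    Tot w c ω (.block (.assign v a :: l)) s (a.cost + U) Q :=
  Tot.seq (R := fun s' => s' = s.set v (a.eval s)) (Tot.assign ha hv rfl) fun _ h' => h' ▸ h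

theorem Tot.block_put {a b : Expr} {l : List Prog} {s : Store} {U : ℕ}
    {Q : Store → Prop} (ha : a.ok w c s) (hb : b.ok w c s) (hv : b.eval s < 2 ^ c)
    (h : Tot w c ω (.block l) (s.put (a.eval s) (b.eval s)) U Q) :
    Tot w c ω (.block (.put a b :: l)) s (a.cost + b.cost + 1 + U) Q :=
  Tot.seq (R := fun s' => s' = s.put (a.eval s) (b.eval s)) (Tot.put ha hb hv rfl)
    fun _ h' => h' ▸ h

theorem Tot.block_toss {v : Var} {l : List Prog} {s : Store} {U : ℕ}
    {Q : Store → Prop} (hw : 1 ≤ w)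
    (h : Tot w c ω (.block l) (s.tick.set v (ω s.used).toNat) U Q) :
    Tot w c ω (.block (.toss v :: l)) s (1 + U) Q :=
  Tot.seq (R := fun s' => s' = s.tick.set v (ω s.used).toNat) (Tot.toss hw rfl) fun _ h' => h' ▸ h

/-- A conditional assignment. -/
def Prog.assignIf (a b : Expr) (v : Var) (e : Expr) : Prog := .ite a b (.assign v e) .nop

theorem Store.set_self (s : Store) (v : Var) : s.set v (s.env v) = s := by
  simp [Store.set]

theorem Tot.block_assignIf {a b e : Expr} {v : Var} {l : List Prog} {s : Store} {U : ℕ}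
    {Q : Store → Prop} (ha : a.ok w c s) (hb : b.ok w c s)
    (he : a.eval s < b.eval s → e.ok w c s ∧ e.eval s < 2 ^ w)
    (h : Tot w c ω (.block l)
      (s.set v (if a.eval s < b.eval s then e.eval s else s.env v)) U Q) :
    Tot w c ω (.block (.assignIf a b v e :: l)) s (a.cost + b.cost + 1 + e.cost + U) Q := by
  refine Tot.seq (R := fun s' => s' = s.set v (if a.eval s < b.eval s then e.eval s else s.env v))
    ((Tot.ite (U := 0) ha hb (fun hlt => Tot.assign (he hlt).1 (he hlt).2 (by rw [if_pos hlt]))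
      fun hlt => Tot.nop (by rw [if_neg hlt, Store.set_self])).mono (by omega) fun _ h => h)
    fun _ h' => h' ▸ h

/-! ### Reading the random maps -/

/-- One level of `split`. -/
def splitStep : Prog := .block [
  .assign .h (.half (.var .q)),
  .assignIf (.add (.var .h) (.var .h)) (.var .q) .k (.add (.var .k) (.var .pw)),
  .assign .q (.half (.var .h)),
  .assignIf (.add (.var .q) (.var .q)) (.var .h) .i (.add (.var .i) (.var .pw)),
  .assign .pw (.add (.var .pw) (.var .pw))]

/-- Decode the Morton index `a` into its row `i` and its column `k`. -/
def split : Prog := .block [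
  .assign .q (.var .a), .assign .i (.lit 0), .assign .k (.lit 0), .assign .pw (.lit 1),
  .forLt .c .L splitStep]

theorem split_spec {s : Store} {L a : ℕ} (hL : s.env .L = L) (ha : s.env .a = a) (haw : a < 2 ^ w)
    (hw : 2 ^ (L + 1) < 2 ^ w) : Tot w c ω split s (60 * (L + 1)) fun s' =>
      s'.env .i = row L a ∧ s'.env .k = col L a ∧
      Same [.q, .h, .i, .k, .pw, .c] s' s ∧ s'.mem = s.mem ∧ s'.used = s.used := by
  have h1w : 1 < 2 ^ w := lt_of_le_of_lt Nat.one_le_two_pow hw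
  have hLw : L < 2 ^ w := (Nat.lt_two_pow_self.trans (Nat.pow_lt_pow_right (by norm_num)
    (Nat.lt_succ_self L))).trans hw
  unfold split
  apply Tot.le
  · apply Tot.block_assign
    · simp
    · simpa [ha]
    apply Tot.block_assign
    · simp
    · simp
    apply Tot.block_assign
    · simp
    · simp
    apply Tot.block_assign
    · simp [h1w]
    · simp [h1w]
    apply Tot.block_cons
    -- After `r` rounds `q` has lost its `r` lowest digits in base 4, whose bits are already stored
    -- in `i` and `k`; the rest of the Morton index still owes them a multiple of `2 ^ r`.
    · refine (Tot.forLt (N := L) (T := 45) (I := fun r s' => s'.env .q = a / 4 ^ r ∧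
        s'.env .pw = 2 ^ r ∧ s'.env .i + 2 ^ r * row (L - r) (a / 4 ^ r) = row L a ∧
        s'.env .k + 2 ^ r * col (L - r) (a / 4 ^ r) = col L a ∧ s'.env .i < 2 ^ r ∧
        s'.env .k < 2 ^ r ∧ Same [.q, .h, .i, .k, .pw, .c] s' s ∧ s'.mem = s.mem ∧ s'.used = s.used)
        (by decide) (by simp [hL]) hLw ?_ ?_)
      · simp [ha]
      · rintro r s' hr hc hL' ⟨h1, h2, h3, h4, h5, h6, h7, h8, h9⟩
        have hq : a / 4 ^ r ≤ a := Nat.div_le_self _ _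
        have hr1 : 2 ^ (r + 1) ≤ 2 ^ L := Nat.pow_le_pow_right (by norm_num) hr
        rw [pow_succ] at hr1 hw
        have hdiv : a / 4 ^ (r + 1) = a / 4 ^ r / 4 := by rw [pow_succ, Nat.div_div_eq_div_mul]
        obtain ⟨M, hM⟩ : ∃ M, L - r = M + 1 := ⟨L - r - 1, by omega⟩
        have hM' : L - (r + 1) = M := by omega
        rw [hM, row] at h3
        rw [hM, col] at h4
        generalize a / 4 ^ r = q at *
        unfold splitStep
        apply Tot.le
        · apply Tot.block_assign
          · simp [h1]; omega
          · simp [h1]; omega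
          apply Tot.block_assignIf
          · simp [h1]; omega
          · simp
          · simp [h2]; omega
          apply Tot.block_assign
          · simp [h1]; omega
          · simp [h1]; omega
          apply Tot.block_assignIf
          · simp [h1]; omega
          · simp
          · simp [h2]; omega
          apply Tot.block_assign
          · simp [h2]; omega
          · simp [h2]; omega
          refine Tot.block_nil ?_
          simp only [Expr.eval, Store.set_env, Store.set_mem, Store.set_used, h1, h2, hc, hL', hM',
            hdiv, reduceCtorEq, if_true, if_false, true_and, h8, h9, and_true]
          refine ⟨by omega, by ring, ?_, ?_, ?_, ?_, by simpa using h7⟩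
          -- A bit is tested by comparing twice the half with the number itself, as there is no
          -- remainder operation.
          · rw [show q % 4 / 2 = if q / 2 / 2 + q / 2 / 2 < q / 2 then 1 else 0 by
              split_ifs <;> omega] at h3
            rw [pow_succ]
            split_ifs at h3 ⊢ <;> linarith
          · rw [show q % 2 = if q / 2 + q / 2 < q then 1 else 0 by split_ifs <;> omega] at h4
            rw [pow_succ]
            split_ifs at h4 ⊢ <;> linarith
          · rw [pow_succ]
            split_ifs <;> omega
          · rw [pow_succ]
            split_ifs <;> omega
        · simp
    · rintro s' ⟨-, -, h1, h2, h3, h4, h5, h6, h7, h8, h9⟩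
      refine Tot.block_nil ⟨by simpa [row] using h3, by simpa [col] using h4, h7, h8, h9⟩
  · simp; omega

/-- One digit of `readNumber`. -/
def readStep : Prog := .block [
  .assign .v (.add (.var .v) (.var .v)),
  .assign .vn (.add (.var .vn) (.var .vn)),
  .assign .t (.load (.var .adr)),
  .assignIf (.lit 0) (.var .t) .v (.add (.var .v) (.lit 1)),
  .assignIf (.lit 0) (.var .t) .vn (.add (.var .vn) (.var .n)),
  .assign .adr (.add (.var .adr) (.var .d2))]

/-- Read into `v` the number of `wd` binary digits that starts in cell `adr` and continues in steps
of `d2`; also compute `vn = v * n`. -/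
def readNumber : Prog := .block [
  .assign .v (.lit 0), .assign .vn (.lit 0), .forLt .c .wd readStep]

/-- `vn` is built up by doubling and adding like `v`: memory addresses need the product `v * n`, but
a bit machine multiplies bits only. -/
theorem readNumber_spec {s : Store} {n D k A : ℕ} (hn : s.env .n = n) (hD : s.env .d2 = D)
    (hk : s.env .wd = k) (hA : s.env .adr = A) (hbit : ∀ r < k, s.mem (A + r * D) < 2) (hn0 : 0 < n)
    (hkw : k < 2 ^ w) (hvw : 2 ^ k * n < 2 ^ w) (hAw : A + k * D < 2 ^ w) (hw : 1 < 2 ^ w) :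
    Tot w c ω readNumber s (50 * (k + 1)) fun s' =>
      s'.env .v = ofBits (fun r => s.mem (A + r * D)) k ∧
      s'.env .vn = ofBits (fun r => s.mem (A + r * D)) k * n ∧
      Same [.v, .vn, .t, .adr, .c] s' s ∧ s'.mem = s.mem ∧ s'.used = s.used := by
  unfold readNumber
  apply Tot.le
  · apply Tot.block_assign
    · simp
    · simp
    apply Tot.block_assign
    · simp
    · simp
    apply Tot.block_cons
    · refine (Tot.forLt (N := k) (T := 45) (I := fun r s' => s'.env .adr = A + r * D ∧
        s'.env .v = ofBits (fun r => s.mem (A + r * D)) r ∧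
        s'.env .vn = ofBits (fun r => s.mem (A + r * D)) r * n ∧
        Same [.v, .vn, .t, .adr, .c] s' s ∧ s'.mem = s.mem ∧ s'.used = s.used)
        (by decide) (by simp [hk]) hkw ?_ ?_)
      · simp [hA, ofBits]
      · rintro r s' hr hc hk' ⟨h1, h2, h3, h4, h5, h6⟩
        have hn' : s'.env .n = n := by rw [h4 _ (by decide), hn]
        have hD' : s'.env .d2 = D := by rw [h4 _ (by decide), hD]
        have hb := hbit r hr
        have hlt : ofBits (fun r => s.mem (A + r * D)) (r + 1) < 2 ^ (r + 1) :=
          ofBits_lt fun r' hr' => hbit r' (by omega)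
        have hr1 : 2 ^ (r + 1) ≤ 2 ^ k := Nat.pow_le_pow_right (by norm_num) hr
        rw [ofBits] at hlt
        have hle : r * D + D ≤ k * D := by
          have := Nat.mul_le_mul_right D hr
          rwa [Nat.succ_mul] at this
        have hs : ofBits (fun r => s.mem (A + r * D)) (r + 1) =
          2 * ofBits (fun r => s.mem (A + r * D)) r + s.mem (A + r * D) := rfl
        generalize ofBits (fun r => s.mem (A + r * D)) r = u at *
        generalize ofBits (fun r => s.mem (A + r * D)) (r + 1) = u' at *
        generalize hbv : s.mem (A + r * D) = b at *
        have hun : (2 * u + b) * n ≤ 2 ^ k * n := Nat.mul_le_mul_right _ (by omega)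
        have hbn : b * n = if 0 < b then n else 0 := by
          split_ifs with h
          · rw [show b = 1 by omega, one_mul]
          · rw [show b = 0 by omega, zero_mul]
        have hu : 2 * u + b ≤ (2 * u + b) * n := Nat.le_mul_of_pos_right _ hn0
        have he : (2 * u + b) * n = u * n + u * n + b * n := by ring
        have hb1 : b = if 0 < b then 1 else 0 := by split_ifs <;> omega
        unfold readStep
        apply Tot.le
        · apply Tot.block_assign
          · simp [h2]; omega
          · simp [h2]; omega
          apply Tot.block_assign
          · simp [h3]; omega
          · simp [h3]; omega
          apply Tot.block_assign
          · simp [h1, h5, hbv]; omega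
          · simp [h1, h5, hbv]; omega
          apply Tot.block_assignIf
          · simp
          · simp
          · simp [h1, h2, h5, hbv, hw]; omega
          apply Tot.block_assignIf
          · simp
          · simp
          · simp only [Expr.eval, Expr.ok, Store.set_env, Store.set_mem, h1, h3, h5, hbv, hn',
              reduceCtorEq, if_true, if_false, true_and, and_self]
            intro h
            rw [if_pos h] at hbn
            omega
          apply Tot.block_assign
          · simp [h1, hD']; omega
          · simp [h1, hD']; omega
          refine Tot.block_nil ?_
          simp only [Expr.eval, Store.set_env, Store.set_mem, Store.set_used, h1, h2, h3, hc, hk',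
            h5, hbv, hn', hD', reduceCtorEq, if_true, if_false, true_and, h6, and_true, hs]
          refine ⟨by ring, ?_, ?_, by simpa using h4⟩
          · split_ifs at hb1 ⊢ <;> omega
          · rw [he, hbn]
            split_ifs <;> omega
        · simp
    · rintro s' ⟨-, -, h1, h2, h3, h4, h5, h6⟩
      exact Tot.block_nil ⟨h2, h3, h4, h5, h6⟩
  · simp; omega

/-- Decode the Morton index `a` and look up the images of its row and of its column under the random
maps with base addresses `b₁`, `b₂` and widths `w₁`, `w₂`. -/
def lookup (b₁ w₁ b₂ w₂ : Var) : Prog := .block [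
  split,
  .assign .adr (.add (.var b₁) (.var .i)), .assign .wd (.var w₁), readNumber,
  .assign .x (.var .v), .assign .xn (.var .vn),
  .assign .adr (.add (.var b₂) (.var .k)), .assign .wd (.var w₂), readNumber,
  .assign .y (.var .v)]

/-- The variables that `lookup` changes. -/
def lookupVars : List Var :=
  [.q, .h, .i, .k, .pw, .c, .adr, .wd, .v, .vn, .t, .x, .xn, .y]

/-- The number in column `i` of the table of bits at address `B`. -/
def tableEntry (μ : ℕ → ℕ) (D B k i : ℕ) : ℕ := ofBits (fun r => μ (B + i + r * D)) k

theorem lookup_spec {s : Store} {b₁ w₁ b₂ w₂ : Var} {n L D a B₁ B₂ k₁ k₂ : ℕ}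
    (hv : b₁ ∉ lookupVars ∧ w₁ ∉ lookupVars ∧ b₂ ∉ lookupVars ∧ w₂ ∉ lookupVars)
    (hn : s.env .n = n) (hL : s.env .L = L) (hD : s.env .d2 = D) (hDL : D = 2 ^ L)
    (ha : s.env .a = a)
    (hB₁ : s.env b₁ = B₁) (hB₂ : s.env b₂ = B₂) (hk₁ : s.env w₁ = k₁) (hk₂ : s.env w₂ = k₂)
    (hbit₁ : ∀ x < k₁ * D, s.mem (B₁ + x) < 2) (hbit₂ : ∀ x < k₂ * D, s.mem (B₂ + x) < 2)
    (hn0 : 0 < n) (haw : a < 2 ^ w) (hw : 2 ^ (L + 1) < 2 ^ w)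
    (hk₁w : k₁ < 2 ^ w) (hk₂w : k₂ < 2 ^ w)
    (hv₁ : 2 ^ k₁ * n < 2 ^ w) (hv₂ : 2 ^ k₂ * n < 2 ^ w)
    (hA₁ : B₁ + D + k₁ * D < 2 ^ w) (hA₂ : B₂ + D + k₂ * D < 2 ^ w) :
    Tot w c ω (lookup b₁ w₁ b₂ w₂) s (100 * (L + k₁ + k₂ + 2)) fun s' =>
      s'.env .x = tableEntry s.mem D B₁ k₁ (row L a) ∧
      s'.env .xn = tableEntry s.mem D B₁ k₁ (row L a) * n ∧
      s'.env .y = tableEntry s.mem D B₂ k₂ (col L a) ∧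
      Same lookupVars s' s ∧ s'.mem = s.mem ∧ s'.used = s.used := by
  obtain ⟨hb₁, hw₁, hb₂, hw₂⟩ := hv
  have h1w : 1 < 2 ^ w := lt_of_le_of_lt Nat.one_le_two_pow hw
  have hrow : row L a < D := hDL ▸ row_lt L a
  have hcol : col L a < D := hDL ▸ col_lt L a
  have hbits {B k i : ℕ} (hi : i < D) (h : ∀ x < k * D, s.mem (B + x) < 2) :
      ∀ r < k, s.mem (B + i + r * D) < 2 := fun r hr => by
    rw [show B + i + r * D = B + (r * D + i) by ring]
    exact h _ (mul_add_lt_mul hi hr)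
  have hval {B k i : ℕ} (hi : i < D) (h : ∀ x < k * D, s.mem (B + x) < 2) (hk : 2 ^ k * n < 2 ^ w) :
      tableEntry s.mem D B k i < 2 ^ w ∧ tableEntry s.mem D B k i * n < 2 ^ w := by
    have h1 : tableEntry s.mem D B k i < 2 ^ k := ofBits_lt (hbits hi h)
    have h2 := Nat.mul_lt_mul_of_pos_right h1 hn0
    have h3 := Nat.le_mul_of_pos_right (tableEntry s.mem D B k i) hn0
    omega
  have hl1 : ∀ u ∈ [Var.q, .h, .i, .k, .pw, .c], u ∈ lookupVars := by decide
  have hl2 : ∀ u ∈ [Var.v, .vn, .t, .adr, .c], u ∈ lookupVars := by decide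
  have hne {u : Var} (h : u ∉ lookupVars) : u ≠ .adr := by rintro rfl; exact h (by decide)
  have hnx {u : Var} (h : u ∉ lookupVars) : u ≠ .x ∧ u ≠ .xn := by
    constructor <;> (rintro rfl; exact h (by decide))
  unfold lookup
  apply Tot.le
  · apply Tot.block_cons (split_spec hL ha haw hw)
    rintro s₁ ⟨h1, h2, h3, h4, h5⟩
    have h3 := h3.weaken hl1
    have e1 := h3 _ hb₁
    have e2 := h3 _ hw₁
    apply Tot.block_assign
    · simp [e1, hB₁, h1]; omega
    · simp [e1, hB₁, h1]; omega
    apply Tot.block_assign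
    · simp
    · simp [hne hw₁, e2, hk₁, hk₁w]
    apply Tot.block_cons
    · exact readNumber_spec (n := n) (D := D) (k := k₁) (A := B₁ + row L a)
        (by simp [h3 .n (by decide), hn]) (by simp [h3 .d2 (by decide), hD])
        (by simp [hne hw₁, e2, hk₁]) (by simp [e1, hB₁, h1])
        (by simpa [h4] using hbits hrow hbit₁) hn0 hk₁w hv₁ (by omega) h1w
    simp only [Store.set_mem, Store.set_used, h4, h5]
    rintro s₂ ⟨g1, g2, g3, g4, g5⟩
    have hk'' := g3
    have g3 : Same lookupVars s₂ s := by
      refine (g3.weaken hl2).trans ?_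
      rw [same_set (by decide), same_set (by decide)]
      exact h3
    have hk' : s₂.env .k = col L a := by rw [hk'' .k (by decide)]; simp [h2]
    apply Tot.block_assign
    · simp
    · simp [g1]; exact (hval hrow hbit₁ hv₁).1
    apply Tot.block_assign
    · simp
    · simp [g2]; exact (hval hrow hbit₁ hv₁).2
    apply Tot.block_assign
    · simp [g3 _ hb₂, hB₂, hk', hnx hb₂]; omega
    · simp [g3 _ hb₂, hB₂, hk', hnx hb₂]; omega
    apply Tot.block_assign
    · simp
    · simp [hne hw₂, hnx hw₂, g3 _ hw₂, hk₂, hk₂w]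
    apply Tot.block_cons
    · exact readNumber_spec (n := n) (D := D) (k := k₂) (A := B₂ + col L a)
        (by simp [g3 .n (by decide), hn]) (by simp [g3 .d2 (by decide), hD])
        (by simp [hne hw₂, hnx hw₂, g3 _ hw₂, hk₂]) (by simp [hnx hb₂, g3 _ hb₂, hB₂, hk'])
        (by simpa [g4] using hbits hcol hbit₂) hn0 hk₂w hv₂ (by omega) h1w
    simp only [Store.set_mem, Store.set_used, g4, g5]
    rintro s₃ ⟨f1, f2, f3, f4, f5⟩
    have fx : s₃.env .x = tableEntry s.mem D B₁ k₁ (row L a) := by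
      rw [f3 .x (by decide)]; simp [g1, tableEntry]
    have fxn : s₃.env .xn = tableEntry s.mem D B₁ k₁ (row L a) * n := by
      rw [f3 .xn (by decide)]; simp [g2, tableEntry]
    apply Tot.block_assign
    · simp
    · simp [f1]; exact (hval hcol hbit₂ hv₂).1
    refine Tot.block_nil ?_
    simp only [Expr.eval, Store.set_env, Store.set_mem, Store.set_used, reduceCtorEq, if_true,
      if_false, fx, fxn, f1, f4, f5, true_and, and_true]
    refine ⟨rfl, ?_⟩
    rw [same_set (by decide)]
    refine (f3.weaken hl2).trans ?_
    rw [same_set (by decide), same_set (by decide), same_set (by decide), same_set (by decide)]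
    exact g3
  · simp; omega

/-! ### Applying Kronecker powers -/

/-- Add `k ∈ {0, 1, -1}` times the content of cell `adr` to `acc`, modulo `md`. -/
def termCode (k : ℤ) : Prog := .block [
  if k = 1 then .assign .acc (.add (.var .acc) (.load (.var .adr)))
  else if k = -1 then
    .assign .acc (.add (.var .acc) (.sub (.var .md) (.load (.var .adr))))
  else .assign .acc (.var .acc),
  .assignIf (.var .md) (.add (.var .acc) (.lit 1)) .acc (.sub (.var .acc) (.var .md)),
  .assign .adr (.add (.var .adr) (.var .M))]

/-- The test `md < a + 1` stands for `md ≤ a`, since branches compare strictly. -/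
theorem reduce_cast {md a : ℕ} :
    ((if md < a + 1 then a - md else a : ℕ) : ZMod md) = a := by
  split_ifs with h
  · rw [Nat.cast_sub (by omega)]; simp
  · rfl

theorem termCode_spec {k : ℤ} (hk : k = 0 ∨ k = 1 ∨ k = -1) {s : Store} {md M A : ℕ}
    (hmd : s.env .md = md) (hM : s.env .M = M) (hA : s.env .adr = A) (hacc : s.env .acc < md)
    (hmem : s.mem A < md) (hmdw : 2 * md < 2 ^ w) (hAw : A + M < 2 ^ w) :
    Tot w c ω (termCode k) s 30 fun s' =>
      s'.env .acc < md ∧ (s'.env .acc : ZMod md) = s.env .acc + k * s.mem A ∧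
      s'.env .adr = A + M ∧ Same [.acc, .adr] s' s ∧ s'.mem = s.mem ∧ s'.used = s.used := by
  -- For each coefficient the new sum is below `2 * md`, so one conditional subtraction reduces it.
  -- The coefficient `-1` is realized by adding `md - s.mem A`, which keeps everything nonnegative.
  have key : ∃ a, a < 2 * md ∧ (a : ZMod md) = s.env .acc + k * s.mem A ∧
      ∀ {l U Q}, Tot w c ω (.block l) (s.set .acc a) U Q → Tot w c ω (.block
        ((if k = 1 then .assign .acc (.add (.var .acc) (.load (.var .adr)))
  else if k = -1 then
    .assign .acc (.add (.var .acc) (.sub (.var .md) (.load (.var .adr))))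
  else .assign .acc (.var .acc)) :: l)) s (9 + U) Q := by
    rcases hk with rfl | rfl | rfl
    · refine ⟨s.env .acc, by omega, by simp, fun {l U Q} h => ?_⟩
      simp only [zero_ne_one, if_false, show ¬ (0 : ℤ) = -1 by norm_num]
      refine (Tot.block_assign (by simp) (by simp; omega) h).le (by simp)
    · refine ⟨s.env .acc + s.mem A, by omega, by simp, fun {l U Q} h => ?_⟩
      simp only [if_true]
      refine (Tot.block_assign (by simp [hA]; omega) (by simp [hA]; omega)
        (by simpa [hA] using h)).le (by simp)
    · refine ⟨s.env .acc + (md - s.mem A), by omega, ?_, fun {l U Q} h => ?_⟩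
      · rw [Nat.cast_add, Nat.cast_sub hmem.le]
        simp
      · simp only [if_true, show ¬ (-1 : ℤ) = 1 by norm_num, if_false]
        refine (Tot.block_assign (by simp [hA, hmd]; omega) (by simp [hA, hmd]; omega)
          (by simpa [hA, hmd] using h)).le (by simp)
  obtain ⟨a, ha, ha', hT⟩ := key
  have h1w : 1 < 2 ^ w := by omega
  unfold termCode
  apply Tot.le
  · apply hT
    apply Tot.block_assignIf
    · simp
    · simp [h1w]; omega
    · simp [hmd]; omega
    apply Tot.block_assign
    · simp [hA, hM]; omega
    · simp [hA, hM]; omega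
    refine Tot.block_nil ?_
    simp only [Expr.eval, Store.set_env, Store.set_mem, Store.set_used, hmd, hA, hM,
      reduceCtorEq, if_true, if_false, true_and, and_true]
    refine ⟨by split_ifs <;> omega, by rw [reduce_cast, ha'], by simp⟩
  · simp

theorem terms_spec (l : List ℤ) (hl : ∀ k ∈ l, k = 0 ∨ k = 1 ∨ k = -1) {s : Store} {md M A : ℕ}
    (hmd : s.env .md = md) (hM : s.env .M = M) (hA : s.env .adr = A) (hacc : s.env .acc < md)
    (hmem : ∀ d < l.length, s.mem (A + d * M) < md) (hmdw : 2 * md < 2 ^ w)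
    (hAw : A + l.length * M < 2 ^ w) :
    Tot w c ω (.block (l.map termCode)) s (30 * l.length) fun s' =>
      s'.env .acc < md ∧ (s'.env .acc : ZMod md) = s.env .acc +
        ∑ d ∈ Finset.range l.length, (l.getD d 0 : ZMod md) * s.mem (A + d * M) ∧
      Same [.acc, .adr] s' s ∧ s'.mem = s.mem ∧ s'.used = s.used := by
  induction l generalizing s A with
  | nil => exact Tot.nop (by simpa using hacc)
  | cons k l ih =>
    simp only [List.length_cons, Nat.succ_mul] at hmem hAw
    rw [List.map_cons]
    refine (Tot.block_cons (termCode_spec (hl k (by simp)) hmd hM hA hacc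
      (by simpa using hmem 0 (by omega)) hmdw (by omega)) fun s' h => ?_).le
        (T := 30 + 30 * l.length) (by simp only [List.length_cons]; omega)
    obtain ⟨h1, h2, h3, h4, h5, h6⟩ := h
    refine (ih (fun k hk => hl k (by simp [hk])) (by rw [h4 _ (by decide), hmd])
      (by rw [h4 _ (by decide), hM]) h3 h1 (fun d hd => ?_) (by omega)).mono le_rfl ?_
    · rw [h5, show A + M + d * M = A + (d + 1) * M by ring]
      exact hmem _ (by omega)
    · rintro s'' ⟨g1, g2, g3, g4, g5⟩
      refine ⟨g1, ?_, g3.trans h4, g4.trans h5, g5.trans h6⟩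
      rw [g2, h2, List.length_cons, Finset.sum_range_succ', h5, add_assoc,
        add_comm (∑ k ∈ _, _ : ZMod md)]
      simp only [List.getD_cons_succ, List.getD_cons_zero, zero_mul, add_zero]
      congr 2
      refine Finset.sum_congr rfl fun d _ => ?_
      rw [show A + M + d * M = A + (d + 1) * M by ring]

/-- Compute one output entry. -/
def rowCode (l : List ℤ) : Prog := .block [
  .assign .adr (.add (.var .src) (.var .rho)), .assign .acc (.lit 0), .block (l.map termCode),
  .put (.var .dst) (.var .acc), .assign .dst (.add (.var .dst) (.lit 1))]

theorem rowCode_spec (l : List ℤ) (hl : ∀ k ∈ l, k = 0 ∨ k = 1 ∨ k = -1) (hl6 : l.length ≤ 6)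
    {s : Store} {md M A D : ℕ}
    (hmd : s.env .md = md) (hM : s.env .M = M) (hA : s.env .src + s.env .rho = A)
    (hD : s.env .dst = D)
    (hmem : ∀ d < l.length, s.mem (A + d * M) < md) (hmdw : 2 * md < 2 ^ w) (hmdc : md ≤ 2 ^ c)
    (hmd0 : 0 < md) (hAw : A + l.length * M < 2 ^ w) (hDw : D + 1 < 2 ^ w) :
    Tot w c ω (rowCode l) s 200 fun s' =>
      (∃ v < md, (v : ZMod md) =
        ∑ d ∈ Finset.range l.length, (l.getD d 0 : ZMod md) * s.mem (A + d * M) ∧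
        ∀ a, s'.mem a = if a = D then v else s.mem a) ∧ s'.env .dst = D + 1 ∧
      Same [.acc, .adr, .dst] s' s ∧ s'.used = s.used := by
  have h1w : 1 < 2 ^ w := by omega
  unfold rowCode
  apply Tot.le
  · apply Tot.block_assign
    · simp [hA]; omega
    · simp [hA]; omega
    apply Tot.block_assign
    · simp
    · simp
    apply Tot.block_cons
    · exact terms_spec l hl (md := md) (M := M) (A := A) (by simpa using hmd) (by simpa using hM)
        (by simpa using hA) (by simpa using hmd0) (by simpa using hmem) hmdw hAw
    rintro s' ⟨h1, h2, h3, h4, h5⟩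
    have hD' : s'.env .dst = D := by rw [h3 _ (by decide)]; simpa using hD
    apply Tot.block_put
    · simp
    · simp
    · simp; omega
    apply Tot.block_assign
    · simp [hD', h1w]; omega
    · simp [hD']; omega
    refine Tot.block_nil ?_
    simp only [Expr.eval, Store.set_env, Store.set_mem, Store.set_used, Store.put_env,
      Store.put_mem, Store.put_used, hD', h4, h5, reduceCtorEq, if_true, if_false, true_and,
      and_true, Nat.cast_zero, zero_add] at h2 ⊢
    refine ⟨⟨_, h1, h2, fun a => rfl⟩, ?_⟩
    rw [same_set (by decide), same_put]
    have := h3.weaken (l' := [.acc, .adr, .dst]) (by decide)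
    refine this.trans ?_
    simp
  · simp; omega

/-- All inputs lie below the output address `D` (`hAD`), hence no row overwrites what a later row
reads. -/
theorem rows_spec (S : List (List ℤ)) {p : ℕ} (hp : p ≤ 6)
    (hS : ∀ l ∈ S, l.length = p ∧ ∀ k ∈ l, k = 0 ∨ k = 1 ∨ k = -1)
    {s : Store} {md M A D : ℕ}
    (hmd : s.env .md = md) (hM : s.env .M = M) (hA : s.env .src + s.env .rho = A)
    (hD : s.env .dst = D)
    (hmem : ∀ d < p, s.mem (A + d * M) < md) (hAD : ∀ d < p, A + d * M < D)
    (hmdw : 2 * md < 2 ^ w) (hmdc : md ≤ 2 ^ c)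
    (hmd0 : 0 < md) (hAw : A + p * M < 2 ^ w) (hDw : D + S.length < 2 ^ w) :
    Tot w c ω (.block (S.map rowCode)) s (200 * S.length) fun s' =>
      (∀ e < S.length, s'.mem (D + e) < md ∧ (s'.mem (D + e) : ZMod md) =
        ∑ d ∈ Finset.range p, coeff (ZMod md) S e d * s.mem (A + d * M)) ∧
      (∀ a < D, s'.mem a = s.mem a) ∧ s'.env .dst = D + S.length ∧
      Same [.acc, .adr, .dst] s' s ∧ s'.used = s.used := by
  induction S generalizing s D with
  | nil => exact Tot.nop (by simpa using hD)
  | cons l S ih =>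
    simp only [List.length_cons] at hDw
    obtain ⟨hlp, hlk⟩ := hS l (by simp)
    rw [List.map_cons]
    refine (Tot.block_cons (rowCode_spec l hlk (by omega) hmd hM hA hD
      (by rwa [hlp]) hmdw hmdc hmd0 (by rwa [hlp]) (by omega)) fun s' h => ?_).le
        (T := 200 + 200 * S.length) (by simp only [List.length_cons]; omega)
    obtain ⟨⟨v, hv, hv', h1⟩, h2, h3, h4⟩ := h
    have hin : ∀ d < p, s'.mem (A + d * M) = s.mem (A + d * M) := fun d hd => by
      rw [h1, if_neg (hAD d hd).ne]
    refine (ih (fun l hl => hS l (by simp [hl])) (by rw [h3 _ (by decide), hmd])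
      (by rw [h3 _ (by decide), hM]) (by rw [h3 _ (by decide), h3 _ (by decide), hA]) h2
      (fun d hd => by rw [hin d hd]; exact hmem d hd)
      (fun d hd => (hAD d hd).trans (Nat.lt_succ_self D)) (by omega)).mono le_rfl ?_
    rintro s'' ⟨g1, g2, g3, g4, g5⟩
    refine ⟨?_, fun a ha => by rw [g2 a (by omega), h1, if_neg ha.ne], by
      rw [g3, List.length_cons]; omega, g4.trans h3, g5.trans h4⟩
    rintro (_ | e) he
    · rw [add_zero, g2 _ (by omega), h1, if_pos rfl]
      refine ⟨hv, hv'.trans ?_⟩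
      rw [hlp]
      simp [coeff, entry]
    · rw [show D + (e + 1) = D + 1 + e by ring]
      refine ⟨(g1 e (by simpa using he)).1, (g1 e (by simpa using he)).2.trans ?_⟩
      refine Finset.sum_congr rfl fun d hd => ?_
      rw [hin d (Finset.mem_range.1 hd)]
      simp [coeff, entry]

/-- Apply the matrix `S`, which has `p` columns, to one digit of the vector of length `sz` at
address `src`; the result is written behind that vector. -/
def levelCode (S : List (List ℤ)) (p : ℕ) : Prog := .block [
  .assign .M (.lit 0), .assign .c (.lit 0),
  .whileLt .c .sz (.block [
    .assign .c (.add (.var .c) (.lit p)), .assign .M (.add (.var .M) (.lit 1))]),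
  .assign .dst (.add (.var .src) (.var .sz)),
  .forLt .rho .M (.block (S.map rowCode)),
  .assign .src (.add (.var .src) (.var .sz)),
  .assign .sz (.sub (.var .dst) (.var .src))]

def levelVars : List Var := [.M, .c, .dst, .rho, .acc, .adr, .src, .sz]

theorem levelCode_spec (S : List (List ℤ)) {p q : ℕ} (hp : p ≤ 6) (hp0 : 0 < p) (hq0 : 0 < q)
    (hq : q ≤ 6) (hSq : S.length = q)
    (hS : ∀ l ∈ S, l.length = p ∧ ∀ k ∈ l, k = 0 ∨ k = 1 ∨ k = -1)
    {s : Store} {md M A : ℕ}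
    (hmd : s.env .md = md) (hA : s.env .src = A) (hsz : s.env .sz = p * M)
    (hmem : ∀ x < p * M, s.mem (A + x) < md)
    (hmdw : 2 * md < 2 ^ w) (hmdc : md ≤ 2 ^ c)
    (hmd0 : 0 < md) (hAw : A + p * M + q * M < 2 ^ w) (hw : 6 < 2 ^ w) :
    Tot w c ω (levelCode S p) s (1300 * (M + 1)) fun s' =>
      (∀ x < q * M, s'.mem (A + p * M + x) < md ∧ (s'.mem (A + p * M + x) : ZMod md) =
        ∑ d ∈ Finset.range p, coeff (ZMod md) S (x % q) d * s.mem (A + (x / q + d * M))) ∧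
      (∀ a < A + p * M, s'.mem a = s.mem a) ∧ s'.env .src = A + p * M ∧ s'.env .sz = q * M ∧
      Same levelVars s' s ∧ s'.used = s.used := by
  have hpM : M ≤ p * M := Nat.le_mul_of_pos_left _ hp0
  have h1w : 1 < 2 ^ w := by omega
  unfold levelCode
  apply Tot.le
  · apply Tot.block_assign
    · simp
    · simp
    apply Tot.block_assign
    · simp
    · simp
    apply Tot.block_cons
    -- Division by counting: `M` is the number of times that `p` fits into `sz = p * M`.
    · refine Tot.whileLt (N := M) (T := 10) (I := fun r s' => s'.env .M = r ∧ s'.env .c = p * r ∧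
        Same levelVars s' s ∧ s'.env .src = A ∧ s'.env .sz = p * M ∧ s'.mem = s.mem ∧
        s'.used = s.used) ?_ ?_ ?_
      · simp [hA, hsz, levelVars]
      · rintro r s' hr ⟨h1, h2, h3, h4, h5, h6, h7⟩
        have hr' : p * r + p ≤ p * M := by
          have := Nat.mul_le_mul_left p hr
          rwa [Nat.mul_succ] at this
        refine ⟨by omega, ?_⟩
        apply Tot.le
        · apply Tot.block_assign
          · simp [h2]; omega
          · simp [h2]; omega
          apply Tot.block_assign
          · simp [h1, h1w]; omega
          · simp [h1]; omega
          refine Tot.block_nil ?_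
          simp only [Expr.eval, Store.set_env, Store.set_mem, Store.set_used, h1, h2, h4, h5, h6,
            h7, reduceCtorEq, if_true, if_false, true_and, and_true]
          exact ⟨by ring, by simpa [levelVars] using h3⟩
        · simp
      · rintro s' ⟨h1, h2, h3, h4, h5, h6, h7⟩
        omega
    rintro s₁ ⟨h1, h2, h3, h4, h5, h6, h7⟩
    apply Tot.block_assign
    · simp [h4, h5]; omega
    · simp [h4, h5]; omega
    apply Tot.block_cons
    · refine (Tot.forLt (N := M) (T := 1200) (I := fun r s' =>
        (∀ x < q * r, s'.mem (A + p * M + x) < md ∧ (s'.mem (A + p * M + x) : ZMod md) =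
          ∑ d ∈ Finset.range p, coeff (ZMod md) S (x % q) d * s.mem (A + (x / q + d * M))) ∧
        (∀ a < A + p * M, s'.mem a = s.mem a) ∧ s'.env .dst = A + p * M + q * r ∧
        s'.env .src = A ∧ s'.env .sz = p * M ∧ Same levelVars s' s ∧ s'.used = s.used)
        (by decide) (by simp [h1]) (by omega) ?_ ?_)
      · simp [h4, h5, h6, h7, levelVars]
        exact h3
      · rintro r s' hr hc hM' ⟨g1, g2, g3, g4, g5, g6, g7⟩
        have hr' : q * r + q ≤ q * M := by
          have := Nat.mul_le_mul_left q hr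
          rwa [Nat.mul_succ] at this
        have hd {d : ℕ} (h : d < p) : r + d * M < p * M := by
          have := mul_add_lt_mul hr h
          omega
        refine (rows_spec S hp hS (md := md) (M := M) (A := A + r) (D := A + p * M + q * r)
          (by rw [g6 _ (by decide), hmd]) hM' (by rw [g4, hc]) g3 ?_ ?_ hmdw hmdc hmd0 ?_ ?_).mono
          (by omega) ?_
        · intro d h
          rw [add_assoc, g2 _ (by have := hd h; omega)]
          exact hmem _ (hd h)
        · intro d h
          have := hd h
          omega
        · have : M ≤ q * M := Nat.le_mul_of_pos_left _ hq0
          omega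
        · omega
        · rintro s'' ⟨f1, f2, f3, f4, f5⟩
          have f4' := f4.weaken (l' := levelVars) (by decide)
          refine ⟨by rw [f4 _ (by decide), hc], by rw [f4 _ (by decide), hM'], ?_, ?_, ?_, ?_, ?_,
            ?_, by simp [f5, g7]⟩
          · intro x hx
            simp only [Store.set_mem]
            rw [Nat.mul_succ] at hx
            rcases lt_or_ge x (q * r) with h | h
            · rw [f2 _ (by omega)]
              exact g1 x h
            · obtain ⟨e, rfl⟩ := Nat.exists_eq_add_of_le h
              have he : e < q := by omega
              rw [← add_assoc, Nat.mul_add_mod, Nat.mod_eq_of_lt he, Nat.mul_add_div hq0,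
                Nat.div_eq_of_lt he, add_zero]
              refine ⟨(f1 e (by omega)).1, (f1 e (by omega)).2.trans ?_⟩
              refine Finset.sum_congr rfl fun d h => ?_
              have := hd (Finset.mem_range.1 h)
              rw [add_assoc, g2 _ (by omega)]
          · intro a ha
            simp only [Store.set_mem]
            rw [f2 _ (by omega), g2 _ ha]
          · simp [f3, hSq]; ring
          · simp [f4 .src (by decide), g4]
          · simp [f4 .sz (by decide), g5]
          · rw [same_set (by decide)]
            exact f4'.trans g6
    rintro s₂ ⟨-, -, g1, g2, g3, g4, g5, g6, g7⟩
    apply Tot.block_assign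
    · simp [g4, g5]; omega
    · simp [g4, g5]; omega
    apply Tot.block_assign
    · simp [g3, g4, g5]; omega
    · simp [g3, g4, g5]; omega
    refine Tot.block_nil ?_
    simp only [Expr.eval, Store.set_env, Store.set_mem, Store.set_used, g3, g4, g5, g7,
      reduceCtorEq, if_true, if_false, true_and, and_true, Nat.add_sub_cancel_left]
    exact ⟨g1, g2, by simpa [levelVars] using g6⟩
  · simp; omega

/-- Apply the `L`-th Kronecker power of `S`, which has `p` columns, to the vector of length `sz` at
address `src`. -/
def transform (S : List (List ℤ)) (p : ℕ) : Prog := .forLt .l .L (levelCode S p)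

def transformVars : List Var := .l :: levelVars

/-- Level `l` costs `O(p ^ (L - 1 - l) * q ^ l)`. By `hG` this geometric sum is at most `6 ^ L`, so
the Kronecker power costs no logarithmic factor, neither in time nor in memory. Each level writes
behind its input. -/
theorem transform_spec (S : List (List ℤ)) {p q : ℕ} (hp : p ≤ 6) (hp0 : 0 < p) (hq0 : 0 < q)
    (hq : q ≤ 6) (hSq : S.length = q)
    (hS : ∀ l ∈ S, l.length = p ∧ ∀ k ∈ l, k = 0 ∨ k = 1 ∨ k = -1)
    {s : Store} {md L A : ℕ}
    (hG : ∑ l ∈ Finset.range L, p ^ (L - 1 - l) * q ^ l ≤ 6 ^ L)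
    (hmd : s.env .md = md) (hL : s.env .L = L) (hA : s.env .src = A) (hsz : s.env .sz = p ^ L)
    (hmem : ∀ x < p ^ L, s.mem (A + x) < md)
    (hmdw : 2 * md < 2 ^ w) (hmdc : md ≤ 2 ^ c)
    (hmd0 : 0 < md) (hAw : A + 12 * 6 ^ L < 2 ^ w) :
    Tot w c ω (transform S p) s (3000 * 6 ^ L) fun s' =>
      ∃ A', A ≤ A' ∧ A' + q ^ L ≤ A + 7 * 6 ^ L ∧ s'.env .src = A' ∧ s'.env .sz = q ^ L ∧
      (∀ x < q ^ L, s'.mem (A' + x) < md ∧ (s'.mem (A' + x) : ZMod md) =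
        stage (coeff (ZMod md) S) q p L (fun x => s.mem (A + x)) L x) ∧
      (∀ a < A, s'.mem a = s.mem a) ∧ Same transformVars s' s ∧ s'.used = s.used := by
  have hL6 : L < 6 ^ L := Nat.lt_pow_self (by norm_num)
  set G : ℕ → ℕ := fun r => ∑ l ∈ Finset.range r, p ^ (L - 1 - l) * q ^ l with hGdef
  have hGr {r : ℕ} (hr : r ≤ L) : G r ≤ 6 ^ L :=
    (Finset.sum_le_sum_of_subset (Finset.range_mono hr)).trans hG
  unfold transform
  refine (Tot.forLt_sum (N := L) (T := fun l => 1300 * (p ^ (L - 1 - l) * q ^ l + 1))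
    (I := fun r s' => s'.env .src = A + p * G r ∧ s'.env .sz = p ^ (L - r) * q ^ r ∧
      (∀ x < p ^ (L - r) * q ^ r, s'.mem (A + p * G r + x) < md ∧
        (s'.mem (A + p * G r + x) : ZMod md) =
        stage (coeff (ZMod md) S) q p L (fun x => s.mem (A + x)) r x) ∧
      (∀ a < A, s'.mem a = s.mem a) ∧ Same transformVars s' s ∧ s'.used = s.used)
    (by decide) hL (by omega) ?_ ?_).mono ?_ ?_
  · simp only [Store.set_env, Store.set_mem, Store.set_used, reduceCtorEq, if_false, hA, hsz, hGdef,
      Finset.sum_range_zero, mul_zero, add_zero, pow_zero, mul_one, Nat.sub_zero, true_and,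
      stage, and_true, implies_true]
    exact ⟨hmem, by simp [transformVars]⟩
  · rintro r s' hr hc hL' ⟨h1, h2, h3, h4, h5, h6⟩
    have e1 : L - r = L - 1 - r + 1 := by omega
    have e2 : p ^ (L - r) * q ^ r = p * (p ^ (L - 1 - r) * q ^ r) := by rw [e1]; ring
    have e3 : G (r + 1) = G r + p ^ (L - 1 - r) * q ^ r := Finset.sum_range_succ _ _
    have e4 : p ^ (L - (r + 1)) * q ^ (r + 1) = q * (p ^ (L - 1 - r) * q ^ r) := by
      rw [show L - (r + 1) = L - 1 - r by omega]; ring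
    have hG1 := hGr (show r + 1 ≤ L by omega)
    rw [e2] at h2 h3
    have b1 : A + p * G r + p * (p ^ (L - 1 - r) * q ^ r) = A + p * G (r + 1) := by rw [e3]; ring
    have b2 : p * G (r + 1) ≤ 6 * 6 ^ L := Nat.mul_le_mul hp hG1
    have b3 : q * (p ^ (L - 1 - r) * q ^ r) ≤ 6 * 6 ^ L := Nat.mul_le_mul hq (by omega)
    have hL0 : 1 ≤ L := by omega
    have b4 : 6 ≤ 6 ^ L := by simpa using Nat.pow_le_pow_right (n := 6) (by norm_num) hL0
    refine (levelCode_spec S hp hp0 hq0 hq hSq hS (md := md) (M := p ^ (L - 1 - r) * q ^ r)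
      (A := A + p * G r) (by rw [h5 _ (by decide), hmd]) h1 h2 (fun x hx => (h3 x hx).1) hmdw hmdc
      hmd0 (by omega) (by omega)).mono le_rfl ?_
    rintro s'' ⟨g1, g2, g3, g4, g5, g6⟩
    refine ⟨by rw [g5 _ (by decide), hc], by rw [g5 _ (by decide), hL'], ?_, ?_, ?_, ?_, ?_, ?_⟩
    · simp [g3, b1]
    · simp [g4, e4]
    · rw [e4, ← b1]
      intro x hx
      refine ⟨(g1 x hx).1, (g1 x hx).2.trans ?_⟩
      rw [stage]
      refine Finset.sum_congr rfl fun d hd => ?_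
      rw [(h3 _ _).2]
      have hd := Finset.mem_range.1 hd
      have hx' : x / q < p ^ (L - 1 - r) * q ^ r := by
        rw [Nat.div_lt_iff_lt_mul hq0, mul_comm]; exact hx
      have := mul_add_lt_mul hx' hd
      omega
    · intro a ha
      simp only [Store.set_mem]
      rw [g2 a (by omega), h4 a ha]
    · rw [same_set (by decide)]
      exact (g5.weaken (by decide)).trans h5
    · simp [g6, h6]
  · simp only [Finset.sum_add_distrib, ← Finset.mul_sum, Finset.sum_const, Finset.card_range,
      smul_eq_mul]
    omega
  · rintro s' ⟨-, -, h1, h2, h3, h4, h5, h6⟩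
    simp only [Nat.sub_self, pow_zero, one_mul] at h2 h3
    have b2 : p * G L ≤ 6 * 6 ^ L := Nat.mul_le_mul hp (hGr le_rfl)
    have b3 : q ^ L ≤ 6 ^ L := Nat.pow_le_pow_left hq L
    exact ⟨_, by omega, by omega, h1, h2, h3, h4, h5, h6⟩

/-- The geometric sum `(6 - 4) * ∑ 4 ^ (L - 1 - l) * 6 ^ l = 6 ^ L - 4 ^ L`, without subtraction. -/
theorem sum_four_six (L : ℕ) : 2 * ∑ l ∈ Finset.range L, 4 ^ (L - 1 - l) * 6 ^ l + 4 ^ L = 6 ^ L := by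
  induction L with
  | zero => simp
  | succ L ih =>
    rw [Finset.sum_range_succ, Finset.sum_congr rfl fun l hl => by
      rw [show L + 1 - 1 - l = L - 1 - l + 1 by have := Finset.mem_range.1 hl; omega, pow_succ',
        mul_assoc], ← Finset.mul_sum]
    simp only [Nat.add_sub_cancel, Nat.sub_self, pow_zero, one_mul, pow_succ]
    omega

theorem sum_six_four (L : ℕ) : 2 * ∑ l ∈ Finset.range L, 6 ^ (L - 1 - l) * 4 ^ l + 4 ^ L = 6 ^ L := by
  rw [← sum_four_six L, ← Finset.sum_range_reflect]
  congr 2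
  refine Finset.sum_congr rfl fun l hl => ?_
  have := Finset.mem_range.1 hl
  rw [show L - 1 - (L - 1 - l) = l by omega, mul_comm]

/-! ### Drawing the random maps -/

/-- Set `v` to `b + k * d2`. -/
def advance (v b k : Var) : Prog := .block [
  .assign v (.var b), .forLt .c k (.assign v (.add (.var v) (.var .d2)))]

/-- Repeated addition in place of a multiplication, whose factors would not fit into one-bit cells.
-/
theorem advance_spec {v b k : Var} (hv : v ≠ .c ∧ v ≠ .d2 ∧ v ≠ k ∧ k ≠ .c ∧ b ≠ .c) {s : Store}
    {B K D : ℕ}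
    (hb : s.env b = B) (hk : s.env k = K) (hD : s.env .d2 = D) (hw : B + K * D < 2 ^ w)
    (hKw : K < 2 ^ w) :
    Tot w c ω (advance v b k) s (10 * (K + 1)) fun s' =>
      s'.env v = B + K * D ∧ Same [v, .c] s' s ∧ s'.mem = s.mem ∧ s'.used = s.used := by
  obtain ⟨hvc, hvd, hvk, hkc, hbc⟩ := hv
  unfold advance
  apply Tot.le
  · apply Tot.block_assign
    · simp
    · simp [hb]; omega
    apply Tot.block_cons
    · refine Tot.forLt (N := K) (T := 5) (I := fun r s' => s'.env v = B + r * D ∧ Same [v, .c] s' s ∧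
        s'.mem = s.mem ∧ s'.used = s.used) hkc.symm (by simp [hvk.symm, hk]) hKw ?_ ?_
      · simp [hb, hvc]
      · rintro r s' hr hc hk' ⟨h1, h2, h3, h4⟩
        have hle : r * D + D ≤ K * D := by
          have := Nat.mul_le_mul_right D hr
          rwa [Nat.succ_mul] at this
        have hD' : s'.env .d2 = D := by rw [h2 _ (by simp [hvd.symm]), hD]
        refine (Tot.assign ?_ ?_ ?_).le (show _ ≤ 5 by simp)
        · simp [h1, hD']; omega
        · simp [h1, hD']; omega
        · simp only [Expr.eval, Store.set_env, Store.set_mem, Store.set_used, h1, hc, hk', hvc,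
            hvk.symm, hvc.symm, hD', if_true, if_false, h3, h4, true_and, and_true]
          exact ⟨by ring, by simpa using h2⟩
    · rintro s' ⟨-, -, h1, h2, h3, h4⟩
      exact Tot.block_nil ⟨h1, h2, h3, h4⟩
  · simp; omega

/-- Draw the tables of the random maps. -/
def drawMaps : Prog := .block [
  advance .gb .rb .m, advance .hb .gb .e, advance .ab .hb .m, .assign .p (.var .rb),
  .whileLt .p .ab (.block [
    .toss .t, .put (.var .p) (.var .t), .assign .p (.add (.var .p) (.lit 1))])]

theorem drawMaps_spec {s : Store} {m e L B : ℕ} (hm : s.env .m = m) (he : s.env .e = e)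
    (hD : s.env .d2 = 2 ^ L) (hB : s.env .rb = B) (hw : B + runBits L m e + 1 < 2 ^ w)
    (hc : 1 ≤ c) :
    Tot w c ω drawMaps s (50 * (runBits L m e + m + e + 1)) fun s' =>
      s'.env .gb = B + m * 2 ^ L ∧ s'.env .hb = B + (m + e) * 2 ^ L ∧
      s'.env .ab = B + runBits L m e ∧
      (∀ b < runBits L m e, s'.mem (B + b) = (ω (s.used + b)).toNat) ∧
      (∀ a < B, s'.mem a = s.mem a) ∧ Same [.gb, .hb, .ab, .c, .p, .t] s' s ∧
      s'.used = s.used + runBits L m e := by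
  have h1L : 1 ≤ 2 ^ L := Nat.one_le_two_pow
  have hm1 : m ≤ m * 2 ^ L := Nat.le_mul_of_pos_right _ h1L
  have he1 : e ≤ e * 2 ^ L := Nat.le_mul_of_pos_right _ h1L
  have hR : runBits L m e = m * 2 ^ L + e * 2 ^ L + m * 2 ^ L := by unfold runBits; ring
  have h1w : 1 < 2 ^ w := by omega
  have hw1 : 1 ≤ w := by
    by_contra h
    obtain rfl : w = 0 := by omega
    simp at h1w
  unfold drawMaps
  apply Tot.le
  · apply Tot.block_cons (advance_spec (by decide) hB hm hD (by omega) (by omega))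
    rintro s₁ ⟨h1, h2, h3, h4⟩
    apply Tot.block_cons (advance_spec (by decide) h1 (by rw [h2 _ (by decide), he])
      (by rw [h2 _ (by decide), hD]) (by omega) (by omega))
    rintro s₂ ⟨g1, g2, g3, g4⟩
    apply Tot.block_cons (advance_spec (by decide) g1
      (by rw [g2 _ (by decide), h2 _ (by decide), hm])
      (by rw [g2 _ (by decide), h2 _ (by decide), hD]) (by omega) (by omega))
    rintro s₃ ⟨f1, f2, f3, f4⟩
    have fgb : s₃.env .gb = B + m * 2 ^ L := by rw [f2 _ (by decide), g2 _ (by decide), h1]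
    have fhb : s₃.env .hb = B + (m + e) * 2 ^ L := by rw [f2 _ (by decide), g1]; ring
    have fab : s₃.env .ab = B + runBits L m e := by rw [f1, hR]; ring
    have frb : s₃.env .rb = B := by
      rw [f2 _ (by decide), g2 _ (by decide), h2 _ (by decide), hB]
    have fmem : s₃.mem = s.mem := f3.trans (g3.trans h3)
    have fused : s₃.used = s.used := f4.trans (g4.trans h4)
    have fsame : Same [.gb, .hb, .ab, .c, .p, .t] s₃ s :=
      (f2.weaken (by decide)).trans ((g2.weaken (by decide)).trans (h2.weaken (by decide)))
    apply Tot.block_assign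
    · simp
    · simp [frb]; omega
    apply Tot.block_cons
    · refine Tot.whileLt (N := runBits L m e) (T := 20) (I := fun r s' => s'.env .p = B + r ∧
        s'.env .gb = B + m * 2 ^ L ∧ s'.env .hb = B + (m + e) * 2 ^ L ∧
        s'.env .ab = B + runBits L m e ∧ (∀ b < r, s'.mem (B + b) = (ω (s.used + b)).toNat) ∧
        (∀ a < B, s'.mem a = s.mem a) ∧ Same [.gb, .hb, .ab, .c, .p, .t] s' s ∧
        s'.used = s.used + r) ?_ ?_ ?_
      · simp [frb, fgb, fhb, fab, fmem, fused]
        exact fsame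
      · rintro r s' hr ⟨e1, e2, e3, e4, e5, e6, e7, e8⟩
        refine ⟨by omega, ?_⟩
        have hbit : (ω (s.used + r)).toNat < 2 ^ c :=
          (Bool.toNat_lt _).trans_le (by simpa using Nat.pow_le_pow_right (n := 2) (by simp) hc)
        apply Tot.le
        · apply Tot.block_toss hw1
          apply Tot.block_put
          · simp
          · simp
          · simpa [e8] using hbit
          apply Tot.block_assign
          · simp [e1, h1w]; omega
          · simp [e1]; omega
          refine Tot.block_nil ?_
          simp only [Expr.eval, Store.set_env, Store.set_mem, Store.set_used, Store.put_env,
            Store.put_mem, Store.put_used, Store.tick_env, Store.tick_mem, Store.tick_used, e1, e2,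
            e3, e4, e8, reduceCtorEq, if_true, if_false, true_and, and_true, add_assoc]
          refine ⟨fun b hb => ?_, fun a ha => ?_, by simpa using e7⟩
          · split_ifs with h
            · rw [show b = r by omega]
            · exact e5 b (by omega)
          · rw [if_neg (by omega), e6 a ha]
        · simp
      · rintro s' ⟨e1, -, -, e4, -⟩
        omega
    · rintro s' ⟨-, e2, e3, e4, e5, e6, e7, e8⟩
      exact Tot.block_nil ⟨e2, e3, e4, e5, e6, e7, e8⟩
  · simp; omega

/-! ### Reading the randomly rearranged matrices -/

/-- The entry of an `n × n` matrix padded with zeros; the nonzero entries in row `x` are replaced by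
`x + 1` if `wt` is true. -/
def padded (n : ℕ) (wt : Bool) (γ : ℕ → ℕ → ℕ) (x y : ℕ) : ℕ :=
  if x < n ∧ y < n then (if wt = true ∧ 0 < γ x y then x + 1 else γ x y) else 0

/-- Read the entry in row `x` and column `y` of the matrix at address `b` into `t`. -/
def fetchEntry (wt : Bool) (b : Var) : Prog := .block [
  .assign .t (.lit 0),
  .ite (.var .x) (.var .n) (.ite (.var .y) (.var .n) (.block [
    .assign .t (.load (.add (.var b) (.add (.var .xn) (.var .y)))),
    if wt then .assignIf (.lit 0) (.var .t) .t (.add (.var .x) (.lit 1)) else .nop]) .nop) .nop]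

theorem fetchEntry_spec {wt : Bool} {b : Var} (hbt : b ≠ .t) {s : Store} {n x y B : ℕ}
    {γ : ℕ → ℕ → ℕ}
    (hn : s.env .n = n) (hx : s.env .x = x) (hxn : s.env .xn = x * n) (hy : s.env .y = y)
    (hB : s.env b = B) (hmem : ∀ x < n, ∀ y < n, s.mem (B + (x * n + y)) = γ x y)
    (hγ : ∀ x y, γ x y < 2) (hw : B + n * n < 2 ^ w) (hnw : n < 2 ^ w) (h1w : 1 < 2 ^ w) :
    Tot w c ω (fetchEntry wt b) s 50 fun s' => s'.env .t = padded n wt γ x y ∧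
      Same [.t] s' s ∧ s'.mem = s.mem ∧ s'.used = s.used := by
  unfold fetchEntry
  apply Tot.le
  · apply Tot.block_assign
    · simp
    · simp
    apply Tot.block_cons
    · refine Tot.ite (T := 40) (U := 0) (Q := fun s' => s'.env .t = padded n wt γ x y ∧
        Same [.t] s' s ∧ s'.mem = s.mem ∧ s'.used = s.used) (by simp) (by simp) ?_ ?_
      · simp only [Expr.eval, Store.set_env, reduceCtorEq, if_false, hx, hn]
        intro hxn'
        apply Tot.le
        · refine Tot.ite (T := 25) (U := 0) (by simp) (by simp) ?_ ?_
          · simp only [Expr.eval, Store.set_env, reduceCtorEq, if_false, hy, hn]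
            intro hyn
            have hlt : x * n + y < n * n := mul_add_lt_mul hyn hxn'
            have hval := hmem x hxn' y hyn
            have hγ' := hγ x y
            refine (Tot.block_assign (U := 10) ?_ ?_ ?_).le (show _ ≤ 25 by simp)
            · simp [hbt, hB, hxn, hy, hval]; omega
            · simp [hbt, hB, hxn, hy, hval]; omega
            cases wt
            · simp only [Bool.false_eq_true, if_false]
              apply Tot.le
              · apply Tot.block_cons (Tot.nop rfl)
                rintro s' rfl
                refine Tot.block_nil ?_
                simp [hbt, hB, hxn, hy, hval, padded, hxn', hyn]
              · simp
            · simp only [if_true]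
              apply Tot.le
              · apply Tot.block_assignIf
                · simp
                · simp
                · simp [hx, h1w]; omega
                refine Tot.block_nil ?_
                simp [hbt, hB, hxn, hy, hval, padded, hxn', hyn, hx]
              · simp
          · simp only [Expr.eval, Store.set_env, reduceCtorEq, if_false, hy, hn]
            intro hyn
            refine Tot.nop ?_
            simp [padded, hyn]
        · simp
      · simp only [Expr.eval, Store.set_env, reduceCtorEq, if_false, hx, hn]
        intro hxn'
        refine Tot.nop ?_
        simp [padded, hxn']
    · intro s' h
      exact Tot.block_nil h
  · simp

/-- Write the matrix at address `b`, with rows and columns rearranged by two random maps, into the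
cells from `o` on, in Morton order. -/
def gather (wt : Bool) (b₁ w₁ b₂ w₂ b o : Var) : Prog := .forLt .a .d4 (.block [
  lookup b₁ w₁ b₂ w₂, fetchEntry wt b, .put (.add (.var o) (.var .a)) (.var .t)])

/-- `U` is a common bound for all addresses and values that occur, which gathers the overflow
conditions into `U < 2 ^ w`. -/
theorem gather_spec {wt : Bool} {s : Store} {b₁ w₁ b₂ w₂ b o : Var} {n L B₁ B₂ k₁ k₂ B O U : ℕ}
    {γ : ℕ → ℕ → ℕ}
    (hv : ∀ u ∈ [b₁, w₁, b₂, w₂, b, o], u ∉ Var.a :: lookupVars)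
    (hn : s.env .n = n) (hL : s.env .L = L) (hD : s.env .d2 = 2 ^ L) (hd4 : s.env .d4 = 4 ^ L)
    (hB₁ : s.env b₁ = B₁) (hB₂ : s.env b₂ = B₂) (hk₁ : s.env w₁ = k₁) (hk₂ : s.env w₂ = k₂)
    (hB : s.env b = B) (hO : s.env o = O)
    (hbit₁ : ∀ x < k₁ * 2 ^ L, s.mem (B₁ + x) < 2) (hbit₂ : ∀ x < k₂ * 2 ^ L, s.mem (B₂ + x) < 2)
    (hmem : ∀ x < n, ∀ y < n, s.mem (B + (x * n + y)) = γ x y) (hγ : ∀ x y, γ x y < 2)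
    (hn0 : 0 < n) (hU : U < 2 ^ w) (hp₁ : B₁ + 2 ^ L + k₁ * 2 ^ L ≤ U)
    (hp₂ : B₂ + 2 ^ L + k₂ * 2 ^ L ≤ U) (hO₁ : B₁ + k₁ * 2 ^ L ≤ O) (hO₂ : B₂ + k₂ * 2 ^ L ≤ O)
    (hBO : B + n * n ≤ O) (hOU : O + 4 ^ L ≤ U) (hLU : 2 ^ (L + 1) ≤ U)
    (hv₁ : 2 ^ k₁ * n ≤ U) (hv₂ : 2 ^ k₂ * n ≤ U)
    (hc : ∀ x y, padded n wt γ x y < 2 ^ c) :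
    Tot w c ω (gather wt b₁ w₁ b₂ w₂ b o) s (300 * ((L + k₁ + k₂ + 2) * 4 ^ L)) fun s' =>
      (∀ a < 4 ^ L, s'.mem (O + a) = padded n wt γ (tableEntry s.mem (2 ^ L) B₁ k₁ (row L a))
        (tableEntry s.mem (2 ^ L) B₂ k₂ (col L a))) ∧
      (∀ a < O, s'.mem a = s.mem a) ∧ Same (.a :: lookupVars) s' s ∧ s'.used = s.used := by
  have h1L : 1 ≤ 2 ^ L := Nat.one_le_two_pow
  have h4L : 1 ≤ 4 ^ L := Nat.one_le_pow _ _ (by norm_num)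
  have h2L : 2 ^ (L + 1) = 2 * 2 ^ L := by ring
  have hself : ∀ k, k < 2 ^ k := fun k => Nat.lt_two_pow_self
  have hk₁n : 2 ^ k₁ ≤ 2 ^ k₁ * n := Nat.le_mul_of_pos_right _ hn0
  have hk₂n : 2 ^ k₂ ≤ 2 ^ k₂ * n := Nat.le_mul_of_pos_right _ hn0
  have s1 := hself k₁
  have s2 := hself k₂
  have hnn : n ≤ n * n := Nat.le_mul_of_pos_right _ hn0
  have hb₁ := hv b₁ (by simp)
  have hw₁ := hv w₁ (by simp)
  have hb₂ := hv b₂ (by simp)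
  have hw₂ := hv w₂ (by simp)
  have hb := hv b (by simp)
  have ho := hv o (by simp)
  have hl {u : Var} (h : u ∉ Var.a :: lookupVars) : u ∉ lookupVars := fun h' => h (by simp [h'])
  have hne {u : Var} (h : u ∉ Var.a :: lookupVars) : u ≠ .t ∧ u ≠ .a := by
    constructor <;> (rintro rfl; exact h (by decide))
  -- The output goes to cells from `O` on, above the tables, so that each lookup still sees the
  -- original maps.
  have htab {μ : ℕ → ℕ} (hμ : ∀ a < O, μ a = s.mem a) {B k i : ℕ} (hi : i < 2 ^ L)
      (h : B + k * 2 ^ L ≤ O) : tableEntry μ (2 ^ L) B k i = tableEntry s.mem (2 ^ L) B k i := by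
    refine ofBits_congr fun r hr => hμ _ ?_
    have := mul_add_lt_mul hi hr
    omega
  unfold gather
  apply Tot.mono
  · refine Tot.forLt (N := 4 ^ L) (T := 100 * (L + k₁ + k₂ + 2) + 80) (I := fun r s' =>
      (∀ a < r, s'.mem (O + a) = padded n wt γ (tableEntry s.mem (2 ^ L) B₁ k₁ (row L a))
        (tableEntry s.mem (2 ^ L) B₂ k₂ (col L a))) ∧
      (∀ a < O, s'.mem a = s.mem a) ∧ Same (.a :: lookupVars) s' s ∧ s'.used = s.used)
      (by decide) hd4 (by omega) ?_ ?_
    · simp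
    · rintro r s' hr ha hd4' ⟨h1, h2, h3, h4⟩
      apply Tot.le
      · apply Tot.block_cons
        · refine lookup_spec (n := n) (L := L) (D := 2 ^ L) (a := r) (B₁ := B₁) (B₂ := B₂)
            (k₁ := k₁) (k₂ := k₂) ⟨hl hb₁, hl hw₁, hl hb₂, hl hw₂⟩ (by rw [h3 _ (by decide), hn])
            (by rw [h3 _ (by decide), hL]) (by rw [h3 _ (by decide), hD]) rfl ha
            (by rw [h3 _ hb₁, hB₁]) (by rw [h3 _ hb₂, hB₂]) (by rw [h3 _ hw₁, hk₁])
            (by rw [h3 _ hw₂, hk₂]) (fun x hx => ?_) (fun x hx => ?_) hn0 (by omega) (by omega)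
            (by omega) (by omega) (by omega) (by omega) (by omega) (by omega)
          · rw [h2 _ (by omega)]; exact hbit₁ x hx
          · rw [h2 _ (by omega)]; exact hbit₂ x hx
        rw [htab h2 (row_lt L r) hO₁, htab h2 (col_lt L r) hO₂]
        rintro s₁ ⟨g1, g2, g3, g4, g5, g6⟩
        have g4' : Same (.a :: lookupVars) s₁ s := (g4.weaken (by simp; tauto)).trans h3
        apply Tot.block_cons
        · refine fetchEntry_spec (hne hb).1 (by rw [g4' _ (by decide), hn]) g1 g2 g3
            (B := B) (γ := γ) (by rw [g4' _ hb, hB]) (fun x hx y hy => ?_) hγ (by omega) (by omega)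
            (by omega)
          have := mul_add_lt_mul hy hx
          rw [g5, h2 _ (by omega), hmem x hx y hy]
        rintro s₂ ⟨f1, f2, f3, f4⟩
        have fo : s₂.env o = O := by rw [f2 _ (by simp [(hne ho).1]), g4' _ ho, hO]
        have fa : s₂.env .a = r := by rw [f2 _ (by decide), g4 _ (by decide), ha]
        have fd4 : s₂.env .d4 = 4 ^ L := by rw [f2 _ (by decide), g4 _ (by decide), hd4']
        have fsame : Same (.a :: lookupVars) s₂ s := (f2.weaken (by decide)).trans g4'
        apply Tot.block_put
        · simp [fo, fa]; omega
        · simp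
        · simp only [Expr.eval, f1]; exact hc _ _
        refine Tot.block_nil ?_
        simp only [Expr.eval, Store.put_env, Store.put_mem, Store.put_used,
          Store.set_mem, Store.set_used, fo, fa, fd4, f1, f4, g6, h4, true_and, and_true]
        refine ⟨fun a ha' => ?_, fun a ha' => ?_, ?_⟩
        · split_ifs with h
          · rw [show a = r by omega]
          · rw [f3, g5]
            exact h1 a (by omega)
        · rw [if_neg (by omega), f3, g5, h2 a ha']
        · rw [same_set (by decide), same_put]
          exact fsame
      · simp
  · nlinarith
  · rintro s' ⟨-, -, h⟩
    exact h

/-! ### Extracting witnesses from the sums of the computed terms -/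

/-- `z` is a witness for the pair `x, y`. -/
def Witness (n : ℕ) (α β : ℕ → ℕ → ℕ) (x y z : ℕ) : Prop := z < n ∧ α x z = 1 ∧ β z y = 1

/-- The contribution of the witness `z`. -/
def weight (wit : Bool) (z : ℕ) : ℕ := if wit then z + 1 else 1

/-- The modulus for computations with weights. -/
def modulus (wit : Bool) (n : ℕ) : ℕ := if wit then n + 1 else 2

theorem weight_lt {wit : Bool} {n z : ℕ} (hz : z < n) : weight wit z < modulus wit n := by
  cases wit <;> simp [weight, modulus, hz]

theorem weight_pos (wit : Bool) (z : ℕ) : 0 < weight wit z := by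
  cases wit <;> simp [weight]

theorem padded_lt {wit wt : Bool} {n : ℕ} {γ : ℕ → ℕ → ℕ} (hn : 0 < n) (hγ : ∀ x y, γ x y < 2)
    (hwt : wt = true → wit = true) (x y : ℕ) : padded n wt γ x y < modulus wit n := by
  have := hγ x y
  unfold padded modulus
  cases wt <;> cases wit <;> simp at hwt ⊢ <;> split_ifs <;> omega

-- Only `B` carries weights, so a product of entries is the weight of `z` if `z` is a witness, and 0
-- otherwise.
open Classical in
theorem padded_mul {wit : Bool} {n x y z : ℕ} {α β : ℕ → ℕ → ℕ} (hα : ∀ x y, α x y < 2)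
    (hβ : ∀ x y, β x y < 2) (hx : x < n) (hy : y < n) :
    padded n false α x z * padded n wit β z y =
      if Witness n α β x y z then weight wit z else 0 := by
  have h1 := hα x z
  have h2 := hβ z y
  unfold padded Witness weight
  generalize α x z = a at *
  generalize β z y = b at *
  interval_cases a <;> interval_cases b <;> cases wit <;> simp [hx, hy]

section Sum
open Classical in
theorem sum_padded {wit : Bool} {n x y K : ℕ} {α β : ℕ → ℕ → ℕ} (hα : ∀ x y, α x y < 2)
    (hβ : ∀ x y, β x y < 2) (hx : x < n) (hy : y < n) (g : ℕ → ℕ) (G : ℕ → Bool) (md : ℕ) :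
    (∑ k ∈ Finset.range K, if G k then (padded n false α x (g k) : ZMod md) *
      padded n wit β (g k) y else 0) =
    ∑ k ∈ Finset.range K, if Witness n α β x y (g k) ∧ G k then (weight wit (g k) : ZMod md)
      else 0 := by
  refine Finset.sum_congr rfl fun k _ => ?_
  rw [← Nat.cast_mul, padded_mul hα hβ hx hy]
  by_cases h1 : G k <;> by_cases h2 : Witness n α β x y (g k) <;> simp [h1, h2]

variable {wit : Bool} {n x y K t : ℕ} {α β : ℕ → ℕ → ℕ} {g : ℕ → ℕ} {G : ℕ → Bool}

theorem natCast_inj_of_lt {md a b : ℕ} (ha : a < md) (hb : b < md)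
    (h : (a : ZMod md) = b) : a = b := by
  rw [ZMod.natCast_eq_natCast_iff'] at h
  rwa [Nat.mod_eq_of_lt ha, Nat.mod_eq_of_lt hb] at h

/-- Without a witness every term vanishes: there are no false positives, however terms may cancel.
-/
theorem exists_witness_of_sum_ne_zero (hα : ∀ x y, α x y < 2)
    (hβ : ∀ x y, β x y < 2) (hx : x < n) (hy : y < n) (ht : t < modulus wit n) (ht0 : t ≠ 0)
    (h : (t : ZMod (modulus wit n)) = ∑ k ∈ Finset.range K, if G k then
      (padded n false α x (g k) : ZMod (modulus wit n)) * padded n wit β (g k) y else 0) :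
    ∃ z, Witness n α β x y z := by
  by_contra! hW
  rw [sum_padded hα hβ hx hy] at h
  refine ht0 (natCast_inj_of_lt ht (by omega) (h.trans ?_))
  simp [hW]

/-- Only one term survives, and its weight is below the modulus, so it is recovered exactly. -/
theorem eq_weight_of_isolated (hα : ∀ x y, α x y < 2)
    (hβ : ∀ x y, β x y < 2) (hx : x < n) (hy : y < n) (ht : t < modulus wit n)
    (h : (t : ZMod (modulus wit n)) = ∑ k ∈ Finset.range K, if G k then
      (padded n false α x (g k) : ZMod (modulus wit n)) * padded n wit β (g k) y else 0)
    (hiso : ∃! k, k < K ∧ Witness n α β x y (g k) ∧ G k = true) :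
    ∃ z, Witness n α β x y z ∧ t = weight wit z := by
  obtain ⟨k, ⟨hk, hW, hG⟩, huniq⟩ := hiso
  refine ⟨g k, hW, natCast_inj_of_lt ht (weight_lt hW.1) ?_⟩
  rw [h, sum_padded hα hβ hx hy, Finset.sum_eq_single k]
  · rw [if_pos ⟨hW, hG⟩]
  · intro j hj hjk
    exact if_neg fun h' => hjk (huniq j ⟨Finset.mem_range.1 hj, h'⟩)
  · exact fun h' => absurd (Finset.mem_range.2 hk) h'

end Sum

/-- The nonzero values in the output cells are correct. -/
def Valid (wit : Bool) (n : ℕ) (α β : ℕ → ℕ → ℕ) (μ : ℕ → ℕ) : Prop :=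
  ∀ x < n, ∀ y < n, μ (2 * (n * n) + (x * n + y)) ≠ 0 →
    ∃ z, Witness n α β x y z ∧ μ (2 * (n * n) + (x * n + y)) = weight wit z

/-- Use the nonzero value `t` for the entry in row `x` and column `y` of the output. -/
def extract (wit : Bool) : Prog :=
  if wit then .block [
    .assign .z (.sub (.var .t) (.lit 1)),
    .ite (.lit 0) (.load (.add (.var .xn) (.var .z)))
      (.ite (.lit 0)
        (.load (.add (.var .nn) (.add (.mul (.var .z) (.var .n)) (.var .y))))
        (.put (.add (.var .nn) (.add (.var .nn) (.add (.var .xn) (.var .y)))) (.var .t))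
        .nop) .nop]
  else .put (.add (.var .nn) (.add (.var .nn) (.add (.var .xn) (.var .y)))) (.lit 1)

/-- Without witnesses, a nonzero `t` is proof enough and 1 is written. With witnesses, `t` may be a
sum of several weights, so `t - 1` is only a candidate: it is stored after a check against `A` and
`B`. Here `v` is the final content of the output cell. -/
theorem extract_spec {wit : Bool} {n x y t : ℕ} {α β : ℕ → ℕ → ℕ} {s : Store}
    (hα : ∀ x y, α x y < 2) (hβ : ∀ x y, β x y < 2)
    (hn : s.env .n = n) (hnn : s.env .nn = n * n)
    (hxn : s.env .xn = x * n) (hye : s.env .y = y) (hte : s.env .t = t)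
    (hA : ∀ x < n, ∀ y < n, s.mem (x * n + y) = α x y)
    (hB : ∀ x < n, ∀ y < n, s.mem (n * n + (x * n + y)) = β x y)
    (hx : x < n) (hy : y < n) (ht0 : 0 < t) (ht : t < modulus wit n)
    (hW : ∃ z, Witness n α β x y z) (hV : Valid wit n α β s.mem)
    (hw : 3 * (n * n) < 2 ^ w) (hmdc : modulus wit n ≤ 2 ^ c) (h1w : 1 < 2 ^ w) :
    Tot w c ω (extract wit) s 60 fun s' => ∃ v,
      (v ≠ 0 → ∃ z, Witness n α β x y z ∧ v = weight wit z) ∧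
      (s.mem (2 * (n * n) + (x * n + y)) ≠ 0 → v ≠ 0) ∧
      ((∃ z, Witness n α β x y z ∧ t = weight wit z) → v ≠ 0) ∧
      (∀ a, s'.mem a = if a = 2 * (n * n) + (x * n + y) then v else s.mem a) ∧
      Same [.z] s' s ∧ s'.used = s.used := by
  have hlt : x * n + y < n * n := mul_add_lt_mul hy hx
  have hadr : n * n + (n * n + (x * n + y)) = 2 * (n * n) + (x * n + y) := by ring
  have hnn' : n ≤ n * n := Nat.le_mul_of_pos_right _ (by omega)
  cases wit
  · simp only [extract, Bool.false_eq_true, if_false]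
    have h1c : 1 < 2 ^ c := by simpa [modulus, Nat.succ_le_iff] using hmdc
    refine (Tot.put ?_ ?_ ?_ ?_).le (show _ ≤ 60 by simp)
    · simp [hnn, hxn, hye]; omega
    · simp [h1w]
    · simp [h1c]
    · refine ⟨1, fun _ => ?_, by simp, by simp, fun a => ?_, by simp, rfl⟩
      · obtain ⟨z, hz⟩ := hW
        exact ⟨z, hz, by simp [weight]⟩
      · simp [hnn, hxn, hye, hadr]
  · simp only [extract, if_true]
    simp only [modulus, if_true] at ht hmdc
    have hz : t - 1 < n := by omega
    have e1 := hA x hx (t - 1) hz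
    have e2 := hB (t - 1) hz y hy
    have hzn : (t - 1) * n + y < n * n := mul_add_lt_mul hy hz
    have hzx : x * n + (t - 1) < n * n := mul_add_lt_mul hz hx
    have b1 := hα x (t - 1)
    have b2 := hβ (t - 1) y
    -- If the check fails, the cell keeps its content, which is valid by `hV`. An isolated witness
    -- never fails, since then `t - 1` is that witness.
    have hno : (¬ Witness n α β x y (t - 1)) → ∀ s', s' = s.set .z (t - 1) → ∃ v,
        (v ≠ 0 → ∃ z, Witness n α β x y z ∧ v = weight true z) ∧
        (s.mem (2 * (n * n) + (x * n + y)) ≠ 0 → v ≠ 0) ∧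
        ((∃ z, Witness n α β x y z ∧ t = weight true z) → v ≠ 0) ∧
        (∀ a, s'.mem a = if a = 2 * (n * n) + (x * n + y) then v else s.mem a) ∧
        Same [.z] s' s ∧ s'.used = s.used := by
      rintro h s' rfl
      refine ⟨_, hV x hx y hy, id, fun ⟨z, hz, htz⟩ => absurd hz ?_, fun a => ?_, by simp, rfl⟩
      · simpa [htz, weight] using h
      · simp only [Store.set_mem]
        split_ifs with ha
        · rw [ha]
        · rfl
    refine (Tot.block_assign (U := 50) ?_ ?_ ?_).le (by simp)
    · simp [h1w, hte]; omega
    · simp [hte]; omega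
    simp only [Expr.eval, hte]
    refine (Tot.block_cons (T := 50) (U := 0) (R := fun s' => ∃ v,
      (v ≠ 0 → ∃ z, Witness n α β x y z ∧ v = weight true z) ∧
      (s.mem (2 * (n * n) + (x * n + y)) ≠ 0 → v ≠ 0) ∧
      ((∃ z, Witness n α β x y z ∧ t = weight true z) → v ≠ 0) ∧
      (∀ a, s'.mem a = if a = 2 * (n * n) + (x * n + y) then v else s.mem a) ∧
      Same [.z] s' s ∧ s'.used = s.used) ?_ fun s' h => Tot.block_nil h).le (by simp)
    refine (Tot.ite (T := 40) (U := 0) ?_ ?_ ?_ ?_).le (by simp)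
    · simp
    · simp [hxn, e1]; omega
    · simp only [Expr.eval, Store.set_env, Store.set_mem, reduceCtorEq, if_true, if_false, hxn, e1]
      intro hA1
      refine (Tot.ite (T := 15) (U := 0) ?_ ?_ ?_ ?_).le (by simp)
      · simp
      · simp [hnn, hn, hye, e2]; omega
      · simp only [Expr.eval, Store.set_env, Store.set_mem, reduceCtorEq, if_true, if_false, hnn, hn,
          hye, e2]
        intro hB1
        refine (Tot.put ?_ ?_ ?_ ?_).le (by simp)
        · simp [hnn, hxn, hye]; omega
        · simp
        · simp [hte]; omega
        · refine ⟨t, fun _ => ⟨t - 1, ⟨hz, by omega, by omega⟩, by simp [weight]; omega⟩,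
            fun _ => by omega, fun _ => by omega, fun a => ?_, by simp, rfl⟩
          simp [hnn, hxn, hye, hte, hadr]
      · simp only [Expr.eval, Store.set_env, Store.set_mem, reduceCtorEq, if_true, if_false, hnn, hn,
          hye, e2]
        intro hB1
        exact Tot.nop (hno (fun h => by have := h.2.2; omega) _ rfl)
    · simp only [Expr.eval, Store.set_env, Store.set_mem, reduceCtorEq, if_true, if_false, hxn, e1]
      intro hA1
      exact Tot.nop (hno (fun h => by have := h.2.1; omega) _ rfl)

/-- Extract witnesses from all entries of the matrix at address `src`. -/
def extractAll (wit : Bool) : Prog := .forLt .a .d4 (.block [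
  lookup .rb .m .hb .m,
  .ite (.var .x) (.var .n) (.ite (.var .y) (.var .n) (.block [
    .assign .t (.load (.add (.var .src) (.var .a))),
    .ite (.lit 0) (.var .t) (extract wit) .nop]) .nop) .nop])

/-- Output cells never return from nonzero to zero and stay valid throughout, so results of earlier
runs are not lost. -/
theorem extractAll_spec {wit : Bool} {n m L B H C U : ℕ} {α β : ℕ → ℕ → ℕ} {s : Store}
    (X Y : ℕ → ℕ) (hX : X = fun a => tableEntry s.mem (2 ^ L) B m (row L a))
    (hY : Y = fun a => tableEntry s.mem (2 ^ L) H m (col L a))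
    (hα : ∀ x y, α x y < 2) (hβ : ∀ x y, β x y < 2)
    (hn : s.env .n = n) (hnn : s.env .nn = n * n) (hm : s.env .m = m) (hL : s.env .L = L)
    (hD : s.env .d2 = 2 ^ L) (hd4 : s.env .d4 = 4 ^ L) (hB : s.env .rb = B) (hH : s.env .hb = H)
    (hC : s.env .src = C)
    (hmA : ∀ x < n, ∀ y < n, s.mem (x * n + y) = α x y)
    (hmB : ∀ x < n, ∀ y < n, s.mem (n * n + (x * n + y)) = β x y)
    (hbit₁ : ∀ x < m * 2 ^ L, s.mem (B + x) < 2) (hbit₂ : ∀ x < m * 2 ^ L, s.mem (H + x) < 2)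
    (hn0 : 0 < n) (hnB : 3 * (n * n) ≤ B) (hnH : 3 * (n * n) ≤ H) (hnC : 3 * (n * n) ≤ C)
    (hU : U < 2 ^ w) (hBU : B + 2 ^ L + m * 2 ^ L ≤ U) (hHU : H + 2 ^ L + m * 2 ^ L ≤ U)
    (hCU : C + 4 ^ L ≤ U) (hLU : 2 ^ (L + 1) ≤ U) (hmU : 2 ^ m * n ≤ U)
    (hmdc : modulus wit n ≤ 2 ^ c) (hV : Valid wit n α β s.mem)
    (hval : ∀ a < 4 ^ L, X a < n → Y a < n → s.mem (C + a) < modulus wit n ∧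
      (s.mem (C + a) ≠ 0 → ∃ z, Witness n α β (X a) (Y a) z)) :
    Tot w c ω (extractAll wit) s (400 * ((L + m + m + 2) * 4 ^ L)) fun s' =>
      Valid wit n α β s'.mem ∧
      (∀ x < n, ∀ y < n, s.mem (2 * (n * n) + (x * n + y)) ≠ 0 →
        s'.mem (2 * (n * n) + (x * n + y)) ≠ 0) ∧
      (∀ a < 4 ^ L, X a < n → Y a < n →
        (∃ z, Witness n α β (X a) (Y a) z ∧ s.mem (C + a) = weight wit z) →
        s'.mem (2 * (n * n) + (X a * n + Y a)) ≠ 0) ∧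
      (∀ a, a < 2 * (n * n) ∨ 3 * (n * n) ≤ a → s'.mem a = s.mem a) ∧
      Same (.z :: .a :: lookupVars) s' s ∧ s'.used = s.used := by
  have h1L : 1 ≤ 2 ^ L := Nat.one_le_two_pow
  have h4L : 1 ≤ 4 ^ L := Nat.one_le_pow _ _ (by norm_num)
  have h2L : 2 ^ (L + 1) = 2 * 2 ^ L := by ring
  have hmn : 2 ^ m ≤ 2 ^ m * n := Nat.le_mul_of_pos_right _ hn0
  have s1 : m < 2 ^ m := Nat.lt_two_pow_self
  have hnn' : n ≤ n * n := Nat.le_mul_of_pos_right _ hn0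
  have h1w : 1 < 2 ^ w := by omega
  have hmdU : modulus wit n ≤ n + 1 := by unfold modulus; split_ifs <;> omega
  have htab {μ : ℕ → ℕ} (hμ : ∀ a, a < 2 * (n * n) ∨ 3 * (n * n) ≤ a → μ a = s.mem a) {A i : ℕ}
      (h : 3 * (n * n) ≤ A) : tableEntry μ (2 ^ L) A m i = tableEntry s.mem (2 ^ L) A m i :=
    ofBits_congr fun r hr => hμ _ (by omega)
  set l : List Var := .z :: .a :: lookupVars with hl
  unfold extractAll
  apply Tot.mono
  · refine Tot.forLt (N := 4 ^ L) (T := 100 * (L + m + m + 2) + 150) (I := fun r s' =>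
      Valid wit n α β s'.mem ∧
      (∀ x < n, ∀ y < n, s.mem (2 * (n * n) + (x * n + y)) ≠ 0 →
        s'.mem (2 * (n * n) + (x * n + y)) ≠ 0) ∧
      (∀ a < r, X a < n → Y a < n →
        (∃ z, Witness n α β (X a) (Y a) z ∧ s.mem (C + a) = weight wit z) →
        s'.mem (2 * (n * n) + (X a * n + Y a)) ≠ 0) ∧
      (∀ a, a < 2 * (n * n) ∨ 3 * (n * n) ≤ a → s'.mem a = s.mem a) ∧
      Same l s' s ∧ s'.used = s.used)
      (by decide) hd4 (by omega) ?_ ?_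
    · simp [hV, hl]
    · rintro r s' hr ha hd4' ⟨h1, h2, h3, h4, h5, h6⟩
      set R : Store → Prop := fun s' => s'.env .a = r ∧ s'.env .d4 = 4 ^ L ∧
        Valid wit n α β s'.mem ∧
        (∀ x < n, ∀ y < n, s.mem (2 * (n * n) + (x * n + y)) ≠ 0 →
          s'.mem (2 * (n * n) + (x * n + y)) ≠ 0) ∧
        (∀ a < r + 1, X a < n → Y a < n →
          (∃ z, Witness n α β (X a) (Y a) z ∧ s.mem (C + a) = weight wit z) →
          s'.mem (2 * (n * n) + (X a * n + Y a)) ≠ 0) ∧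
        (∀ a, a < 2 * (n * n) ∨ 3 * (n * n) ≤ a → s'.mem a = s.mem a) ∧
        Same l s' s ∧ s'.used = s.used with hR
      refine Tot.mono (Q := R) ?_ le_rfl ?_
      swap
      · rintro s'' ⟨g1, g2, g3⟩
        refine ⟨g1, g2, ?_⟩
        simp only [Store.set_mem, Store.set_used]
        rw [same_set (by simp [hl])]
        exact g3
      apply Tot.le
      · apply Tot.block_cons
        · refine lookup_spec (n := n) (L := L) (D := 2 ^ L) (a := r) (B₁ := B) (B₂ := H)
            (k₁ := m) (k₂ := m) (by decide) (by rw [h5 _ (by decide), hn])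
            (by rw [h5 _ (by decide), hL]) (by rw [h5 _ (by decide), hD]) rfl ha
            (by rw [h5 _ (by decide), hB]) (by rw [h5 _ (by decide), hH])
            (by rw [h5 _ (by decide), hm])
            (by rw [h5 _ (by decide), hm]) (fun x hx => ?_) (fun x hx => ?_) hn0 (by omega)
            (by omega) (by omega) (by omega) (by omega) (by omega) (by omega) (by omega)
          · rw [h4 _ (by omega)]; exact hbit₁ x hx
          · rw [h4 _ (by omega)]; exact hbit₂ x hx
        rw [htab h4 hnB, htab h4 hnH]
        rintro s₁ ⟨g1, g2, g3, g4, g5, g6⟩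
        replace g1 : s₁.env .x = X r := by rw [g1, hX]
        replace g2 : s₁.env .xn = X r * n := by rw [g2, hX]
        replace g3 : s₁.env .y = Y r := by rw [g3, hY]
        have g4' : Same l s₁ s := (g4.weaken (by simp [hl]; tauto)).trans h5
        have ga : s₁.env .a = r := by rw [g4 _ (by decide), ha]
        have gd4 : s₁.env .d4 = 4 ^ L := by rw [g4 _ (by decide), hd4']
        -- Skipping index `r` loses nothing: it is only done outside the range or for the value 0,
        -- whereas a weight is positive.
        have hskip (hno : ¬ (X r < n ∧ Y r < n ∧ s.mem (C + r) ≠ 0)) (s₂ : Store)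
            (f1 : Same [.t] s₂ s₁) (f2 : s₂.mem = s₁.mem) (f3 : s₂.used = s₁.used) : R s₂ := by
          refine ⟨by rw [f1 _ (by decide), ga], by rw [f1 _ (by decide), gd4], ?_⟩
          rw [f2, g5]
          refine ⟨h1, h2, fun a ha' hXa hYa hz => ?_, h4, (f1.weaken (by simp [hl, lookupVars])).trans g4',
            by rw [f3, g6, h6]⟩
          rcases Nat.lt_succ_iff_lt_or_eq.1 ha' with h | rfl
          · exact h3 a h hXa hYa hz
          · obtain ⟨z, hz1, hz2⟩ := hz
            exact absurd ⟨hXa, hYa, by rw [hz2]; exact (weight_pos _ _).ne'⟩ hno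
        refine Tot.block_cons (T := 120) (U := 0) (R := R) ?_ fun s'' h => Tot.block_nil h
        refine (Tot.ite (T := 110) (U := 0) (by simp) (by simp) ?_ ?_).le (by simp)
        · simp only [Expr.eval, g1, g4' _ (show Var.n ∉ l by decide), hn]
          intro hXn
          refine (Tot.ite (T := 100) (U := 0) (by simp) (by simp) ?_ ?_).le (by simp)
          · simp only [Expr.eval, g3, g4' _ (show Var.n ∉ l by decide), hn]
            intro hYn
            obtain ⟨v1, v2⟩ := hval r hr hXn hYn
            have hsrc : s₁.env .src = C := by rw [g4' _ (by decide), hC]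
            have hmr : s₁.mem (C + r) = s.mem (C + r) := by rw [g5, h4 _ (by omega)]
            refine (Tot.block_assign (U := 90) ?_ ?_ ?_).le (by simp)
            · simp [hsrc, ga, hmr]; omega
            · simp [hsrc, ga, hmr]; omega
            simp only [Expr.eval, hsrc, ga, hmr]
            refine (Tot.block_cons (T := 80) (U := 0) (R := R) ?_ fun s'' h =>
              Tot.block_nil h).le (by simp)
            refine (Tot.ite (T := 60) (U := 0) (by simp) (by simp) ?_ ?_).le (by simp)
            · simp only [Expr.eval, Store.set_env, if_true]
              intro ht0
              refine (extract_spec (n := n) (x := X r) (y := Y r) (t := s.mem (C + r)) (α := α)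
                (β := β) hα hβ ?_ ?_ ?_ ?_ ?_ ?_ ?_ hXn hYn ht0 v1 (v2 ht0.ne') ?_ (by omega)
                hmdc h1w).mono le_rfl ?_
              · simp [g4' _ (show Var.n ∉ l by decide), hn]
              · simp [g4' _ (show Var.nn ∉ l by decide), hnn]
              · simp [g2]
              · simp [g3]
              · simp
              · intro x hx y hy
                have := mul_add_lt_mul hy hx
                rw [Store.set_mem, g5, h4 _ (by omega), hmA x hx y hy]
              · intro x hx y hy
                have := mul_add_lt_mul hy hx
                rw [Store.set_mem, g5, h4 _ (by omega), hmB x hx y hy]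
              · rw [Store.set_mem, g5]
                exact h1
              · rintro s₂ ⟨v, f1, f2, f3, f4, f5, f6⟩
                have fs : Same l s₂ s := by
                  refine (f5.weaken (by simp [hl])).trans ?_
                  rw [same_set (by simp [hl, lookupVars])]
                  exact g4'
                simp only [Store.set_mem, g5] at f2 f4
                have hXY := mul_add_lt_mul hYn hXn
                refine ⟨by rw [f5 _ (by decide)]; simp [ga], by rw [f5 _ (by decide)]; simp [gd4],
                  fun x hx y hy => ?_, fun x hx y hy hne => ?_, fun a ha' hXa hYa hz => ?_,
                  fun a ha' => ?_, fs, by rw [f6]; simp [g6, h6]⟩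
                · rw [f4]
                  split_ifs with h
                  · obtain ⟨rfl, rfl⟩ := mul_add_inj hy hYn (Nat.add_left_cancel h)
                    exact f1
                  · exact h1 x hx y hy
                · rw [f4]
                  split_ifs with h
                  · rw [h] at hne
                    refine f2 ?_
                    exact h2 _ hXn _ hYn hne
                  · exact h2 x hx y hy hne
                · rw [f4]
                  split_ifs with h
                  · rcases Nat.lt_succ_iff_lt_or_eq.1 ha' with h' | rfl
                    · refine f2 ?_
                      rw [← h]
                      exact h3 a h' hXa hYa hz
                    · exact f3 hz
                  · rcases Nat.lt_succ_iff_lt_or_eq.1 ha' with h' | rfl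
                    · exact h3 a h' hXa hYa hz
                    · exact absurd rfl h
                · rw [f4, if_neg (by omega), h4 a ha']
            · simp only [Expr.eval, Store.set_env, if_true]
              intro ht0
              exact Tot.nop (hskip (by omega) _ (by simp) rfl rfl)
          · simp only [Expr.eval, g3, g4' _ (show Var.n ∉ l by decide), hn]
            intro hYn
            exact Tot.nop (hskip (by omega) _ (by simp) rfl rfl)
        · simp only [Expr.eval, g1, g4' _ (show Var.n ∉ l by decide), hn]
          intro hXn
          exact Tot.nop (hskip (by omega) _ (by simp) rfl rfl)
      · omega
  · nlinarith
  · rintro s' ⟨-, -, h⟩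
    exact h

/-! ### One run of the algorithm -/

/-- The number of cells for input, output, and the table of remainders. -/
def base (wit : Bool) (n : ℕ) : ℕ := 3 * (n * n) + modulus wit n * modulus wit n

/-- The variables that are initialized once and for all. -/
def globals : List Var := [.n, .m, .L, .d2, .d4, .nn, .md, .tb, .rb]

/-- The initialization has been done, and the output so far is correct. -/
structure Ready (wit : Bool) (n m L : ℕ) (α β : ℕ → ℕ → ℕ) (s : Store) : Prop where
  env_n : s.env .n = n
  env_m : s.env .m = m
  env_L : s.env .L = L
  env_d2 : s.env .d2 = 2 ^ L
  env_d4 : s.env .d4 = 4 ^ L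
  env_nn : s.env .nn = n * n
  env_md : s.env .md = modulus wit n
  env_tb : s.env .tb = 3 * (n * n)
  env_rb : s.env .rb = base wit n
  memA : ∀ x < n, ∀ y < n, s.mem (x * n + y) = α x y
  memB : ∀ x < n, ∀ y < n, s.mem (n * n + (x * n + y)) = β x y
  table : ∀ v < modulus wit n * modulus wit n, s.mem (3 * (n * n) + v) = v % modulus wit n
  valid : Valid wit n α β s.mem

section
variable {wit : Bool} {n m L : ℕ} {α β : ℕ → ℕ → ℕ} {s s' : Store} {l : List Var}

theorem Ready.congr_valid (h : Ready wit n m L α β s) (hs : Same l s' s)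
    (hl : ∀ u ∈ globals, u ∉ l)
    (hmem : ∀ a, a < 2 * (n * n) ∨ 3 * (n * n) ≤ a → a < base wit n → s'.mem a = s.mem a)
    (hV : Valid wit n α β s'.mem) : Ready wit n m L α β s' where
  env_n := by rw [hs _ (hl _ (by decide)), h.env_n]
  env_m := by rw [hs _ (hl _ (by decide)), h.env_m]
  env_L := by rw [hs _ (hl _ (by decide)), h.env_L]
  env_d2 := by rw [hs _ (hl _ (by decide)), h.env_d2]
  env_d4 := by rw [hs _ (hl _ (by decide)), h.env_d4]
  env_nn := by rw [hs _ (hl _ (by decide)), h.env_nn]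
  env_md := by rw [hs _ (hl _ (by decide)), h.env_md]
  env_tb := by rw [hs _ (hl _ (by decide)), h.env_tb]
  env_rb := by rw [hs _ (hl _ (by decide)), h.env_rb]
  memA := fun x hx y hy => by
    have := mul_add_lt_mul hy hx
    rw [hmem _ (by omega) (by unfold base; omega), h.memA x hx y hy]
  memB := fun x hx y hy => by
    have := mul_add_lt_mul hy hx
    rw [hmem _ (by omega) (by unfold base; omega), h.memB x hx y hy]
  table := fun v hv => by rw [hmem _ (by omega) (by unfold base; omega), h.table v hv]
  valid := hV

theorem Ready.congr (h : Ready wit n m L α β s) (hs : Same l s' s) (hl : ∀ u ∈ globals, u ∉ l)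
    (hmem : ∀ a < base wit n, s'.mem a = s.mem a) : Ready wit n m L α β s' := by
  refine h.congr_valid hs hl (fun a _ ha => hmem a ha) fun x hx y hy => ?_
  have := mul_add_lt_mul hy hx
  rw [hmem _ (by unfold base; omega)]
  exact h.valid x hx y hy

end

theorem modulus_ge {wit : Bool} {n : ℕ} (hn : 0 < n) : 2 ≤ modulus wit n := by
  unfold modulus; split_ifs <;> omega

/-- Multiply two vectors of length `sz` pointwise, modulo `md`. -/
def pointwise : Prog := .forLt .a .sz (.put (.add (.var .pc) (.var .a))
  (.load (.add (.var .tb) (.mul (.load (.add (.var .fa) (.var .a)))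
    (.load (.add (.var .src) (.var .a)))))))

/-- Both factors are below `md`, so their product is an index into the table of remainders; this
replaces a division. -/
theorem pointwise_spec {wit : Bool} {n m L F G C N : ℕ} {α β : ℕ → ℕ → ℕ} {s : Store}
    (hs : Ready wit n m L α β s) (hF : s.env .fa = F) (hG : s.env .src = G) (hC : s.env .pc = C)
    (hN : s.env .sz = N)
    (hn : 0 < n) (hFC : F + N ≤ C) (hGC : G + N ≤ C) (hbC : base wit n ≤ C) (hCw : C + N < 2 ^ w)
    (hF' : ∀ x < N, s.mem (F + x) < modulus wit n) (hG' : ∀ x < N, s.mem (G + x) < modulus wit n)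
    (hmdc : modulus wit n ≤ 2 ^ c) :
    Tot w c ω pointwise s (40 * N + 2) fun s' =>
      (∀ x < N, s'.mem (C + x) < modulus wit n ∧ (s'.mem (C + x) : ZMod (modulus wit n)) =
        s.mem (F + x) * s.mem (G + x)) ∧
      (∀ a < C, s'.mem a = s.mem a) ∧ Same [.a] s' s ∧ s'.used = s.used := by
  have hmd := modulus_ge (wit := wit) hn
  have hb : base wit n = 3 * (n * n) + modulus wit n * modulus wit n := rfl
  have hmd2 : modulus wit n ≤ modulus wit n * modulus wit n := Nat.le_mul_of_pos_left _ (by omega)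
  unfold pointwise
  apply Tot.mono
  · refine Tot.forLt (N := N) (T := 35) (I := fun r s' =>
      (∀ x < r, s'.mem (C + x) < modulus wit n ∧ (s'.mem (C + x) : ZMod (modulus wit n)) =
        s.mem (F + x) * s.mem (G + x)) ∧
      (∀ a < C, s'.mem a = s.mem a) ∧ Same [.a] s' s ∧ s'.used = s.used)
      (by decide) hN (by omega) ?_ ?_
    · simp
    · rintro r s' hr ha hN' ⟨h1, h2, h3, h4⟩
      have e1 : s'.env .fa = F := by rw [h3 _ (by decide), hF]
      have e2 : s'.env .src = G := by rw [h3 _ (by decide), hG]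
      have e3 : s'.env .pc = C := by rw [h3 _ (by decide), hC]
      have e4 : s'.env .tb = 3 * (n * n) := by rw [h3 _ (by decide), hs.env_tb]
      have m1 : s'.mem (F + r) = s.mem (F + r) := h2 _ (by omega)
      have m2 : s'.mem (G + r) = s.mem (G + r) := h2 _ (by omega)
      have v1 := hF' r hr
      have v2 := hG' r hr
      have hprod : s.mem (F + r) * s.mem (G + r) < modulus wit n * modulus wit n :=
        Nat.mul_lt_mul_of_lt_of_lt v1 v2
      have m3 : s'.mem (3 * (n * n) + s.mem (F + r) * s.mem (G + r)) =
          (s.mem (F + r) * s.mem (G + r)) % modulus wit n := by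
        rw [h2 _ (by omega), hs.table _ hprod]
      have hlt : (s.mem (F + r) * s.mem (G + r)) % modulus wit n < modulus wit n :=
        Nat.mod_lt _ (by omega)
      have hcast : (((s.mem (F + r) * s.mem (G + r)) % modulus wit n : ℕ) :
          ZMod (modulus wit n)) = s.mem (F + r) * s.mem (G + r) := by
        rw [ZMod.natCast_mod, Nat.cast_mul]
      generalize (s.mem (F + r) * s.mem (G + r)) % modulus wit n = v at *
      refine (Tot.put ?_ ?_ ?_ ?_).le (by simp)
      · simp [e3, ha]; omega
      · simp [e1, e2, e4, ha, m1, m2, m3]; omega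
      · simp [e1, e2, e4, ha, m1, m2, m3]; omega
      · simp only [Expr.eval, Store.put_env, Store.put_mem, Store.put_used, 
          Store.set_mem, Store.set_used, e1, e2, e3, e4, ha, hN', m1, m2, m3, h4, true_and,
          and_true]
        refine ⟨fun x hx => ?_, fun a ha' => ?_, ?_⟩
        · split_ifs with h
          · rw [show x = r by omega]
            exact ⟨hlt, hcast⟩
          · exact h1 x (by omega)
        · rw [if_neg (by omega), h2 a ha']
        · rw [same_set (by decide), same_put]
          exact h3
  · omega
  · rintro s' ⟨-, -, h⟩
    exact h

/-- Compute the sums of the computed terms, once the random maps have been drawn. -/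
def partialProduct (wit : Bool) : Prog := .block [
  .assign .z (.lit 0), gather false .rb .m .gb .e .z .ab,
  .assign .src (.var .ab), .assign .sz (.var .d4), transform coeffA 4,
  .assign .fa (.var .src), .assign .bb (.add (.var .src) (.var .sz)),
  gather wit .gb .e .hb .m .nn .bb,
  .assign .src (.var .bb), .assign .sz (.var .d4), transform coeffB 4,
  .assign .pc (.add (.var .src) (.var .sz)), pointwise,
  .assign .src (.var .pc), transform coeffC 6]

def productVars : List Var := [.z, .fa, .bb, .pc, .a] ++ lookupVars ++ transformVars

-- The rearranged `A`, its transform at `F`, the rearranged `B`, its transform at `G`, the pointwise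
-- products and their transform at `C` follow each other in memory. Each part is written behind the
-- previous ones, and `40 * 6 ^ L` cells suffice.
set_option maxHeartbeats 1000000 in
theorem partialProduct_spec {wit : Bool} {n m L e GB HB AB U : ℕ} {α β : ℕ → ℕ → ℕ} {s : Store}
    (hs : Ready wit n m L α β s) (f g h : ℕ → ℕ)
    (hf : f = tableEntry s.mem (2 ^ L) (base wit n) m)
    (hg : g = tableEntry s.mem (2 ^ L) GB e) (hh : h = tableEntry s.mem (2 ^ L) HB m)
    (hα : ∀ x y, α x y < 2) (hβ : ∀ x y, β x y < 2) (he : s.env .e = e)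
    (hGB : s.env .gb = GB) (hHB : s.env .hb = HB) (hAB : s.env .ab = AB)
    (hbit₁ : ∀ x < m * 2 ^ L, s.mem (base wit n + x) < 2)
    (hbit₂ : ∀ x < e * 2 ^ L, s.mem (GB + x) < 2)
    (hbit₃ : ∀ x < m * 2 ^ L, s.mem (HB + x) < 2) (hn : 0 < n)
    (hBG : base wit n + m * 2 ^ L ≤ GB) (hGH : GB + e * 2 ^ L ≤ HB) (hHA : HB + m * 2 ^ L ≤ AB)
    (hU : U < 2 ^ w) (hAU : AB + 40 * 6 ^ L ≤ U) (hmU : 2 ^ m * n ≤ U) (heU : 2 ^ e * n ≤ U)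
    (hmdc : modulus wit n ≤ 2 ^ c) :
    Tot w c ω (partialProduct wit) s (10000 * ((L + m + e + 2) * 4 ^ L + 6 ^ L)) fun s' =>
      ∃ C, AB ≤ C ∧ C + 4 ^ L ≤ U ∧ s'.env .src = C ∧
      (∀ a < 4 ^ L, s'.mem (C + a) < modulus wit n ∧ (s'.mem (C + a) : ZMod (modulus wit n)) =
        ∑ k ∈ Finset.range (2 ^ L), if good L (row L a) k (col L a) then
          (padded n false α (f (row L a)) (g k) : ZMod (modulus wit n)) *
            padded n wit β (g k) (h (col L a)) else 0) ∧
      (∀ a < AB, s'.mem a = s.mem a) ∧ Same productVars s' s ∧ s'.used = s.used := by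
  have h2L : 2 ^ (L + 1) = 2 * 2 ^ L := by ring
  have h26 : 2 ^ L ≤ 6 ^ L := Nat.pow_le_pow_left (by norm_num) L
  have h46 : 4 ^ L ≤ 6 ^ L := Nat.pow_le_pow_left (by norm_num) L
  have h6L : 1 ≤ 6 ^ L := Nat.one_le_pow _ _ (by norm_num)
  have h4L : 1 ≤ 4 ^ L := Nat.one_le_pow _ _ (by norm_num)
  have hb : base wit n = 3 * (n * n) + modulus wit n * modulus wit n := rfl
  have hnn : 1 ≤ n * n := Nat.mul_pos hn hn
  have hmd := modulus_ge (wit := wit) hn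
  have hmd2 : 2 * modulus wit n ≤ modulus wit n * modulus wit n := Nat.mul_le_mul_right _ hmd
  have hG4 := sum_four_six L
  have hG6 := sum_six_four L
  have hg1 {u : Var} (hu : u ∈ globals) : u ∉ productVars := by revert u; decide
  have hp1 : ∀ u ∈ Var.a :: lookupVars, u ∈ productVars := by decide
  have hp2 : ∀ u ∈ transformVars, u ∈ productVars := by decide
  unfold partialProduct
  apply Tot.le
  · apply Tot.block_assign
    · simp
    · simp
    apply Tot.block_cons
    · refine gather_spec (n := n) (L := L) (B₁ := base wit n) (B₂ := GB) (k₁ := m) (k₂ := e) (B := 0)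
        (O := AB) (U := U) (γ := α) (by decide) ?_ ?_ ?_ ?_ ?_ ?_ ?_ ?_ ?_ ?_ hbit₁ hbit₂
        (fun x hx y hy => ?_) hα hn hU (by omega) (by omega) (by omega) (by omega) (by omega)
        (by omega) (by omega) hmU heU
        (fun x y => (padded_lt (wit := wit) hn hα (by simp) x y).trans_le hmdc)
      · simp [hs.env_n]
      · simp [hs.env_L]
      · simp [hs.env_d2]
      · simp [hs.env_d4]
      · simp [hs.env_rb]
      · simp [hGB]
      · simp [hs.env_m]
      · simp [he]
      · simp
      · simp [hAB]
      · simpa using hs.memA x hx y hy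
    simp only [Store.set_mem, Store.set_used, ← hf, ← hg]
    rintro s₁ ⟨a1, a2, a3, a4⟩
    replace a3 : Same productVars s₁ s :=
      (a3.weaken hp1).trans ((same_set (by decide)).2 Same.self)
    apply Tot.block_assign
    · simp
    · simp [a3 .ab (by decide), hAB]; omega
    apply Tot.block_assign
    · simp
    · simp [a3 .d4 (by decide), hs.env_d4]; omega
    apply Tot.block_cons
    · refine transform_spec coeffA (p := 4) (q := 6) (by norm_num) (by norm_num) (by norm_num)
        (by norm_num) rfl (by decide) (md := modulus wit n) (L := L) (A := AB) (by omega) ?_ ?_ ?_ ?_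
        (fun x hx => ?_) (by omega) hmdc (by omega) (by omega)
      · simp [a3 .md (by decide), hs.env_md]
      · simp [a3 .L (by decide), hs.env_L]
      · simp [a3 .ab (by decide), hAB]
      · simp [a3 .d4 (by decide), hs.env_d4]
      · simp only [Store.set_mem, a1 x hx]
        exact padded_lt hn hα (by simp) _ _
    simp only [Store.set_mem, Store.set_used]
    rintro s₂ ⟨F, b1, b2, b3, b4, b5, b6, b7, b8⟩
    replace b7 : Same productVars s₂ s := (b7.weaken hp2).trans
      ((same_set (by decide)).2 ((same_set (by decide)).2 a3))
    apply Tot.block_assign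
    · simp
    · simp [b3]; omega
    apply Tot.block_assign
    · simp [b3, b4]; omega
    · simp [b3, b4]; omega
    simp only [Expr.eval, Store.set_env, reduceCtorEq, if_false, b3, b4]
    have m2 : ∀ a < AB, s₂.mem a = s.mem a := fun a ha => by rw [b6 a ha, a2 a ha]
    have htab {B k : ℕ} (hB : B + k * 2 ^ L ≤ AB) {i : ℕ} (hi : i < 2 ^ L) :
        tableEntry s₂.mem (2 ^ L) B k i = tableEntry s.mem (2 ^ L) B k i :=
      ofBits_congr fun r hr => m2 _ (by have := mul_add_lt_mul hi hr; omega)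
    apply Tot.block_cons
    · refine gather_spec (n := n) (L := L) (B₁ := GB) (B₂ := HB) (k₁ := e) (k₂ := m) (B := n * n)
        (O := F + 6 ^ L) (U := U) (γ := β) (by decide) ?_ ?_ ?_ ?_ ?_ ?_ ?_ ?_ ?_ ?_
        (fun x hx => ?_) (fun x hx => ?_)
        (fun x hx y hy => ?_) hβ hn hU (by omega) (by omega) (by omega) (by omega) (by omega)
        (by omega) (by omega) heU hmU
        (fun x y => (padded_lt (wit := wit) hn hβ id x y).trans_le hmdc)
      · simp [b7 .n (by decide), hs.env_n]
      · simp [b7 .L (by decide), hs.env_L]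
      · simp [b7 .d2 (by decide), hs.env_d2]
      · simp [b7 .d4 (by decide), hs.env_d4]
      · simp [b7 .gb (by decide), hGB]
      · simp [b7 .hb (by decide), hHB]
      · simp [b7 .e (by decide), he]
      · simp [b7 .m (by decide), hs.env_m]
      · simp [b7 .nn (by decide), hs.env_nn]
      · simp
      · simp only [Store.set_mem]
        rw [m2 _ (by omega)]; exact hbit₂ x hx
      · simp only [Store.set_mem]
        rw [m2 _ (by omega)]; exact hbit₃ x hx
      · have := mul_add_lt_mul hy hx
        simp only [Store.set_mem]
        rw [m2 _ (by omega)]; exact hs.memB x hx y hy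
    simp only [Store.set_mem, Store.set_used]
    rintro s₃ ⟨c1, c2, c3, c4⟩
    have c5 : s₃.env .fa = F := by rw [c3 _ (by decide)]; simp
    have c6 : s₃.env .bb = F + 6 ^ L := by rw [c3 _ (by decide)]; simp
    replace c3 : Same productVars s₃ s := (c3.weaken hp1).trans
      ((same_set (by decide)).2 ((same_set (by decide)).2 b7))
    apply Tot.block_assign
    · simp
    · simp [c6]; omega
    apply Tot.block_assign
    · simp
    · simp [c3 .d4 (by decide), hs.env_d4]; omega
    apply Tot.block_cons
    · refine transform_spec coeffB (p := 4) (q := 6) (by norm_num) (by norm_num) (by norm_num)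
        (by norm_num) rfl (by decide) (md := modulus wit n) (L := L) (A := F + 6 ^ L) (by omega)
        ?_ ?_ ?_ ?_ (fun x hx => ?_) (by omega) hmdc (by omega) (by omega)
      · simp [c3 .md (by decide), hs.env_md]
      · simp [c3 .L (by decide), hs.env_L]
      · simp [c6]
      · simp [c3 .d4 (by decide), hs.env_d4]
      · simp only [Store.set_mem, c1 x hx]
        exact padded_lt hn hβ id _ _
    simp only [Store.set_mem, Store.set_used]
    rintro s₄ ⟨G, d1, d2, d3, d4, d5, d6, d7, d8⟩
    have d9 : s₄.env .fa = F := by rw [d7 _ (by decide)]; simp [c5]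
    replace d7 : Same productVars s₄ s := (d7.weaken hp2).trans
      ((same_set (by decide)).2 ((same_set (by decide)).2 c3))
    have m4 : ∀ a < AB, s₄.mem a = s.mem a := fun a ha => by
      rw [d6 a (by omega), c2 a (by omega), m2 a ha]
    apply Tot.block_assign
    · simp [d3, d4]; omega
    · simp [d3, d4]; omega
    simp only [Expr.eval, d3, d4]
    have mF : ∀ x < 6 ^ L, s₄.mem (F + x) = s₂.mem (F + x) := fun x hx => by
      rw [d6 _ (by omega), c2 _ (by omega)]
    apply Tot.block_cons
    · refine pointwise_spec (wit := wit) (n := n) (m := m) (L := L) (α := α) (β := β) (F := F)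
        (G := G) (C := G + 6 ^ L) (N := 6 ^ L)
        (hs.congr (l := productVars) (by rw [same_set (by decide)]; exact d7) (fun u hu => hg1 hu)
          fun a ha => m4 a (by omega))
        (by simp [d9]) (by simp [d3]) (by simp) (by simp [d4]) hn (by omega) le_rfl (by omega)
        (by omega) (fun x hx => ?_) (fun x hx => ?_) hmdc
      · rw [Store.set_mem, mF x hx]; exact (b5 x hx).1
      · exact (d5 x hx).1
    simp only [Store.set_mem, Store.set_used]
    rintro s₅ ⟨e1, e2, e3, e4⟩
    have e5 : s₅.env .pc = G + 6 ^ L := by rw [e3 _ (by decide)]; simp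
    have e6 : s₅.env .sz = 6 ^ L := by rw [e3 _ (by decide)]; simp [d4]
    replace e3 : Same productVars s₅ s := (e3.weaken (by decide)).trans
      ((same_set (by decide)).2 d7)
    apply Tot.block_assign
    · simp
    · simp [e5]; omega
    apply Tot.block_cons
    · refine transform_spec coeffC (p := 6) (q := 4) (by norm_num) (by norm_num) (by norm_num)
        (by norm_num) rfl (by decide) (md := modulus wit n) (L := L) (A := G + 6 ^ L) (by omega)
        ?_ ?_ ?_ ?_ (fun x hx => (e1 x hx).1) (by omega) hmdc (by omega) (by omega)
      · simp [e3 .md (by decide), hs.env_md]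
      · simp [e3 .L (by decide), hs.env_L]
      · simp [e5]
      · simp [e6]
    simp only [Store.set_mem, Store.set_used]
    rintro s₆ ⟨C, f1, f2, f3, f4, f5, f6, f7, f8⟩
    replace f7 : Same productVars s₆ s := (f7.weaken hp2).trans ((same_set (by decide)).2 e3)
    refine Tot.block_nil ?_
    refine ⟨C, by omega, by omega, f3, ?_, fun a ha => ?_, f7, ?_⟩
    rotate_left
    · rw [f6 a (by omega), e2 a (by omega), m4 a ha]
    · rw [f8, e4, d8, c4, b8, a4]
    -- What remains is algebra in `ZMod`: `stage_eq` turns the computed vectors into Kronecker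
    -- powers, and `partial_product` evaluates them.
    intro a ha
    refine ⟨(f5 a ha).1, ?_⟩
    rw [(f5 a ha).2]
    rw [stage_eq _ (by norm_num) (by norm_num) _ _ ha]
    rw [← partial_product L a (fun i k => (padded n false α (f i) (g k) : ZMod (modulus wit n)))
      fun k j => (padded n wit β (g k) (h j) : ZMod (modulus wit n))]
    refine Finset.sum_congr rfl fun ε hε => ?_
    have hε := Finset.mem_range.1 hε
    rw [(e1 ε hε).2, mF ε hε, (b5 ε hε).2, (d5 ε hε).2, stage_eq _ (by norm_num) (by norm_num) _ _ hε,
      stage_eq _ (by norm_num) (by norm_num) _ _ hε]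
    congr 2
    · refine Finset.sum_congr rfl fun δ hδ => ?_
      rw [a1 δ (Finset.mem_range.1 hδ)]
    · refine Finset.sum_congr rfl fun δ hδ => ?_
      rw [c1 δ (Finset.mem_range.1 hδ), htab (by omega) (row_lt L δ), htab (by omega) (col_lt L δ),
        hg, hh]
  · have g1 : (L + e + m + 2) * 4 ^ L = (L + m + e + 2) * 4 ^ L := by ring
    rw [g1]
    simp only [Expr.cost]
    clear * - h6L
    generalize (L + m + e + 2) * 4 ^ L = u, 6 ^ L = v at *
    omega

/-- One run of the algorithm. -/
def run (wit : Bool) : Prog := .block [drawMaps, partialProduct wit, extractAll wit]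

def runVars : List Var := [.gb, .hb, .ab, .p, .t] ++ productVars

set_option maxHeartbeats 1000000 in
theorem run_spec {wit : Bool} {n m L e : ℕ} {α β : ℕ → ℕ → ℕ} {s : Store}
    (hs : Ready wit n m L α β s) (hα : ∀ x y, α x y < 2) (hβ : ∀ x y, β x y < 2)
    (he : s.env .e = e) (hn : 0 < n)
    (hw : base wit n + runBits L m e + 40 * 6 ^ L + 2 ^ m * n + 2 ^ e * n < 2 ^ w)
    (hmdc : modulus wit n ≤ 2 ^ c) :
    Tot w c ω (run wit) s (20000 * ((L + m + m + e + 2) * 4 ^ L + 6 ^ L)) fun s' =>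
      Ready wit n m L α β s' ∧
      (∀ x < n, ∀ y < n, s.mem (2 * (n * n) + (x * n + y)) ≠ 0 →
        s'.mem (2 * (n * n) + (x * n + y)) ≠ 0) ∧
      (∀ x < n, ∀ y < n, IsolatesAt ω L m e s.used x y (Witness n α β x y) →
        s'.mem (2 * (n * n) + (x * n + y)) ≠ 0) ∧
      Same runVars s' s ∧ s'.used = s.used + runBits L m e := by
  have h2L : 2 ^ (L + 1) = 2 * 2 ^ L := by ring
  have h24 : 2 ^ L ≤ 4 ^ L := Nat.pow_le_pow_left (by norm_num) L
  have h26 : 2 ^ L ≤ 6 ^ L := Nat.pow_le_pow_left (by norm_num) L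
  have h46 : 4 ^ L ≤ 6 ^ L := Nat.pow_le_pow_left (by norm_num) L
  have h6L : 1 ≤ 6 ^ L := Nat.one_le_pow _ _ (by norm_num)
  have h4L : 1 ≤ 4 ^ L := Nat.one_le_pow _ _ (by norm_num)
  have hb : base wit n = 3 * (n * n) + modulus wit n * modulus wit n := rfl
  have hR : runBits L m e = m * 2 ^ L + e * 2 ^ L + m * 2 ^ L := by unfold runBits; ring
  have hR' : runBits L m e = (m + e) * 2 ^ L + m * 2 ^ L := by unfold runBits; ring
  have hmd := modulus_ge (wit := wit) hn
  have hc : 1 ≤ c := by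
    by_contra h
    obtain rfl : c = 0 := by omega
    simp at hmdc; omega
  unfold run
  apply Tot.le
  · apply Tot.block_cons
    · exact drawMaps_spec hs.env_m he hs.env_d2 hs.env_rb (by omega) hc
    rintro s₁ ⟨a1, a2, a3, a4, a5, a6, a7⟩
    have hs₁ := hs.congr a6 (by decide) a5
    have hbit {x : ℕ} (hx : x < runBits L m e) : s₁.mem (base wit n + x) < 2 := by
      rw [a4 x hx]; exact Bool.toNat_lt _
    apply Tot.block_cons
    · refine partialProduct_spec (U := base wit n + runBits L m e + 40 * 6 ^ L + 2 ^ m * n + 2 ^ e * n)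
        hs₁ _ _ _ rfl rfl rfl hα hβ (by rw [a6 _ (by decide), he]) a1 a2 a3
        (fun x hx => hbit (by omega)) (fun x hx => ?_) (fun x hx => ?_) hn le_rfl ?_ ?_ hw
        (by omega) (by omega) (by omega) hmdc
      · rw [add_assoc]; exact hbit (by omega)
      · rw [add_assoc]; exact hbit (by omega)
      · rw [add_mul]; omega
      · omega
    rintro s₂ ⟨C, b1, b2, b3, b4, b5, b6, b7⟩
    have hs₂ := hs₁.congr b6 (by decide) fun a ha => b5 a (by omega)
    have htab {B : ℕ} (hB : B + m * 2 ^ L ≤ base wit n + runBits L m e) {i : ℕ} (hi : i < 2 ^ L) :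
        tableEntry s₂.mem (2 ^ L) B m i = tableEntry s₁.mem (2 ^ L) B m i :=
      ofBits_congr fun r hr => b5 _ (by have := mul_add_lt_mul hi hr; omega)
    -- The tables in memory are the coins in the order in which they were drawn.
    have hcol {b k i : ℕ} (hb : b + k * 2 ^ L ≤ runBits L m e) (hi : i < 2 ^ L) :
        tableEntry s₁.mem (2 ^ L) (base wit n + b) k i = column ω (2 ^ L) (s.used + b) k i :=
      ofBits_congr fun r hr => by
        have := mul_add_lt_mul hi hr
        rw [show base wit n + b + i + r * 2 ^ L = base wit n + (b + r * 2 ^ L + i) by ring,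
          a4 _ (by omega)]
        congr 2
        ring
    have hX (a : ℕ) : tableEntry s₂.mem (2 ^ L) (base wit n) m (row L a) =
        column ω (2 ^ L) s.used m (row L a) := by
      rw [htab (by omega) (row_lt L a)]
      exact hcol (b := 0) (by omega) (row_lt L a)
    have hY (a : ℕ) : tableEntry s₂.mem (2 ^ L) (base wit n + (m + e) * 2 ^ L) m (col L a) =
        column ω (2 ^ L) (s.used + (m + e) * 2 ^ L) m (col L a) := by
      rw [htab (by omega) (col_lt L a)]
      exact hcol (by omega) (col_lt L a)
    apply Tot.block_cons
    · refine extractAll_spec (wit := wit) (B := base wit n) (H := base wit n + (m + e) * 2 ^ L)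
        (C := C) (U := base wit n + runBits L m e + 40 * 6 ^ L + 2 ^ m * n + 2 ^ e * n) _ _ rfl rfl
        hα hβ hs₂.env_n hs₂.env_nn hs₂.env_m hs₂.env_L hs₂.env_d2 hs₂.env_d4 hs₂.env_rb
        (by rw [b6 _ (by decide), a2]) b3 hs₂.memA hs₂.memB (fun x hx => ?_) (fun x hx => ?_) hn
        (by omega) (by omega) (by omega) hw (by omega) (by omega) b2 (by omega) (by omega) hmdc
        hs₂.valid (fun a ha hXa hYa => ⟨(b4 a ha).1, fun hne => ?_⟩)
      · rw [b5 _ (by omega)]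
        exact hbit (by omega)
      · rw [b5 _ (by omega), add_assoc]
        exact hbit (by omega)
      · refine exists_witness_of_sum_ne_zero hα hβ hXa hYa (b4 a ha).1 hne
          (K := 2 ^ L) (g := tableEntry s₁.mem (2 ^ L) (base wit n + m * 2 ^ L) e)
          (G := fun k => good L (row L a) k (col L a)) ((b4 a ha).2.trans ?_)
        rw [htab (by omega) (row_lt L a), htab (by omega) (col_lt L a)]
    rintro s₃ ⟨c1, c2, c3, c4, c5, c6⟩
    have mem₂ {x y : ℕ} (hx : x < n) (hy : y < n) : s₂.mem (2 * (n * n) + (x * n + y)) =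
        s.mem (2 * (n * n) + (x * n + y)) := by
      have := mul_add_lt_mul hy hx
      rw [b5 _ (by omega), a5 _ (by omega)]
    refine Tot.block_nil ⟨hs₂.congr_valid c5 (by decide) (fun a ha _ => c4 a ha) c1,
      fun x hx y hy hne => c2 x hx y hy (by rwa [mem₂ hx hy]), fun x hx y hy hiso => ?_, ?_, ?_⟩
    · obtain ⟨i, hi, j, hj, rfl, rfl, huniq⟩ := hiso
      -- The isolating position is visited by `extractAll` at its Morton index.
      obtain ⟨a, ha, rfl, rfl⟩ := exists_morton L i j hi hj
      rw [← hX, ← hY] at *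
      refine c3 a ha hx hy ?_
      refine eq_weight_of_isolated hα hβ hx hy (b4 a ha).1
        (K := 2 ^ L) (g := tableEntry s₁.mem (2 ^ L) (base wit n + m * 2 ^ L) e)
        (G := fun k => good L (row L a) k (col L a)) ((b4 a ha).2.trans ?_) ?_
      · rw [htab (by omega) (row_lt L a), htab (by omega) (col_lt L a)]
      · obtain ⟨k, ⟨hk, h1⟩, h2⟩ := huniq
        refine ⟨k, ⟨hk, ?_⟩, fun k' ⟨hk', h'⟩ => h2 k' ⟨hk', ?_⟩⟩
        · rw [hcol (by omega) hk]; exact h1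
        · rwa [hcol (by omega) hk'] at h'
    · exact (c5.weaken (by decide)).trans ((b6.weaken (by decide)).trans (a6.weaken (by decide)))
    · rw [c6, b7, a7]
  · have q1 : (2 * m + e) * 2 ^ L ≤ (2 * m + e) * 4 ^ L := Nat.mul_le_mul_left _ h24
    have q2 : m + e + 1 ≤ (m + e + 1) * 4 ^ L := Nat.le_mul_of_pos_right _ h4L
    rw [show runBits L m e = (2 * m + e) * 2 ^ L from rfl]
    nlinarith

/-! ### Initialization -/

/-- Compute the number `m` of binary digits of an index. -/
def initDigits : Prog := .block [
  .assign .m (.lit 0), .assign .N (.lit 1),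
  .whileLt .N .n (.block [
    .assign .N (.add (.var .N) (.var .N)), .assign .m (.add (.var .m) (.lit 1))])]

theorem initDigits_spec {s : Store} {n : ℕ} (hn : s.env .n = n) (hw : 2 ^ Nat.clog 2 n < 2 ^ w)
    (h1w : 1 < 2 ^ w) :
    Tot w c ω initDigits s (20 * (Nat.clog 2 n + 1)) fun s' => s'.env .m = Nat.clog 2 n ∧
      Same [.m, .N] s' s ∧ s'.mem = s.mem ∧ s'.used = s.used := by
  set m := Nat.clog 2 n
  have hm : m < 2 ^ m := Nat.lt_two_pow_self
  unfold initDigits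
  apply Tot.le
  · apply Tot.block_assign
    · simp
    · simp
    apply Tot.block_assign
    · simp [h1w]
    · simp [h1w]
    apply Tot.block_cons
    · refine Tot.whileLt (N := m) (T := 10) (I := fun r s' => s'.env .m = r ∧ s'.env .N = 2 ^ r ∧
        Same [.m, .N] s' s ∧ s'.mem = s.mem ∧ s'.used = s.used) ?_ ?_ ?_
      · simp
      · rintro r s' hr ⟨h1, h2, h3, h4, h5⟩
        have hr1 : 2 ^ (r + 1) ≤ 2 ^ m := Nat.pow_le_pow_right (by norm_num) hr
        rw [pow_succ] at hr1
        have hlt : 2 ^ r < n := Nat.pow_lt_of_lt_clog hr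
        refine ⟨by rw [h2, h3 _ (by decide), hn]; exact hlt, ?_⟩
        apply Tot.le
        · apply Tot.block_assign
          · simp [h2]; omega
          · simp [h2]; omega
          apply Tot.block_assign
          · simp [h1, h1w]; omega
          · simp [h1]; omega
          refine Tot.block_nil ?_
          simp only [Expr.eval, Store.set_env, Store.set_mem, Store.set_used, h1, h2, h4, h5,
            reduceCtorEq, if_true, if_false, true_and, and_true]
          exact ⟨by rw [pow_succ]; ring, by simpa using h3⟩
        · simp
      · rintro s' ⟨h1, h2, h3, h4, h5⟩
        rw [h2, h3 _ (by decide), hn]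
        exact (Nat.le_pow_clog (by norm_num) n).not_gt
    · rintro s' ⟨h1, h2, h3, h4, h5⟩
      exact Tot.block_nil ⟨h1, h3, h4, h5⟩
  · simp; omega

/-- Compute the exponent `L` of the Kronecker power, and `2 ^ L` and `4 ^ L`. -/
def initDepth : Prog := .block [
  .assign .X (.var .m),
  .forLt .c .m (.block [
    .assign .X (.add (.var .X) (.var .X)), .assign .X (.add (.var .X) (.var .X)),
    .assign .X (.add (.var .X) (.var .X))]),
  .assign .L (.lit 0), .assign .P (.lit 1), .assign .d2 (.lit 1), .assign .d4 (.lit 1),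
  .whileLt .P .X (.block [
    .assign .t (.add (.var .P) (.add (.var .P) (.var .P))),
    .assign .P (.add (.var .P) (.add (.var .t) (.var .t))),
    .assign .d2 (.add (.var .d2) (.var .d2)),
    .assign .d4 (.add (.var .d4) (.var .d4)), .assign .d4 (.add (.var .d4) (.var .d4)),
    .assign .L (.add (.var .L) (.lit 1))])]

theorem initDepth_spec {s : Store} {m : ℕ} (hm : s.env .m = m) (hw : 7 ^ depth m < 2 ^ w)
    (h1w : 1 < 2 ^ w) (hmX : m * 8 ^ m < 2 ^ w) :
    Tot w c ω initDepth s (50 * (m + depth m + 1)) fun s' => s'.env .L = depth m ∧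
      s'.env .d2 = 2 ^ depth m ∧ s'.env .d4 = 4 ^ depth m ∧
      Same [.X, .c, .L, .P, .d2, .d4, .t] s' s ∧ s'.mem = s.mem ∧ s'.used = s.used := by
  set L := depth m with hL
  have hL7 : L < 7 ^ L := Nat.lt_pow_self (by norm_num)
  have h8m : 1 ≤ 8 ^ m := Nat.one_le_pow _ _ (by norm_num)
  have hm8 : m ≤ m * 8 ^ m := Nat.le_mul_of_pos_right _ h8m
  unfold initDepth
  apply Tot.le
  · apply Tot.block_assign
    · simp
    · simp [hm]; omega
    apply Tot.block_cons
    · refine Tot.forLt (N := m) (T := 15) (I := fun r s' => s'.env .X = m * 8 ^ r ∧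
        Same [.X, .c, .L, .P, .d2, .d4, .t] s' s ∧ s'.mem = s.mem ∧ s'.used = s.used) (by decide)
        (by simp [hm]) (by omega) ?_ ?_
      · simp [hm]
      · rintro r s' hr hc hm' ⟨h1, h2, h3, h4⟩
        have hr1 : 8 ^ (r + 1) ≤ 8 ^ m := Nat.pow_le_pow_right (by norm_num) hr
        have hr2 : m * 8 ^ (r + 1) ≤ m * 8 ^ m := Nat.mul_le_mul_left _ hr1
        rw [show m * 8 ^ (r + 1) = 8 * (m * 8 ^ r) by ring] at hr2
        apply Tot.le
        · apply Tot.block_assign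
          · simp [h1]; omega
          · simp [h1]; omega
          apply Tot.block_assign
          · simp [h1]; omega
          · simp [h1]; omega
          apply Tot.block_assign
          · simp [h1]; omega
          · simp [h1]; omega
          refine Tot.block_nil ?_
          simp only [Expr.eval, Store.set_env, Store.set_mem, Store.set_used, h1, hc, hm', h3, h4,
            reduceCtorEq, if_true, if_false, true_and, and_true]
          exact ⟨by ring, by simpa using h2⟩
        · simp
    rintro s₁ ⟨-, -, a1, a2, a3, a4⟩
    apply Tot.block_assign
    · simp
    · simp
    apply Tot.block_assign
    · simp [h1w]
    · simp [h1w]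
    apply Tot.block_assign
    · simp [h1w]
    · simp [h1w]
    apply Tot.block_assign
    · simp [h1w]
    · simp [h1w]
    apply Tot.block_cons
    -- The loop stops at the least `r` with `7 ^ r ≥ m * 8 ^ m`, which is `depth m`; the factor 7 is
    -- obtained as `P + 2 * (3 * P)`.
    · refine Tot.whileLt (N := L) (T := 40) (I := fun r s' => s'.env .L = r ∧ s'.env .P = 7 ^ r ∧
        s'.env .d2 = 2 ^ r ∧ s'.env .d4 = 4 ^ r ∧ s'.env .X = m * 8 ^ m ∧
        Same [.X, .c, .L, .P, .d2, .d4, .t] s' s ∧ s'.mem = s.mem ∧ s'.used = s.used) ?_ ?_ ?_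
      · simp [a1, a3, a4]
        exact a2
      · rintro r s' hr ⟨h1, h2, h3, h4, h5, h6, h7, h8⟩
        have hr1 : 7 ^ (r + 1) ≤ 7 ^ L := Nat.pow_le_pow_right (by norm_num) hr
        rw [pow_succ] at hr1
        have h27 : 2 ^ r ≤ 7 ^ r := Nat.pow_le_pow_left (by norm_num) r
        have h47 : 4 ^ r ≤ 7 ^ r := Nat.pow_le_pow_left (by norm_num) r
        have hlt : 7 ^ r < m * 8 ^ m := Nat.pow_lt_of_lt_clog hr
        refine ⟨by rw [h2, h5]; exact hlt, ?_⟩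
        apply Tot.le
        · apply Tot.block_assign
          · simp [h2]; omega
          · simp [h2]; omega
          apply Tot.block_assign
          · simp [h2]; omega
          · simp [h2]; omega
          apply Tot.block_assign
          · simp [h3]; omega
          · simp [h3]; omega
          apply Tot.block_assign
          · simp [h4]; omega
          · simp [h4]; omega
          apply Tot.block_assign
          · simp [h4]; omega
          · simp [h4]; omega
          apply Tot.block_assign
          · simp [h1, h1w]; omega
          · simp [h1]; omega
          refine Tot.block_nil ?_
          simp only [Expr.eval, Store.set_env, Store.set_mem, Store.set_used, h1, h2, h3, h4, h5,
            h7, h8, reduceCtorEq, if_true, if_false, true_and, and_true]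
          exact ⟨by ring, by ring, by ring, by simpa using h6⟩
        · simp
      · rintro s' ⟨h1, h2, h3, h4, h5, h6, h7, h8⟩
        rw [h2, h5]
        exact (le_pow_depth m).not_gt
    · rintro s' ⟨h1, h2, h3, h4, h5, h6, h7, h8⟩
      exact Tot.block_nil ⟨h1, h3, h4, h6, h7, h8⟩
  · simp; omega

/-- Set `v` to the square of `u`. -/
def square (v u : Var) : Prog := .block [
  .assign v (.lit 0), .forLt .c u (.assign v (.add (.var v) (.var u)))]

theorem square_spec {v u : Var} (huv : u ≠ v ∧ u ≠ .c ∧ v ≠ .c) {s : Store} {k : ℕ}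
    (hu : s.env u = k) (hw : k * k < 2 ^ w) :
    Tot w c ω (square v u) s (20 * (k + 1)) fun s' => s'.env v = k * k ∧
      Same [v, .c] s' s ∧ s'.mem = s.mem ∧ s'.used = s.used := by
  obtain ⟨huv, huc, hvc⟩ := huv
  have hk : k ≤ k * k := Nat.le_mul_self k
  unfold square
  apply Tot.le
  · apply Tot.block_assign
    · simp
    · simp
    apply Tot.block_cons
    · refine Tot.forLt (N := k) (T := 5) (I := fun r s' => s'.env v = r * k ∧
        Same [v, .c] s' s ∧ s'.mem = s.mem ∧ s'.used = s.used) huc.symm (by simp [huv, hu])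
        (by omega) ?_ ?_
      · simp [hvc]
      · rintro r s' hr hc hu' ⟨h1, h2, h3, h4⟩
        have hle : r * k + k ≤ k * k := by
          have := Nat.mul_le_mul_right k hr
          rwa [Nat.succ_mul] at this
        refine (Tot.assign ?_ ?_ ?_).le (show _ ≤ 5 by simp)
        · simp [h1, hu']; omega
        · simp [h1, hu']; omega
        · simp only [Expr.eval, Store.set_env, Store.set_mem, Store.set_used, h1, hc, hu', hvc,
            huv, hvc.symm, if_true, if_false, h3, h4, true_and, and_true]
          exact ⟨by ring, by simpa using h2⟩
    · rintro s' ⟨-, -, h1, h2, h3, h4⟩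
      exact Tot.block_nil ⟨h1, h2, h3, h4⟩
  · simp; omega

/-- Write the table of remainders. -/
def initTable : Prog := .block [
  .assign .v (.lit 0),
  .forLt .a .mm (.block [
    .put (.add (.var .tb) (.var .a)) (.var .v), .assign .v (.add (.var .v) (.lit 1)),
    .assignIf (.var .md) (.add (.var .v) (.lit 1)) .v (.sub (.var .v) (.var .md))])]

theorem initTable_spec {s : Store} {md mm B : ℕ} (hmd : s.env .md = md) (hmm : s.env .mm = mm)
    (hB : s.env .tb = B) (hmd0 : 0 < md) (hw : B + mm < 2 ^ w) (hmdw : md + 1 < 2 ^ w)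
    (hmdc : md ≤ 2 ^ c) :
    Tot w c ω initTable s (40 * (mm + 1)) fun s' =>
      (∀ v < mm, s'.mem (B + v) = v % md) ∧ (∀ a, a < B ∨ B + mm ≤ a → s'.mem a = s.mem a) ∧
      Same [.v, .a] s' s ∧ s'.used = s.used := by
  have h1w : 1 < 2 ^ w := by omega
  unfold initTable
  apply Tot.le
  · apply Tot.block_assign
    · simp
    · simp
    apply Tot.block_cons
    · refine Tot.forLt (N := mm) (T := 30) (I := fun r s' => s'.env .v = r % md ∧
        (∀ v < r, s'.mem (B + v) = v % md) ∧ (∀ a, a < B ∨ B + mm ≤ a → s'.mem a = s.mem a) ∧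
        Same [.v, .a] s' s ∧ s'.used = s.used) (by decide) (by simp [hmm]) (by omega) ?_ ?_
      · simp
      · rintro r s' hr ha hmm' ⟨h1, h2, h3, h4, h5⟩
        have e1 : s'.env .tb = B := by rw [h4 _ (by decide), hB]
        have e2 : s'.env .md = md := by rw [h4 _ (by decide), hmd]
        have hlt := Nat.mod_lt r hmd0
        -- Successive remainders differ by 1 except when `md` is reached, so one conditional
        -- subtraction maintains them.
        have hstep : (r + 1) % md = if md < r % md + 1 + 1 then r % md + 1 - md else r % md + 1 := by
          have h0 : (r + 1) % md = (r % md + 1) % md := by rw [Nat.mod_add_mod]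
          rw [h0]
          split_ifs with h
          · rw [show r % md + 1 = md by omega]; simp
          · exact Nat.mod_eq_of_lt (by omega)
        rw [hstep]
        generalize hρ : r % md = ρ at *
        apply Tot.le
        · apply Tot.block_put
          · simp [e1, ha]; omega
          · simp
          · simp [h1]; omega
          apply Tot.block_assign
          · simp [h1, h1w]; omega
          · simp [h1]; omega
          apply Tot.block_assignIf
          · simp
          · simp [h1, h1w]; omega
          · simp [h1, e2]; omega
          refine Tot.block_nil ?_
          simp only [Expr.eval, Store.put_env, Store.put_mem, Store.put_used, Store.set_env,
            Store.set_mem, Store.set_used, h1, e1, e2, ha, hmm', h5,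
            reduceCtorEq, if_true, if_false, true_and, and_true]
          refine ⟨fun v hv => ?_, fun a ha' => ?_, by simpa using h4⟩
          · split_ifs with h
            · rw [show v = r by omega, hρ]
            · exact h2 v (by omega)
          · rw [if_neg (by omega), h3 a ha']
        · simp
    · rintro s' ⟨-, -, -, h2, h3, h4, h5⟩
      exact Tot.block_nil ⟨h2, h3, h4, h5⟩
  · simp; omega

/-- Initialize all variables, and write the table of remainders. -/
def setup (wit : Bool) : Prog := .block [
  initDigits, initDepth, square .nn .n,
  .assign .md (if wit then .add (.var .n) (.lit 1) else .lit 2),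
  square .mm .md, .assign .tb (.add (.var .nn) (.add (.var .nn) (.var .nn))),
  .assign .rb (.add (.var .tb) (.var .mm)), initTable]

theorem setup_spec {wit : Bool} {n : ℕ} {α β : ℕ → ℕ → ℕ} {s : Store} (hn : s.env .n = n)
    (hn0 : 0 < n)
    (hmA : ∀ x < n, ∀ y < n, s.mem (x * n + y) = α x y)
    (hmB : ∀ x < n, ∀ y < n, s.mem (n * n + (x * n + y)) = β x y)
    (hout : ∀ x < n, ∀ y < n, s.mem (2 * (n * n) + (x * n + y)) = 0)
    (hw₁ : 2 ^ Nat.clog 2 n < 2 ^ w) (hw₂ : 7 ^ depth (Nat.clog 2 n) < 2 ^ w)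
    (hw₃ : Nat.clog 2 n * 8 ^ Nat.clog 2 n < 2 ^ w) (hw₄ : base wit n < 2 ^ w)
    (hmdc : modulus wit n ≤ 2 ^ c) :
    Tot w c ω (setup wit) s
      (200 * (Nat.clog 2 n + depth (Nat.clog 2 n) + n + base wit n + 1)) fun s' =>
      Ready wit n (Nat.clog 2 n) (depth (Nat.clog 2 n)) α β s' ∧ s'.used = s.used := by
  have hb : base wit n = 3 * (n * n) + modulus wit n * modulus wit n := rfl
  have hmd := modulus_ge (wit := wit) hn0
  have hmd2 : 2 * modulus wit n ≤ modulus wit n * modulus wit n := Nat.mul_le_mul_right _ hmd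
  have h1w : 1 < 2 ^ w := by omega
  set m := Nat.clog 2 n
  unfold setup
  apply Tot.le
  · apply Tot.block_cons (initDigits_spec hn hw₁ h1w)
    rintro s₁ ⟨a1, a2, a3, a4⟩
    apply Tot.block_cons (initDepth_spec a1 hw₂ h1w hw₃)
    rintro s₂ ⟨b1, b2, b3, b4, b5, b6⟩
    have hn₂ : s₂.env .n = n := by rw [b4 _ (by decide), a2 _ (by decide), hn]
    apply Tot.block_cons (square_spec (by decide) hn₂ (by omega))
    rintro s₃ ⟨c1, c2, c3, c4⟩
    have hn₃ : s₃.env .n = n := by rw [c2 _ (by decide), hn₂]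
    have hval : Expr.eval s₃ (if wit then .add (.var .n) (.lit 1) else .lit 2) = modulus wit n := by
      cases wit <;> simp [modulus, hn₃]
    have hok : Expr.ok w c s₃ (if wit then .add (.var .n) (.lit 1) else .lit 2) := by
      cases wit
      · simp only [Bool.false_eq_true, if_false, Expr.ok]; omega
      · simp only [modulus, if_true] at hmd2 hb
        simp [h1w, hn₃]; omega
    apply Tot.block_assign hok (by rw [hval]; omega)
    rw [hval]
    apply Tot.block_cons (square_spec (k := modulus wit n) (by decide) (by simp) (by omega))
    rintro s₄ ⟨d1, d2, d3, d4⟩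
    have d5 : s₄.env .md = modulus wit n := by rw [d2 _ (by decide)]; simp
    have d6 : s₄.env .nn = n * n := by rw [d2 _ (by decide)]; simp [c1]
    have d7 : 3 * (n * n) = n * n + (n * n + n * n) := by ring
    apply Tot.block_assign
    · simp [d6]; omega
    · simp [d6]; omega
    simp only [Expr.eval, d6, ← d7]
    apply Tot.block_assign
    · simp [d1]; omega
    · simp [d1]; omega
    simp only [Expr.eval, Store.set_env, reduceCtorEq, if_true, if_false, d1, ← hb]
    apply Tot.block_cons (initTable_spec (md := modulus wit n) (mm := modulus wit n * modulus wit n)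
      (B := 3 * (n * n)) (by simp [d5]) (by simp [d1]) (by simp) (by omega) (by omega) (by omega)
      hmdc)
    simp only [Store.set_mem, Store.set_used] at d3 d4 ⊢
    rintro s₅ ⟨e1, e2, e3, e4⟩
    have hmem {a : ℕ} (ha : a < 3 * (n * n)) : s₅.mem a = s.mem a := by
      rw [e2 _ (.inl ha), d3, c3, b5, a3]
    have houtz {x y : ℕ} (hx : x < n) (hy : y < n) : s₅.mem (2 * (n * n) + (x * n + y)) = 0 := by
      have := mul_add_lt_mul hy hx
      rw [hmem (by omega), hout x hx y hy]
    refine Tot.block_nil ⟨?_, by rw [e4, d4, c4, b6, a4]⟩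
    refine
      { env_n := ?_, env_m := ?_, env_L := ?_, env_d2 := ?_, env_d4 := ?_, env_nn := ?_,
        env_md := ?_, env_tb := ?_, env_rb := ?_, memA := fun x hx y hy => ?_,
        memB := fun x hx y hy => ?_, table := e1,
        valid := fun x hx y hy h => absurd (houtz hx hy) h }
    · rw [e3 _ (by decide)]; simp [d2 .n (by decide), hn₃]
    · rw [e3 _ (by decide)]
      simp [d2 .m (by decide), c2 .m (by decide), b4 .m (by decide), a1, m]
    · rw [e3 _ (by decide)]; simp [d2 .L (by decide), c2 .L (by decide), b1, m]
    · rw [e3 _ (by decide)]; simp [d2 .d2 (by decide), c2 .d2 (by decide), b2, m]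
    · rw [e3 _ (by decide)]; simp [d2 .d4 (by decide), c2 .d4 (by decide), b3, m]
    · rw [e3 _ (by decide)]; simp [d6]
    · rw [e3 _ (by decide)]; simp [d5]
    · rw [e3 _ (by decide)]; simp
    · rw [e3 _ (by decide)]; simp
    · have := mul_add_lt_mul hy hx
      rw [hmem (by omega), hmA x hx y hy]
    · have := mul_add_lt_mul hy hx
      rw [hmem (by omega), hmB x hx y hy]
  · have hcost : Expr.cost (if wit then .add (.var .n) (.lit 1) else .lit 2) ≤ 4 := by
      cases wit <;> simp
    have hm' : Nat.clog 2 n = m := rfl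
    simp only [Expr.cost, hm']
    clear * - hcost hmd2 hb
    generalize modulus wit n * modulus wit n = u at *
    generalize n * n = v at *
    omega

/-! ### The search for witnesses -/

/-- The position of the random bits for the `k`-th scale. -/
def offset (L m b R k : ℕ) : ℕ := ∑ j ∈ Finset.range k, R * runBits L m (m + j * b)

/-- The main loop: `R` runs for each of 64 scales. -/
def search (wit : Bool) (R : ℕ) : Prog := .block [
  .assign .step (.half (.half (.half (.half (.half (.half (.var .m))))))),
  .assign .step (.add (.var .step) (.lit 1)),
  .assign .e (.var .m), .assign .cnt (.lit 64), .assign .rp (.lit R),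
  .forLt .s .cnt (.block [
    .forLt .r .rp (run wit), .assign .e (.add (.var .e) (.var .step))])]

/-- `offset` counts the coins used before a scale, so no run reuses coins. The claim is
deterministic: whatever the coins are, each entry isolated in some run is nonzero at the end. -/
theorem search_spec {wit : Bool} {n m L R : ℕ} {α β : ℕ → ℕ → ℕ} {s : Store}
    (hs : Ready wit n m L α β s) (hused : s.used = 0)
    (hα : ∀ x y, α x y < 2) (hβ : ∀ x y, β x y < 2) (hn : 0 < n)
    (hw : base wit n + runBits L m (m + 64 * stepSize m) + 40 * 6 ^ L + 2 ^ m * n +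
      2 ^ (m + 64 * stepSize m) * n < 2 ^ w) (hRw : R + 64 < 2 ^ w)
    (hmdc : modulus wit n ≤ 2 ^ c) :
    Tot w c ω (search wit R) s (64 * (R * (20000 *
        ((L + m + m + (m + 64 * stepSize m) + 2) * 4 ^ L + 6 ^ L) + 5) + 15) + 50) fun s' =>
      Valid wit n α β s'.mem ∧ ∀ k < 64, ∀ r < R, ∀ x < n, ∀ y < n,
        IsolatesAt ω L m (m + k * stepSize m)
          (offset L m (stepSize m) R k + r * runBits L m (m + k * stepSize m)) x y
          (Witness n α β x y) → s'.mem (2 * (n * n) + (x * n + y)) ≠ 0 := by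
  set b := stepSize m with hb
  have hmn : 2 ^ m ≤ 2 ^ m * n := Nat.le_mul_of_pos_right _ hn
  have hmm : m < 2 ^ m := Nat.lt_two_pow_self
  have hen : 2 ^ (m + 64 * b) ≤ 2 ^ (m + 64 * b) * n := Nat.le_mul_of_pos_right _ hn
  have hee : m + 64 * b < 2 ^ (m + 64 * b) := Nat.lt_two_pow_self
  have h1w : 1 < 2 ^ w := by omega
  -- Six halvings divide by 64.
  have hstep : m / 2 / 2 / 2 / 2 / 2 / 2 + 1 = b := by rw [hb, stepSize]; omega
  have hgl {s' s'' : Store} {l : List Var} (h : Ready wit n m L α β s') (hS : Same l s'' s')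
    (hl : ∀ u ∈ globals, u ∉ l) (hm : s''.mem = s'.mem) : Ready wit n m L α β s'' :=
      h.congr hS hl fun a _ => by rw [hm]
  unfold search
  apply Tot.le
  · apply Tot.block_assign
    · simp [hs.env_m]; omega
    · simp [hs.env_m]; omega
    apply Tot.block_assign
    · simp [hs.env_m, h1w]; omega
    · simp [hs.env_m]; omega
    simp only [Expr.eval, Store.set_env, if_true, hs.env_m, hstep]
    apply Tot.block_assign
    · simp
    · simp [hs.env_m]; omega
    apply Tot.block_assign
    · simp; omega
    · simp; omega
    apply Tot.block_assign
    · simp; omega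
    · simp; omega
    simp only [Expr.eval, Store.set_env, reduceCtorEq, if_false, hs.env_m]
    apply Tot.block_cons
    · refine Tot.forLt (N := 64) (T := R * (20000 * ((L + m + m + (m + 64 * b) + 2) * 4 ^ L +
          6 ^ L) + 5) + 8)
        (I := fun k s' => Ready wit n m L α β s' ∧ s'.env .e = m + k * b ∧ s'.env .step = b ∧
          s'.env .rp = R ∧ s'.used = offset L m b R k ∧ ∀ k' < k, ∀ r < R, ∀ x < n, ∀ y < n,
          IsolatesAt ω L m (m + k' * b) (offset L m b R k' + r * runBits L m (m + k' * b)) x y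
            (Witness n α β x y) → s'.mem (2 * (n * n) + (x * n + y)) ≠ 0)
        (by decide) (by simp) (by omega) ?_ ?_
      · refine ⟨hgl (l := [.s, .rp, .cnt, .e, .step]) hs ?_ (by decide) (by simp), ?_⟩
        · simp
        · simp [offset, hused]
      · rintro k s₁ hk hsk hcnt ⟨a1, a2, a3, a4, a5, a6⟩
        have hkb : k * b ≤ 64 * b := Nat.mul_le_mul_right _ hk.le
        have hkb' : k * b + b ≤ 64 * b := by
          have := Nat.mul_le_mul_right b hk
          rwa [Nat.succ_mul] at this
        have hrun : runBits L m (m + k * b) ≤ runBits L m (m + 64 * b) := by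
          unfold runBits
          exact Nat.mul_le_mul_right _ (by omega)
        have hpow : 2 ^ (m + k * b) * n ≤ 2 ^ (m + 64 * b) * n :=
          Nat.mul_le_mul_right _ (Nat.pow_le_pow_right (by norm_num) (by omega))
        have htime : 20000 * ((L + m + m + (m + k * b) + 2) * 4 ^ L + 6 ^ L) ≤
            20000 * ((L + m + m + (m + 64 * b) + 2) * 4 ^ L + 6 ^ L) := by
          gcongr
        have hoff : offset L m b R (k + 1) = offset L m b R k + R * runBits L m (m + k * b) :=
          Finset.sum_range_succ _ _
        apply Tot.le
        · apply Tot.block_cons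
          · refine Tot.forLt (N := R)
              (T := 20000 * ((L + m + m + (m + k * b) + 2) * 4 ^ L + 6 ^ L))
              (I := fun r s' => Ready wit n m L α β s' ∧ s'.env .e = m + k * b ∧ s'.env .step = b ∧
                s'.env .s = k ∧ s'.env .cnt = 64 ∧
                s'.used = offset L m b R k + r * runBits L m (m + k * b) ∧
                (∀ k' < k, ∀ r < R, ∀ x < n, ∀ y < n, IsolatesAt ω L m (m + k' * b)
                  (offset L m b R k' + r * runBits L m (m + k' * b)) x y (Witness n α β x y) →
                  s'.mem (2 * (n * n) + (x * n + y)) ≠ 0) ∧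
                ∀ r' < r, ∀ x < n, ∀ y < n, IsolatesAt ω L m (m + k * b)
                  (offset L m b R k + r' * runBits L m (m + k * b)) x y (Witness n α β x y) →
                  s'.mem (2 * (n * n) + (x * n + y)) ≠ 0) (by decide) a4 (by omega) ?_ ?_
            · refine ⟨hgl (l := [.r]) a1 (by simp) (by decide) (by simp), ?_⟩
              simp [a2, a3, a5, hsk, hcnt]
              exact a6
            · rintro r s₂ hr hrr hrp ⟨b1, b2, b3, b4, b5, b6, b7, b8⟩
              refine (run_spec b1 hα hβ b2 hn (by omega) hmdc).mono le_rfl ?_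
              rintro s₃ ⟨c1, c2, c3, c4, c5⟩
              refine ⟨by rw [c4 _ (by decide), hrr], by rw [c4 _ (by decide), hrp],
                hgl (l := [.r]) c1 (by simp) (by decide) (by simp), ?_, ?_, ?_, ?_, ?_, ?_, ?_⟩
              · simp [c4 .e (by decide), b2]
              · simp [c4 .step (by decide), b3]
              · simp [c4 .s (by decide), b4]
              · simp [c4 .cnt (by decide), b5]
              · simp [c5, b6]; ring
              · intro k' hk' r' hr' x hx y hy h
                exact c2 x hx y hy (b7 k' hk' r' hr' x hx y hy h)
              · intro r' hr' x hx y hy h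
                rcases Nat.lt_succ_iff_lt_or_eq.1 hr' with h' | rfl
                · exact c2 x hx y hy (b8 r' h' x hx y hy h)
                · exact c3 x hx y hy (by rw [b6]; exact h)
          · rintro s₂ ⟨-, hrp, b1, b2, b3, b4, b5, b6, b7, b8⟩
            apply Tot.block_assign
            · simp [b2, b3]; omega
            · simp [b2, b3]; omega
            refine Tot.block_nil ⟨by simp [b4], by simp [b5],
              hgl (l := [.s, .e]) b1 (by simp) (by decide) (by simp), ?_, ?_, ?_, ?_, ?_⟩
            · simp [b2, b3]; ring
            · simp [b3]
            · simp [hrp]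
            · simp [b6, hoff]
            · intro k' hk' r' hr' x hx y hy h
              rcases Nat.lt_succ_iff_lt_or_eq.1 hk' with h' | rfl
              · exact b7 k' h' r' hr' x hx y hy h
              · exact b8 r' hr' x hx y hy h
        · have := Nat.mul_le_mul_left R (Nat.add_le_add_right htime 5)
          simp only [Expr.cost]
          omega
    · rintro s' ⟨-, -, h1, -, -, -, -, h2⟩
      exact Tot.block_nil ⟨h1.valid, h2⟩
  · simp only [Expr.cost]
    clear * -
    generalize R * (20000 * ((L + m + m + (m + 64 * b) + 2) * 4 ^ L + 6 ^ L) + 5) = u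
    omega

/-! ### The program -/

def program (wit : Bool) (R : ℕ) : Prog := .block [setup wit, search wit R]

/-- The entries of a Boolean matrix as numbers. -/
def bit {n : ℕ} (A : Matrix (Fin n) (Fin n) Bool) (x y : ℕ) : ℕ :=
  if h : x < n ∧ y < n then (A ⟨x, h.1⟩ ⟨y, h.2⟩).toNat else 0

/-! ### The encoding of the input -/

section Input
variable {n : ℕ} (A B : Matrix (Fin n) (Fin n) Bool)

theorem bit_lt (x y : ℕ) : bit A x y < 2 := by
  unfold bit
  split_ifs
  · exact Bool.toNat_lt _
  · norm_num

theorem bit_eq_one_iff {x y : ℕ} (hx : x < n) (hy : y < n) :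
    bit A x y = 1 ↔ A ⟨x, hx⟩ ⟨y, hy⟩ = true := by
  simp [bit, hx, hy]

theorem ite_eq_bit {x y : ℕ} {P : Prop} [Decidable P] (hx : x < n) (hy : y < n)
    (h : P ↔ A ⟨x, hx⟩ ⟨y, hy⟩ = true) : (if P then 1 else 0) = bit A x y := by
  rw [bit, dif_pos ⟨hx, hy⟩]
  split_ifs with hP
  · simp [h.1 hP]
  · rw [h, Bool.not_eq_true] at hP
    simp [hP]

open Classical in
theorem inputState_mem_left {x y : ℕ} (hx : x < n) (hy : y < n) :
    (inputState A B).mem (x * n + y) = bit A x y := by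
  refine ite_eq_bit A hx hy ⟨?_, fun h => .inl ⟨⟨x, hx⟩, ⟨y, hy⟩, rfl, h⟩⟩
  have h1 := mul_add_lt_mul hy hx
  rintro (⟨i, j, h, hA⟩ | ⟨i, j, h, -⟩)
  · obtain ⟨rfl, rfl⟩ := mul_add_inj hy j.2 h
    exact hA
  · omega

open Classical in
theorem inputState_mem_right {x y : ℕ} (hx : x < n) (hy : y < n) :
    (inputState A B).mem (n * n + (x * n + y)) = bit B x y := by
  refine ite_eq_bit B hx hy ⟨?_, fun h => .inr ⟨⟨x, hx⟩, ⟨y, hy⟩, (add_assoc _ _ _).symm, h⟩⟩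
  rintro (⟨i, j, h, -⟩ | ⟨i, j, h, hB⟩)
  · have := mul_add_lt_mul j.2 i.2
    omega
  · rw [add_assoc] at h
    obtain ⟨rfl, rfl⟩ := mul_add_inj hy j.2 (Nat.add_left_cancel h)
    exact hB

theorem inputState_mem_out (x y : ℕ) : (inputState A B).mem (2 * (n * n) + (x * n + y)) = 0 := by
  refine if_neg ?_
  rintro (⟨i, j, h, -⟩ | ⟨i, j, h, -⟩)
  · have := mul_add_lt_mul j.2 i.2
    omega
  · have := mul_add_lt_mul j.2 i.2
    omega

/-- The store for the initial state. -/
noncomputable def inputStore : Store where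
  env v := if v = .n then n else 0
  mem := (inputState A B).mem
  used := 0

theorem rep_inputStore : Rep (inputState A B) (inputStore A B) := by
  refine ⟨fun v => ?_, rfl, rfl⟩
  cases v <;> rfl

end Input

/-- The running time of the program. -/
def runTime (wit : Bool) (R n m L : ℕ) : ℕ :=
  200 * (m + L + n + base wit n + 1) + (64 * (R * (20000 *
    ((L + m + m + (m + 64 * stepSize m) + 2) * 4 ^ L + 6 ^ L) + 5) + 15) + 50)

/-- All numbers that occur fit into words of length `w`. -/
def WideEnough (wit : Bool) (R n m L w : ℕ) : Prop :=
  2 ^ m < 2 ^ w ∧ 7 ^ L < 2 ^ w ∧ m * 8 ^ m < 2 ^ w ∧ R + 64 < 2 ^ w ∧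
  base wit n + runBits L m (m + 64 * stepSize m) + 40 * 6 ^ L + 2 ^ m * n +
    2 ^ (m + 64 * stepSize m) * n < 2 ^ w

/-- Each entry that has a witness is isolated in one of the runs. -/
def AllIsolated (ω : ℕ → Bool) (R n m L : ℕ) (α β : ℕ → ℕ → ℕ) : Prop :=
  ∀ x < n, ∀ y < n, (∃ z, Witness n α β x y z) → ∃ k < 64, ∃ r < R,
    IsolatesAt ω L m (m + k * stepSize m)
      (offset L m (stepSize m) R k + r * runBits L m (m + k * stepSize m)) x y (Witness n α β x y)

/-- Randomness enters only through `hω`, a property of the coins alone; the rest of the analysis is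
worst-case. -/
theorem program_spec {wit : Bool} {R n : ℕ} (A B : Matrix (Fin n) (Fin n) Bool) (hn : 0 < n)
    (hw : WideEnough wit R n (Nat.clog 2 n) (depth (Nat.clog 2 n)) w)
    (hmdc : modulus wit n ≤ 2 ^ c)
    (hω : AllIsolated ω R n (Nat.clog 2 n) (depth (Nat.clog 2 n)) (bit A) (bit B)) :
    ∃ t τ, Exec w c ω (program wit R) (inputState A B) t τ ∧
      t ≤ runTime wit R n (Nat.clog 2 n) (depth (Nat.clog 2 n)) ∧
      Valid wit n (bit A) (bit B) τ.mem ∧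
      ∀ x < n, ∀ y < n, (∃ z, Witness n (bit A) (bit B) x y z) →
        τ.mem (2 * (n * n) + (x * n + y)) ≠ 0 := by
  obtain ⟨h1, h2, h3, h4, h5⟩ := hw
  have key : Tot w c ω (program wit R) (inputStore A B)
      (runTime wit R n (Nat.clog 2 n) (depth (Nat.clog 2 n))) fun s' =>
      Valid wit n (bit A) (bit B) s'.mem ∧
      ∀ x < n, ∀ y < n, (∃ z, Witness n (bit A) (bit B) x y z) →
        s'.mem (2 * (n * n) + (x * n + y)) ≠ 0 := by
    unfold program
    apply Tot.le
    · apply Tot.block_cons (setup_spec (wit := wit) (n := n) (α := bit A) (β := bit B)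
        (s := inputStore A B) rfl hn
        (fun x hx y hy => inputState_mem_left A B hx hy)
        (fun x hx y hy => inputState_mem_right A B hx hy)
        (fun x _ y _ => inputState_mem_out A B x y) h1 h2 h3 (by omega) hmdc)
      rintro s₁ ⟨a1, a2⟩
      apply Tot.block_cons (search_spec a1 a2 (bit_lt A) (bit_lt B) hn h5 h4 hmdc)
      rintro s₂ ⟨b1, b2⟩
      refine Tot.block_nil ⟨b1, fun x hx y hy hz => ?_⟩
      obtain ⟨k, hk, r, hr, h⟩ := hω x hx y hy hz
      exact b2 k hk r hr x hx y hy h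
    · unfold runTime
      omega
  obtain ⟨t, τ, s', e1, e2, e3, e4⟩ := key _ (rep_inputStore A B)
  refine ⟨t, τ, e1, e2, ?_⟩
  rw [e3.2.1]
  exact e4

theorem exists_witness_iff {n : ℕ} (A B : Matrix (Fin n) (Fin n) Bool) (i j : Fin n) :
    (∃ z, Witness n (bit A) (bit B) i j z) ↔ ∃ k, A i k = true ∧ B k j = true := by
  constructor
  · rintro ⟨z, hz, h1, h2⟩
    exact ⟨⟨z, hz⟩, (bit_eq_one_iff A i.2 hz).1 h1, (bit_eq_one_iff B hz j.2).1 h2⟩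
  · rintro ⟨k, h1, h2⟩
    exact ⟨k, k.2, (bit_eq_one_iff A i.2 k.2).2 h1, (bit_eq_one_iff B k.2 j.2).2 h2⟩

theorem outputsBool_of_valid {n : ℕ} {A B : Matrix (Fin n) (Fin n) Bool} {τ : State}
    (h : Valid false n (bit A) (bit B) τ.mem)
    (h' : ∀ x < n, ∀ y < n, (∃ z, Witness n (bit A) (bit B) x y z) →
      τ.mem (2 * (n * n) + (x * n + y)) ≠ 0) : OutputsBool (boolMul A B) τ := by
  intro i j
  have h1 := h i i.2 j j.2
  have h2 := h' i i.2 j j.2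
  rw [exists_witness_iff] at h2
  rw [add_assoc]
  by_cases hk : ∃ k, A i k = true ∧ B k j = true
  · obtain ⟨z, -, hz⟩ := h1 (h2 hk)
    rw [hz]
    simp [weight, boolMul, hk]
  · have : τ.mem (2 * (n * n) + (i * n + j)) = 0 := by
      by_contra h0
      obtain ⟨z, hz, -⟩ := h1 h0
      exact hk ((exists_witness_iff A B i j).1 ⟨z, hz⟩)
    simp [this, boolMul, hk]

theorem outputsWitness_of_valid {n : ℕ} {A B : Matrix (Fin n) (Fin n) Bool} {τ : State}
    (h : Valid true n (bit A) (bit B) τ.mem)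
    (h' : ∀ x < n, ∀ y < n, (∃ z, Witness n (bit A) (bit B) x y z) →
      τ.mem (2 * (n * n) + (x * n + y)) ≠ 0) :
    ∃ W : Matrix (Fin n) (Fin n) (Option (Fin n)), IsWitnessMatrix A B W ∧ OutputsWitness W τ := by
  have key (i j : Fin n) : ∃ o : Option (Fin n),
      ((∀ k, o = some k → A i k = true ∧ B k j = true) ∧
        (o = none → ∀ k, ¬ (A i k = true ∧ B k j = true))) ∧
      τ.mem (2 * (n * n) + i * n + j) = o.elim 0 (fun k => (k : ℕ) + 1) := by
    have h1 := h i i.2 j j.2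
    have h2 := h' i i.2 j j.2
    rw [exists_witness_iff] at h2
    rw [add_assoc]
    by_cases h0 : τ.mem (2 * (n * n) + (i * n + j)) = 0
    · refine ⟨none, ⟨by simp, fun _ k hk => h2 ⟨k, hk⟩ h0⟩, by simp [h0]⟩
    · obtain ⟨z, ⟨hz, hA, hB⟩, hzm⟩ := h1 h0
      refine ⟨some ⟨z, hz⟩, ⟨?_, by simp⟩, by simp [hzm, weight]⟩
      rintro k hk
      obtain rfl := Option.some.inj hk
      exact ⟨(bit_eq_one_iff A i.2 hz).1 hA, (bit_eq_one_iff B hz j.2).1 hB⟩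
  choose W hW using key
  exact ⟨W, fun i j => (hW i j).1, fun i j => (hW i j).2⟩

/-! ### The probability of success -/

theorem one_le_clog {n : ℕ} (hn : 2 ≤ n) : 1 ≤ Nat.clog 2 n := Nat.clog_pos (by norm_num) hn

/-- The scale is `⌊log₂ q / stepSize⌋`, which is below 64 because `log₂ q ≤ m < 64 * stepSize m`. -/
theorem exists_scale {n q : ℕ} (hq : 0 < q) (hqn : q ≤ n) :
    ∃ k < 64, k * stepSize (Nat.clog 2 n) ≤ Nat.clog 2 n ∧
      2 ^ (k * stepSize (Nat.clog 2 n)) ≤ q ∧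
      q < 2 ^ (k * stepSize (Nat.clog 2 n) + stepSize (Nat.clog 2 n)) := by
  set m := Nat.clog 2 n
  have hb : 0 < stepSize m := Nat.succ_pos _
  have h64 : m < 64 * stepSize m := by unfold stepSize; omega
  have hlog : Nat.log 2 q ≤ m := (Nat.log_mono_right hqn).trans (Nat.log_le_clog 2 n)
  have h1 : Nat.log 2 q / stepSize m * stepSize m ≤ Nat.log 2 q := Nat.div_mul_le_self _ _
  refine ⟨Nat.log 2 q / stepSize m, ?_, by omega,
    (Nat.pow_le_pow_right (by norm_num) h1).trans (Nat.pow_log_le_self 2 hq.ne'),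
    (Nat.lt_pow_succ_log_self (by norm_num) q).trans_le (Nat.pow_le_pow_right (by norm_num) ?_)⟩
  · rw [Nat.div_lt_iff_lt_mul hb]
    omega
  · have := Nat.lt_div_mul_add (a := Nat.log 2 q) hb
    omega

/-- Union bound over the `n ^ 2` entries: the exponent `(d + 2) * L` and `n ≤ 2 ^ L` give `n ^ 2 * n
^ (-(d + 2)) = n ^ (-d)`. -/
theorem measure_allIsolated {d R n : ℕ} (hn : 2 ≤ n) (α β : ℕ → ℕ → ℕ)
    (hR : ∀ L : ℕ, 1 ≤ L → ∀ φ : ℝ, 0 ≤ φ → φ ≤ 77 * (L * 0.99 ^ L) →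
      φ ≤ 1 - 1 / 2 ^ (4 * L * 2 ^ L) → φ ^ R ≤ (1 / 2) ^ ((d + 2) * L)) :
    1 - 1 / (n : ℝ) ^ d ≤ coinMeasure.real
      {ω | AllIsolated ω R n (Nat.clog 2 n) (depth (Nat.clog 2 n)) α β} := by
  classical
  set m := Nat.clog 2 n
  set L := depth m
  have hm : 1 ≤ m := one_le_clog hn
  have hL : 1 ≤ L := depth_pos hm
  have hmL : m ≤ L := le_depth hm
  have hnm : n ≤ 2 ^ m := Nat.le_pow_clog (by norm_num) n
  have hnL : n ≤ 2 ^ L := hnm.trans (Nat.pow_le_pow_right (by norm_num) hmL)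
  set bad : ℕ × ℕ → Set (ℕ → Bool) := fun v => {ω | (∃ z, Witness n α β v.1 v.2 z) ∧
    ∀ k < 64, ∀ r < R, ¬ IsolatesAt ω L m (m + k * stepSize m)
      (offset L m (stepSize m) R k + r * runBits L m (m + k * stepSize m)) v.1 v.2
      (Witness n α β v.1 v.2)} with hbad
  have hbad_le (v : ℕ × ℕ) (hv : v ∈ Finset.range n ×ˢ Finset.range n) :
      coinMeasure.real (bad v) ≤ (1 / 2) ^ ((d + 2) * L) := by
    obtain ⟨x, y⟩ := v
    simp only [Finset.mem_product, Finset.mem_range] at hv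
    by_cases hW : ∃ z, Witness n α β x y z
    · set S := (Finset.range n).filter (Witness n α β x y) with hS
      have hmem (z : ℕ) : z ∈ S ↔ Witness n α β x y z := by
        rw [hS, Finset.mem_filter, Finset.mem_range]
        exact ⟨fun h => h.2, fun h => ⟨h.1, h⟩⟩
      obtain ⟨z, hz⟩ := hW
      -- For each entry only the scale that fits its number of witnesses matters.
      obtain ⟨k, hk, h1, h2, h3⟩ := exists_scale
        (Finset.card_pos.2 ⟨z, (hmem z).2 hz⟩)
        ((Finset.card_filter_le _ _).trans (Finset.card_range n).le)
      obtain ⟨φ, g1, g2, g3, g4⟩ := repeated_failure m (k * stepSize m)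
        (offset L m (stepSize m) R k) R x y hm h1 (hv.1.trans_le hnm) (hv.2.trans_le hnm)
        (Witness n α β x y) S hmem (fun z hz => ((hmem z).1 hz).1.trans_le hnm) h2 h3
      refine le_trans (measureReal_mono ?_) (g4.trans (hR L hL φ g1 g2 g3))
      exact fun ω hω => hω.2 k hk
    · rw [show bad (x, y) = ∅ by simp [hbad, hW]]
      simp
  have hcover : {ω | AllIsolated ω R n m L α β} ∪
      ⋃ v ∈ Finset.range n ×ˢ Finset.range n, bad v = Set.univ := by
    refine Set.eq_univ_of_forall fun ω => ?_
    by_cases h : AllIsolated ω R n m L α β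
    · exact .inl h
    · right
      unfold AllIsolated at h
      push Not at h
      obtain ⟨x, hx, y, hy, hz, h⟩ := h
      simp only [Set.mem_iUnion, Finset.mem_product, Finset.mem_range]
      exact ⟨(x, y), ⟨hx, hy⟩, hz, h⟩
  have h1 : (1 : ℝ) ≤ coinMeasure.real {ω | AllIsolated ω R n m L α β} +
      coinMeasure.real (⋃ v ∈ Finset.range n ×ˢ Finset.range n, bad v) := by
    have := measureReal_union_le (μ := coinMeasure) {ω | AllIsolated ω R n m L α β}
      (⋃ v ∈ Finset.range n ×ˢ Finset.range n, bad v)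
    rwa [hcover, probReal_univ] at this
  have h2 : coinMeasure.real (⋃ v ∈ Finset.range n ×ˢ Finset.range n, bad v) ≤ 1 / (n : ℝ) ^ d := by
    refine (measureReal_biUnion_finset_le _ _).trans ((Finset.sum_le_sum hbad_le).trans ?_)
    rw [Finset.sum_const, Finset.card_product, Finset.card_range, nsmul_eq_mul, one_div_pow,
      mul_one_div, div_le_div_iff₀ (by positivity) (by positivity), one_mul, Nat.cast_mul]
    have hnL' : (n : ℝ) ≤ 2 ^ L := by exact_mod_cast hnL
    calc (n : ℝ) * n * n ^ d = n ^ (d + 2) := by ring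
      _ ≤ (2 ^ L) ^ (d + 2) := by gcongr
      _ = 2 ^ ((d + 2) * L) := by rw [← pow_mul, mul_comm]
  linarith

end Programs

/-! ### Word width and running time -/

theorem modulus_le {wit : Bool} {n : ℕ} (hn : 1 ≤ n) : modulus wit n ≤ 2 * n := by
  unfold modulus; split_ifs <;> omega

theorem base_le {wit : Bool} {n : ℕ} (hn : 1 ≤ n) : base wit n ≤ 7 * (n * n) := by
  have := Nat.mul_le_mul (modulus_le (wit := wit) hn) (modulus_le (wit := wit) hn)
  unfold base
  linarith [show 2 * n * (2 * n) = 4 * (n * n) by ring]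

theorem stepSize_le (m : ℕ) : 64 * stepSize m ≤ m + 64 := by
  unfold stepSize; omega

theorem wideEnough (wit : Bool) (R n : ℕ) (hn : 2 ≤ n) :
    WideEnough wit R n (Nat.clog 2 n) (depth (Nat.clog 2 n)) ((R + 100) * Nat.size n) := by
  have hσ : n < 2 ^ Nat.size n := Nat.lt_size_self n
  have hσ2 : 2 ≤ Nat.size n := Nat.lt_size.2 (by simpa using hn)
  have hmσ : Nat.clog 2 n ≤ Nat.size n := Nat.clog_le_of_le_pow hσ.le
  set m := Nat.clog 2 n
  set L := depth m
  set σ := Nat.size n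
  have hm : 1 ≤ m := one_le_clog hn
  have hL : L ≤ 2 * m := depth_le hm
  have hpow {a b : ℕ} (h : a ≤ b) : 2 ^ a ≤ 2 ^ b := Nat.pow_le_pow_right (by norm_num) h
  have hself (a : ℕ) : a < 2 ^ a := Nat.lt_two_pow_self
  have hstep := stepSize_le m
  -- Each quantity is at most a small multiple of `2 ^ (40 * σ)`, and `2 ^ 100` absorbs the
  -- constants. The summand 64 in `stepSize_le` is at most `32 * σ`, as `σ ≥ 2`.
  have hQ : 2 ^ 100 * 2 ^ (40 * σ) ≤ 2 ^ ((R + 100) * σ) := by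
    rw [← pow_add]
    refine hpow ?_
    nlinarith
  set Q := 2 ^ (40 * σ) with hQdef
  have hQ1 : 1 ≤ Q := Nat.one_le_two_pow
  have b1 : 2 ^ m ≤ Q := hpow (by omega)
  have b2 : 7 ^ L ≤ Q :=
    calc 7 ^ L ≤ (2 ^ 3) ^ L := Nat.pow_le_pow_left (by norm_num) L
      _ = 2 ^ (3 * L) := by rw [pow_mul]
      _ ≤ Q := hpow (by omega)
  have b3 : m * 8 ^ m ≤ Q :=
    calc m * 8 ^ m ≤ 2 ^ m * (2 ^ 3) ^ m := Nat.mul_le_mul (hself m).le le_rfl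
      _ = 2 ^ (m + 3 * m) := by rw [pow_add, pow_mul]
      _ ≤ Q := hpow (by omega)
  have b4 : R + 64 < 2 ^ ((R + 100) * σ) := by
    refine (hself _).trans_le (hpow ?_)
    nlinarith
  have b5 : base wit n ≤ 7 * Q := by
    refine (base_le (by omega)).trans (Nat.mul_le_mul_left _ ?_)
    calc n * n ≤ 2 ^ σ * 2 ^ σ := Nat.mul_le_mul hσ.le hσ.le
      _ = 2 ^ (σ + σ) := by rw [pow_add]
      _ ≤ Q := hpow (by omega)
  have b6 : runBits L m (m + 64 * stepSize m) ≤ Q :=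
    calc (2 * m + (m + 64 * stepSize m)) * 2 ^ L
        ≤ 2 ^ (2 * m + (m + 64 * stepSize m)) * 2 ^ L := Nat.mul_le_mul_right _ (hself _).le
      _ = 2 ^ (2 * m + (m + 64 * stepSize m) + L) := by rw [← pow_add]
      _ ≤ Q := hpow (by omega)
  have b7 : 6 ^ L ≤ Q := (Nat.pow_le_pow_left (by norm_num) L).trans b2
  have b8 : 2 ^ m * n ≤ Q :=
    calc 2 ^ m * n ≤ 2 ^ m * 2 ^ σ := Nat.mul_le_mul_left _ hσ.le
      _ = 2 ^ (m + σ) := by rw [pow_add]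
      _ ≤ Q := hpow (by omega)
  have b9 : 2 ^ (m + 64 * stepSize m) * n ≤ Q :=
    calc 2 ^ (m + 64 * stepSize m) * n ≤ 2 ^ (m + 64 * stepSize m) * 2 ^ σ :=
          Nat.mul_le_mul_left _ hσ.le
      _ = 2 ^ (m + 64 * stepSize m + σ) := by rw [← pow_add]
      _ ≤ Q := hpow (by omega)
  clear_value Q
  rw [WideEnough]
  generalize 2 ^ ((R + 100) * σ) = V at *
  norm_num at hQ
  exact ⟨by omega, by omega, by omega, b4, by omega⟩

/-- The logarithmic cost of each of the `4 ^ L` lookups is absorbed by the gap between 4 and 6, by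
means of `(L + 2) * 2 ^ L ≤ 2 * 3 ^ L`. -/
theorem add_two_mul_pow_le (L : ℕ) : (L + 2) * 4 ^ L ≤ 2 * 6 ^ L := by
  have h (L : ℕ) : (L + 2) * 2 ^ L ≤ 2 * 3 ^ L := by
    induction L with
    | zero => norm_num
    | succ L ih =>
      have := Nat.pow_le_pow_left (show 2 ≤ 3 by norm_num) L
      rw [pow_succ, pow_succ]
      linarith
  calc (L + 2) * 4 ^ L = (L + 2) * 2 ^ L * 2 ^ L := by
        rw [mul_assoc, ← mul_pow]; norm_num
    _ ≤ 2 * 3 ^ L * 2 ^ L := Nat.mul_le_mul_right _ (h L)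
    _ = 2 * 6 ^ L := by rw [mul_assoc, ← mul_pow]; norm_num

theorem runTime_le (wit : Bool) (R n : ℕ) (hn : 2 ≤ n) :
    runTime wit R n (Nat.clog 2 n) (depth (Nat.clog 2 n)) ≤
      (10 ^ 9 * (R + 1)) * 6 ^ depth (Nat.clog 2 n) := by
  have hnm : n ≤ 2 ^ Nat.clog 2 n := Nat.le_pow_clog (by norm_num) n
  set m := Nat.clog 2 n
  set L := depth m
  have hm : 1 ≤ m := one_le_clog hn
  have hmL : m ≤ L := le_depth hm
  have hstep := stepSize_le m
  have hL6 : L < 6 ^ L := Nat.lt_pow_self (by norm_num)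
  have h46 : 4 ^ L ≤ 6 ^ L := Nat.pow_le_pow_left (by norm_num) L
  have hnL : n ≤ 2 ^ L := hnm.trans (Nat.pow_le_pow_right (by norm_num) hmL)
  have hnn : n * n ≤ 6 ^ L := (Nat.mul_le_mul hnL hnL).trans (by rwa [← mul_pow])
  have hn1 : n ≤ n * n := Nat.le_mul_of_pos_left _ (by omega)
  have hbase := base_le (wit := wit) (n := n) (by omega)
  have h4 := add_two_mul_pow_le L
  have h5 : (L + m + m + (m + 64 * stepSize m) + 2) * 4 ^ L ≤ 140 * 6 ^ L :=
    calc (L + m + m + (m + 64 * stepSize m) + 2) * 4 ^ L ≤ (70 * (L + 2)) * 4 ^ L :=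
          Nat.mul_le_mul_right _ (by omega)
      _ = 70 * ((L + 2) * 4 ^ L) := by ring
      _ ≤ 70 * (2 * 6 ^ L) := Nat.mul_le_mul_left _ h4
      _ = 140 * 6 ^ L := by ring
  have h6 : R * (20000 * ((L + m + m + (m + 64 * stepSize m) + 2) * 4 ^ L + 6 ^ L) + 5) ≤
      R * (3000000 * 6 ^ L) := Nat.mul_le_mul_left _ (by omega)
  have h7 : (10 ^ 9 * (R + 1)) * 6 ^ L = 10 ^ 9 * (R * 6 ^ L) + 10 ^ 9 * 6 ^ L := by ring
  rw [show R * (3000000 * 6 ^ L) = 3000000 * (R * 6 ^ L) by ring] at h6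
  rw [h7, runTime]
  clear * - h6 hbase hnn hn1 hL6 hmL
  generalize R * (20000 * ((L + m + m + (m + 64 * stepSize m) + 2) * 4 ^ L + 6 ^ L) + 5) = u at *
  generalize R * 6 ^ L = v at *
  generalize 6 ^ L = t at *
  generalize n * n = q at *
  norm_num
  omega

/-! ### The rate -/

/-- `6 ^ 101 < 7 ^ 93` and `93 / 101 < 0.921`; note that `2.763 = 3 * 0.921`. -/
theorem log_six_div_log_seven_lt : Real.log 6 / Real.log 7 < 0.921 := by
  have h : (101 : ℕ) * Real.log 6 < (93 : ℕ) * Real.log 7 := by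
    rw [← Real.log_pow, ← Real.log_pow]
    exact Real.log_lt_log (by norm_num) (by norm_num)
  have h7 : 0 < Real.log 7 := Real.log_pos (by norm_num)
  rw [div_lt_iff₀ h7]
  push_cast at h
  linarith

theorem log_six_div_log_seven_pos : 0 < Real.log 6 / Real.log 7 :=
  div_pos (Real.log_pos (by norm_num)) (Real.log_pos (by norm_num))

/-- Since `3 * θ < 2.763` strictly, a positive power of `n` is left over to dominate the logarithm.
-/
theorem rate_isBigO : rate =O[Filter.atTop] fun n : ℕ => (n : ℝ) ^ (2.763 : ℝ) := by
  set θ := Real.log 6 / Real.log 7 with hθ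
  have h0 : 0 < θ := log_six_div_log_seven_pos
  have h1 : θ < 0.921 := log_six_div_log_seven_lt
  have hε : 0 < 2.763 / θ - 3 := by
    rw [sub_pos, lt_div_iff₀ h0]
    linarith
  have hlog : (fun n : ℕ => (n : ℝ) ^ 3 * Real.log n) =O[Filter.atTop]
      fun n : ℕ => (n : ℝ) ^ (2.763 / θ) := by
    have h2 := ((isLittleO_log_rpow_atTop hε).isBigO.comp_tendsto
      (tendsto_natCast_atTop_atTop (R := ℝ)))
    refine ((Asymptotics.isBigO_refl (fun n : ℕ => (n : ℝ) ^ 3) Filter.atTop).mul h2).congr'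
      (Filter.Eventually.of_forall fun n => rfl) ?_
    filter_upwards [Filter.eventually_gt_atTop 0] with n hn
    have hn' : (0 : ℝ) < n := by exact_mod_cast hn
    simp only [Function.comp]
    rw [← Real.rpow_natCast, ← Real.rpow_add hn']
    norm_num
  refine (hlog.rpow h0.le (Filter.Eventually.of_forall fun n => ?_)).congr'
    (Filter.Eventually.of_forall fun n => rfl) (Filter.Eventually.of_forall fun n => ?_)
  · exact Real.rpow_nonneg (Nat.cast_nonneg _) _
  · simp only
    rw [← Real.rpow_mul (Nat.cast_nonneg _), div_mul_cancel₀ _ h0.ne']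

/-- `6 ^ L = (7 ^ L) ^ θ` because `6 = 7 ^ θ`. The constant in `7 ^ L ≤ 168 * n ^ 3 * log n` is `7 *
3 * 8`, from rounding up `L`, from `m ≤ 3 * log n` and from `2 ^ m ≤ 2 * n`. -/
theorem six_pow_le_rate {n : ℕ} (hn : 2 ≤ n) :
    (6 : ℝ) ^ depth (Nat.clog 2 n) ≤ 168 * rate n := by
  set m := Nat.clog 2 n with hmdef
  set L := depth m
  set θ := Real.log 6 / Real.log 7 with hθ
  have h0 : 0 < θ := log_six_div_log_seven_pos
  have h1 : θ < 0.921 := log_six_div_log_seven_lt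
  have hm : 1 ≤ m := one_le_clog hn
  have h7 : (7 : ℝ) ^ L ≤ 7 * (m * 8 ^ m) := by exact_mod_cast (pow_depth_lt hm).le
  have hn0 : (0 : ℝ) < n := by positivity
  have hm1 : 2 ^ (m - 1) < n := Nat.pow_pred_clog_lt_self (by norm_num) (by omega)
  have hlog2 : 0.6931 < Real.log 2 := by linarith [Real.log_two_gt_d9]
  have hlogn : Real.log 2 ≤ Real.log n := Real.log_le_log (by norm_num) (by exact_mod_cast hn)
  have hmlog : (m : ℝ) ≤ 3 * Real.log n := by
    have h2 : ((m - 1 : ℕ) : ℝ) * Real.log 2 ≤ Real.log n := by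
      rw [← Real.log_pow]
      exact Real.log_le_log (by positivity) (by exact_mod_cast hm1.le)
    rw [Nat.cast_sub hm] at h2
    push_cast at h2
    nlinarith
  have h8 : (8 : ℝ) ^ m ≤ 8 * n ^ 3 := by
    have h2 : (2 : ℝ) ^ (m - 1) ≤ n := by exact_mod_cast hm1.le
    calc (8 : ℝ) ^ m = 8 * (2 ^ (m - 1)) ^ 3 := by
          rw [← pow_mul, mul_comm _ 3, pow_mul, show (2 : ℝ) ^ 3 = 8 by norm_num, ← pow_succ',
            Nat.sub_add_cancel hm]
      _ ≤ 8 * n ^ 3 := by gcongr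
  have hX : (7 : ℝ) ^ L ≤ 168 * (n ^ 3 * Real.log n) := by
    calc (7 : ℝ) ^ L ≤ 7 * (m * 8 ^ m) := h7
      _ ≤ 7 * (3 * Real.log n * (8 * n ^ 3)) := by gcongr
      _ = 168 * (n ^ 3 * Real.log n) := by ring
  have hnn : (0 : ℝ) ≤ n ^ 3 * Real.log n := by
    have : 0 ≤ Real.log n := by linarith
    positivity
  have h6 : (6 : ℝ) = 7 ^ θ := by
    rw [hθ, Real.rpow_def_of_pos (by norm_num), mul_div_cancel₀ _ (Real.log_pos (by norm_num)).ne',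
      Real.exp_log (by norm_num)]
  calc (6 : ℝ) ^ L = (7 ^ L) ^ θ := by
        conv_lhs => rw [h6]
        rw [← Real.rpow_natCast, ← Real.rpow_mul (by norm_num), mul_comm θ,
          Real.rpow_mul (by norm_num), Real.rpow_natCast]
    _ ≤ (168 * (n ^ 3 * Real.log n)) ^ θ := Real.rpow_le_rpow (by positivity) hX h0.le
    _ = 168 ^ θ * rate n := Real.mul_rpow (by norm_num) hnn
    _ ≤ 168 * rate n := by
        refine mul_le_mul_of_nonneg_right ?_ (Real.rpow_nonneg hnn _)
        exact Real.rpow_le_self_of_one_le (by norm_num) (by linarith)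

/-- Serves both problems: `Q` is any consequence of a final memory that is valid and nonzero
wherever a witness exists. The additional 2 in `d + 2` pays for the union bound over the entries. -/
theorem success (wit : Bool) (d : ℕ) : ∃ R : ℕ, ∀ n : ℕ, 2 ≤ n →
    ∀ (A B : Matrix (Fin n) (Fin n) Bool) (c : ℕ) (Q : State → Prop), modulus wit n ≤ 2 ^ c →
    (∀ τ : State, Valid wit n (bit A) (bit B) τ.mem →
      (∀ x < n, ∀ y < n, (∃ z, Witness n (bit A) (bit B) x y z) →
        τ.mem (2 * (n * n) + (x * n + y)) ≠ 0) → Q τ) →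
    1 - 1 / (n : ℝ) ^ d ≤ coinMeasure.real (successEvent ((R + 100) * Nat.size n) c
      (program wit R) A B (10 ^ 9 * (R + 1) * 168 * rate n) Q) := by
  obtain ⟨R, hR⟩ := exists_repetitions (d + 2)
  refine ⟨R, fun n hn A B c Q hc hQ => ?_⟩
  refine (measure_allIsolated hn (bit A) (bit B) hR).trans (measureReal_mono fun ω hω => ?_)
  obtain ⟨t, τ, h1, h2, h3, h4⟩ := program_spec A B (by omega) (wideEnough wit R n hn) hc hω
  refine ⟨t, τ, h1, ?_, hQ τ h3 h4⟩
  have h5 : (t : ℝ) ≤ 10 ^ 9 * (R + 1) * 6 ^ depth (Nat.clog 2 n) := by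
    exact_mod_cast h2.trans (runTime_le wit R n hn)
  refine h5.trans ?_
  rw [mul_assoc _ (168 : ℝ)]
  exact mul_le_mul_of_nonneg_left (six_pow_le_rate hn) (by positivity)

end BMM

theorem theorem1 :
    -- the rate is `O(n ^ 2.763)`
    (BMM.rate =O[Filter.atTop] fun n : ℕ => (n : ℝ) ^ (2.763 : ℝ)) ∧
    -- Boolean matrix multiplication, on a machine whose memory cells are single bits
    (∀ d : ℕ, ∃ (p : BMM.Prog) (κ : ℕ) (K : ℝ), ∀ n : ℕ, 2 ≤ n →
      ∀ A B : Matrix (Fin n) (Fin n) Bool,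
        1 - 1 / (n : ℝ) ^ d ≤
          BMM.coinMeasure.real
            (BMM.successEvent (κ * Nat.size n) 1 p A B (K * BMM.rate n)
              (BMM.OutputsBool (BMM.boolMul A B)))) ∧
    -- witnessing, on a machine whose memory cells are integers of `O(log n)` bits
    (∀ d : ℕ, ∃ (p : BMM.Prog) (κ : ℕ) (K : ℝ), ∀ n : ℕ, 2 ≤ n →
      ∀ A B : Matrix (Fin n) (Fin n) Bool,
        1 - 1 / (n : ℝ) ^ d ≤
          BMM.coinMeasure.real
            (BMM.successEvent (κ * Nat.size n) (κ * Nat.size n) p A B (K * BMM.rate n)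
              (fun τ => ∃ W : Matrix (Fin n) (Fin n) (Option (Fin n)),
                BMM.IsWitnessMatrix A B W ∧ BMM.OutputsWitness W τ))) := by
  refine ⟨BMM.rate_isBigO, fun d => ?_, fun d => ?_⟩
  · obtain ⟨R, hR⟩ := BMM.success false d
    -- The modulus is 2, so one-bit cells suffice.
    exact ⟨_, _, _, fun n hn A B => hR n hn A B 1 _ (by simp [BMM.modulus])
      fun τ h h' => BMM.outputsBool_of_valid h h'⟩
  · obtain ⟨R, hR⟩ := BMM.success true d
    refine ⟨_, _, _, fun n hn A B => hR n hn A B _ _ ?_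
      fun τ h h' => BMM.outputsWitness_of_valid h h'⟩
    -- The cells must hold residues modulo `n + 1`, the largest being `n < 2 ^ Nat.size n`.
    have h1 : n < 2 ^ Nat.size n := Nat.lt_size_self n
    have h2 : 2 ^ Nat.size n ≤ 2 ^ ((R + 100) * Nat.size n) :=
      Nat.pow_le_pow_right (by norm_num) (Nat.le_mul_of_pos_left _ (by omega))
    simp only [BMM.modulus, if_true]
    omega
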